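/- **Setting.** Fix an integer $r\ge 1$ and $\lambda\in\{1,-1\}$. For $K\in\mathbb N=\{0,1,2,\dots\}$ and $\delta x>0$ let $V_{\delta x}=\mathbb C^{2K+1}$, with vectors $u=(u_j)_{-K\le j\le K}$ extended by $u_j=0$ for $|j|>K$, with the norm $$\|u\|_{\delta x}^2=2\,\delta x\sum_{j\in\mathbb Z}\frac{|u_{j+1}-u_j|^2}{\delta x^2}+\delta x\sum_{j\in\mathbb Z}|u_j|^2,$$ and put $B_{\delta x}(\rho)=\{u\in V_{\delta x}:\|u\|_{\delta x}\le\rho\}$. Let $A=\delta x^{-2}\,\mathrm{tridiag}(-1,2,-1)$, $f(u)_j=\lambda|u_j|^{2r}u_j$ and $R(hA)=\bigl(1+\tfrac{ihA}2\bigr)\bigl(1-\tfrac{ihA}2\bigr)^{-1}$. For $\varepsilon,h\ge0$ and $u\in V_{\delta x}$ let $$F_{\varepsilon,h,u}(v)=u+i\varepsilon\Bigl(1+\frac{ihA}2\Bigr)^{-1}f\Bigl(\frac{u+R(hA)v}2\Bigr).$$ Call $u$ *permissible* for $(\varepsilon,h)$ if $F_{\varepsilon,h,u}$ maps $B_{\delta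 x}(2\|u\|_{\delta x})$ into itself and is a contraction there with respect to $\|\cdot\|_{\delta x}$; then $\Psi^h_\varepsilon(u)$ denotes its unique fixed point in $B_{\delta x}(2\|u\|_{\delta x})$. Put $\Psi^h=\Psi^h_h$. A map is *symplectic* at $u$ if it is real differentiable at $u$ and its Jacobian $M$ in the coordinates $(\mathrm{Re}\,u,\mathrm{Im}\,u)$ satisfies $M^TJM=J$, where $J=\begin{pmatrix}0&I\\-I&0\end{pmatrix}$. For a smooth $H:V_{\delta x}\to\mathbb R$ let $X_H=i\,\delta x^{-1}\nabla_{\bar u}H$, where $\partial/\partial\bar u_j=\frac12\bigl(\partial/\partial\,\mathrm{Re}\,u_j+i\,\partial/\partial\,\mathrm{Im}\,u_j\bigr)$, and let $\Phi^t_H$ be the flow of $X_H$. A *homogeneous polynomial* on $V_{\delta x}$ means one in the real coordinates $(\mathrm{Re}\,u_j,\mathrm{Im}\,u_j)_j$; a vector field is a homogeneous polynomial vector field if the real and imaginary parts of its components are homogeneous polynomials (of the same degree). **Proposition 3.3.** 1. There is $c>0$, independent of $K,\delta x,h,\varepsilon$, such that every $u\in V_{\delta x}$ with $\varepsilon\|u\|_{\delta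 x}^{2r}\le c$ is permissible for $(\varepsilon,h)$. For all $K$, $\delta x>0$ and $\varepsilon,h\ge0$, the map $\Psi^h_\varepsilon$ is well defined on the set of permissible $u$ and symplectic at every interior point of this set. In particular this holds for $\Psi^h=\Psi^h_h$. 2. There are functions $P_{k,h}:V_{\delta x}\to\mathbb R$ ($k\ge0$, $h\ge0$; depending also on $K$ and $\delta x$), the coefficients of a formal real Hamiltonian $P_h=P_{0,h}+\sum_{k\ge1}h^kP_{k,h}$, such that $$P_{0,h}(u)=\frac{\lambda}{r+1}\,\delta x\sum_{\ell=-K}^{K}\Bigl|\Bigl(\bigl(1-\tfrac{ihA}2\bigr)^{-1}u\Bigr)_\ell\Bigr|^{2r+2},$$ each $P_{k,h}$ is a real-valued homogeneous polynomial of degree $2r(k+1)+2$, and $$|P_{k,h}(u)|\le C^{(k)}\|u\|_{\delta x}^{2r(k+1)+2}\qquad\text{for all }u\in V_{\delta x},$$ with $C^{(k)}>0$ independent of $K,\delta x,h$, and such that the following holds for every $N\ge0$, with $P_h^{(N)}=P_{0,h}+\sum_{k=1}^Nh^kP_{k,h}$. There are constants $\tilde C_N,C_N>0$ independent of $K,\delta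 x,h$, and, for $\ell\ge N+2$ and $h\ge0$, homogeneous polynomial vector fields $\mathcal R^{(N)}_{h,\ell}$ of degree $2r\ell+1$ on $V_{\delta x}$ with $$\bigl\|\mathcal R^{(N)}_{h,\ell}(u)\bigr\|_{\delta x}\le\tilde C_N\,C_N^{\,\ell}\,\|u\|_{\delta x}^{2r\ell+1}\qquad\text{for all }u\in V_{\delta x},$$ such that for every $R>0$ there is $\tau>0$, independent of $K,\delta x$, such that for all $K$, all $\delta x>0$, all $h\in[0,\tau)$ and all $u\in B_{\delta x}(R)$: $u$ is permissible for $(h,h)$, the flow of $X_{P_h^{(N)}}$ starting at $u$ exists on $[0,h]$, and $$\Psi^h(u)=\Phi^h_{P_h^{(N)}}(u)+\sum_{\ell=N+2}^\infty h^\ell\,\mathcal R^{(N)}_{h,\ell}(u),$$ where the series converges. -/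

import Mathlib

open scoped Matrix

noncomputable section

namespace MidpointNLS

/-- The grid indices `-K, …, K`. -/
abbrev Grid (K : ℕ) : Type := {j : ℤ // j ∈ Finset.Icc (-(K : ℤ)) (K : ℤ)}

/-- The space of grid functions, `ℂ^(2K+1)`. -/
abbrev V (K : ℕ) : Type := Grid K → ℂ

/-- Extension of a grid function by zero to all of `ℤ`. -/
def zeroExt {K : ℕ} (u : V K) (j : ℤ) : ℂ :=
  if hj : j ∈ Finset.Icc (-(K : ℤ)) (K : ℤ) then u ⟨j, hj⟩ else 0

/-- The discrete `H¹` norm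
`‖u‖² = 2 δx ∑_{j ∈ ℤ} |u_{j+1} - u_j|² / δx² + δx ∑_{j ∈ ℤ} |u_j|²`, where `u` is extended by zero.
All terms of the two sums outside the ranges written here vanish. -/
def dnorm {K : ℕ} (δx : ℝ) (u : V K) : ℝ :=
  Real.sqrt
    (2 * δx * ∑ j ∈ Finset.Icc (-(K : ℤ) - 1) (K : ℤ), ‖zeroExt u (j + 1) - zeroExt u j‖ ^ 2 / δx ^ 2
      + δx * ∑ j : Grid K, ‖u j‖ ^ 2)

/-- The closed ball of radius `R` about `0` in the discrete norm. -/
def dball (K : ℕ) (δx R : ℝ) : Set (V K) := {u | dnorm δx u ≤ R}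

/-- The tridiagonal matrix `A = δx⁻² tridiag(-1, 2, -1)`. -/
def lapA (K : ℕ) (δx : ℝ) : Matrix (Grid K) (Grid K) ℂ :=
  fun i j => ((δx ^ 2 : ℝ) : ℂ)⁻¹ *
    (if (i : ℤ) = j then 2 else if (i : ℤ) = j + 1 ∨ (j : ℤ) = i + 1 then -1 else 0)

/-- `1 + i h A / 2`. -/
def opPlus (K : ℕ) (δx h : ℝ) : Matrix (Grid K) (Grid K) ℂ :=
  1 + (Complex.I * (h : ℂ) / 2) • lapA K δx

/-- `1 - i h A / 2`. -/
def opMinus (K : ℕ) (δx h : ℝ) : Matrix (Grid K) (Grid K) ℂ :=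
  1 - (Complex.I * (h : ℂ) / 2) • lapA K δx

/-- The stability function `R(hA) = (1 + i h A / 2) (1 - i h A / 2)⁻¹` of the midpoint rule.
(For real `h` the matrix `1 - i h A / 2` is invertible, as `A` is Hermitian.) -/
def stab (K : ℕ) (δx h : ℝ) : Matrix (Grid K) (Grid K) ℂ :=
  opPlus K δx h * (opMinus K δx h)⁻¹

/-- The nonlinearity `f(u)_ℓ = λ |u_ℓ|^{2r} u_ℓ`. -/
def nonlin (r : ℕ) (lam : ℝ) {K : ℕ} (u : V K) : V K :=
  fun j => (lam : ℂ) * ((‖u j‖ ^ (2 * r) : ℝ) : ℂ) * u j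

/-- The fixed-point map
`F_{ε,h,u}(v) = u + i ε (1 + i h A / 2)⁻¹ f((u + R(hA) v) / 2)`. -/
def fixMap (r : ℕ) (lam : ℝ) {K : ℕ} (δx ε h : ℝ) (u v : V K) : V K :=
  u + (Complex.I * (ε : ℂ)) •
    ((opPlus K δx h)⁻¹ *ᵥ nonlin r lam ((1 / 2 : ℂ) • (u + stab K δx h *ᵥ v)))

/-- The set of those `u` for which the construction of `Ψ^h_ε(u)` by a contraction is permissible:
`F_{ε,h,u}` maps the closed ball of radius `2‖u‖` to itself and is a contraction there. -/
def permissible (r : ℕ) (lam : ℝ) (K : ℕ) (δx ε h : ℝ) : Set (V K) :=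
  {u | Set.MapsTo (fixMap r lam δx ε h u)
        (dball K δx (2 * dnorm δx u)) (dball K δx (2 * dnorm δx u)) ∧
      ∃ q : ℝ, 0 ≤ q ∧ q < 1 ∧
        ∀ v ∈ dball K δx (2 * dnorm δx u), ∀ w ∈ dball K δx (2 * dnorm δx u),
          dnorm δx (fixMap r lam δx ε h u v - fixMap r lam δx ε h u w)
            ≤ q * dnorm δx (v - w)}

open Classical in
/-- The map `Ψ^h_ε`: the value at `u` is the fixed point of `F_{ε,h,u}` in the closed ball of
radius `2‖u‖` (unique for permissible `u`; the value `u` is a placeholder if there is none). -/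
def Psi (r : ℕ) (lam : ℝ) {K : ℕ} (δx ε h : ℝ) (u : V K) : V K :=
  if hu : ∃ v ∈ dball K δx (2 * dnorm δx u), fixMap r lam δx ε h u v = v then hu.choose else u

/-- The Jacobian of `Φ` at `u` in the real coordinates `(Re u, Im u)`, as a block matrix. -/
def realJacobian {K : ℕ} (Φ : V K → V K) (u : V K) :
    Matrix (Grid K ⊕ Grid K) (Grid K ⊕ Grid K) ℝ :=
  Matrix.fromBlocks
    (Matrix.of fun i j => (fderiv ℝ Φ u (Pi.single j 1) i).re)
    (Matrix.of fun i j => (fderiv ℝ Φ u (Pi.single j Complex.I) i).re)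
    (Matrix.of fun i j => (fderiv ℝ Φ u (Pi.single j 1) i).im)
    (Matrix.of fun i j => (fderiv ℝ Φ u (Pi.single j Complex.I) i).im)

/-- The matrix `J = (0, I; -I, 0)`. -/
def sympJ (K : ℕ) : Matrix (Grid K ⊕ Grid K) (Grid K ⊕ Grid K) ℝ :=
  Matrix.fromBlocks 0 1 (-1) 0

/-- `Φ` is (real) differentiable at `u`, and its Jacobian `M` there satisfies `Mᵀ J M = J`. -/
def IsSymplecticAt {K : ℕ} (Φ : V K → V K) (u : V K) : Prop :=
  DifferentiableAt ℝ Φ u ∧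
    (realJacobian Φ u)ᵀ * sympJ K * realJacobian Φ u = sympJ K

/-- The gradient with respect to `ū`: `∂H/∂ū_j = (∂H/∂(Re u_j) + i ∂H/∂(Im u_j)) / 2`. With
`u = (p + i q) / √2` this is `(∂H/∂p_j + i ∂H/∂q_j) / √2`. -/
def gradBar {K : ℕ} (H : V K → ℝ) (u : V K) : V K :=
  fun j => (((fderiv ℝ H u (Pi.single j 1) : ℝ) : ℂ)
    + Complex.I * ((fderiv ℝ H u (Pi.single j Complex.I) : ℝ) : ℂ)) / 2

/-- The Hamiltonian vector field `X_H = i δx⁻¹ ∇_ū H`. -/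
def hamField {K : ℕ} (δx : ℝ) (H : V K → ℝ) (u : V K) : V K :=
  (Complex.I * (δx : ℂ)⁻¹) • gradBar H u

/-- `v` is the value at time `t ≥ 0` of the flow of the vector field `X` started at `u`: there is
a solution `y` of `y' = X(y)` on `[0, t]` with `y(0) = u` and `y(t) = v`. -/
def IsFlowValue {K : ℕ} (X : V K → V K) (t : ℝ) (u v : V K) : Prop :=
  ∃ y : ℝ → V K, y 0 = u ∧ y t = v ∧
    ∀ s ∈ Set.Icc 0 t, HasDerivWithinAt y (X (y s)) (Set.Icc 0 t) s

/-- `P` is a real-valued homogeneous polynomial of degree `d` in the real coordinates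
`(Re u_j, Im u_j)`. -/
def IsHomPoly {K : ℕ} (d : ℕ) (P : V K → ℝ) : Prop :=
  ∃ p : MvPolynomial (Grid K ⊕ Grid K) ℝ, p.IsHomogeneous d ∧
    ∀ u : V K, P u = MvPolynomial.eval (Sum.elim (fun j => (u j).re) (fun j => (u j).im)) p

/-- `X` is a homogeneous polynomial vector field of degree `d`. -/
def IsHomPolyField {K : ℕ} (d : ℕ) (X : V K → V K) : Prop :=
  ∀ j : Grid K, IsHomPoly d (fun u => (X u j).re) ∧ IsHomPoly d (fun u => (X u j).im)

/-- The nonlinear part `λ/(r+1) δx ∑_ℓ |u_ℓ|^{2r+2}` of the energy. -/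
def nonlinEnergy (r : ℕ) (lam : ℝ) {K : ℕ} (δx : ℝ) (u : V K) : ℝ :=
  lam / (r + 1) * δx * ∑ j : Grid K, ‖u j‖ ^ (2 * r + 2)

/-- `P_{0,h}`: the nonlinear part of the energy composed with `(1 - i h A / 2)⁻¹`. -/
def P0 (r : ℕ) (lam : ℝ) {K : ℕ} (δx h : ℝ) (u : V K) : ℝ :=
  nonlinEnergy r lam δx ((opMinus K δx h)⁻¹ *ᵥ u)

/-- The truncation `∑_{k=0}^N h^k P_k` of a formal Hamiltonian with coefficients `P_k`. -/
def truncHam {K : ℕ} (P : ℕ → V K → ℝ) (N : ℕ) (h : ℝ) (u : V K) : ℝ :=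
  ∑ k ∈ Finset.range (N + 1), h ^ k * P k u

end MidpointNLS

end

noncomputable section

namespace MidpointNLS

open Set Filter Topology Metric
open scoped ContDiff

/-! ### Small perturbations of the identity -/

section Solve

variable {Y : Type*} [NormedAddCommGroup Y]

/-! The norm `dnorm` comes from the inner product 2δx⟨u,Av⟩ + δx⟨u,v⟩ (`inner_gridEmbed`), for which
A is self-adjoint. So (1±ihA/2)⁻¹ are contractions and R(hA) is an isometry for every K, δx and h,
while a discrete Sobolev inequality makes the norm submultiplicative up to a factor 2
(`dnorm_mul_le`). The h multiplying A can therefore be frozen as a parameter, and the constants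
depend only on r and on the order of truncation.

In terms of the stage y = u + ½(1+ihA/2)(v-u) the fixed-point equation with ε = 1 reads y = u +
g(y)/2, v = u + T g(y), where g(y) = i f((1-ihA/2)⁻¹y) and T = (1+ihA/2)⁻¹ (`half_add_stab`). As g
is homogeneous of degree 2r+1, replacing u by zu with z^{2r} = h turns the step of size h into a
unit step near 0 (`Psi_eq_scheme`): expanding in h means expanding in homogeneous parts. To make
Cauchy's estimates available the problem is polarized: |u|^{2r}u becomes p^{r+1}q^r on pairs (p,q),
with the pairs (u,ū) as real points, and the scheme becomes holomorphic (`gridSystem`).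

The modified field is built degree by degree, adding each time the lowest homogeneous part of the
defect, i.e. of the scheme minus the time-one flow of the field found so far. Multiplication by a
primitive 2r-th root of unity commutes with all ingredients, so only degrees 2rl+1 occur and each
correction raises the order of the defect by 2r (`isBigO_defect`). The scheme and the flow of a
Hamiltonian truncation both preserve the symplectic form; comparing their derivatives at lowest
order shows that the next coefficient is Hamiltonian too (`field_hamiltonian`). Cauchy's estimates
on a ball common to all systems (`exists_small`) bound the coefficients and the remainder, which is
the Taylor series of the defect. Equivariance under conjugation restricts everything to the real
points, where Euler's identity integrates each homogeneous field to a Hamiltonian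
(`hasFDerivAt_gridHam`).

For part 1, permissibility is an explicit contraction estimate. At interior points Ψ is
differentiable by the implicit function theorem, because the derivative of the fixed-point map in v
is a strict contraction even when the fixed point lies on the boundary of the ball. Symplecticity
follows by differentiating the fixed-point equation (`imForm_fderiv_Psi`). -/

/-- `G` vanishes at `0` and is Lipschitz with constant `1/2` on the closed ball of radius `ρ`. -/
structure HalfLip (G : Y → Y) (ρ : ℝ) : Prop where
  zero : G 0 = 0
  lip : ∀ y z, ‖y‖ ≤ ρ → ‖z‖ ≤ ρ → ‖G y - G z‖ ≤ 1 / 2 * ‖y - z‖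

open Classical in
/-- A solution of `y = x + G y` with `‖y‖ ≤ 2 ‖x‖`, if there is one. -/
def solve (G : Y → Y) (x : Y) : Y :=
  if h : ∃ y, ‖y‖ ≤ 2 * ‖x‖ ∧ y = x + G y then h.choose else x

namespace HalfLip

variable {G : Y → Y} {ρ : ℝ}

lemma norm_le (hG : HalfLip G ρ) {y : Y} (hy : ‖y‖ ≤ ρ) : ‖G y‖ ≤ 1 / 2 * ‖y‖ := by
  have := hG.lip y 0 hy (by simpa using (norm_nonneg y).trans hy)
  simpa [hG.zero] using this

variable [CompleteSpace Y]

lemma exists_solution (hG : HalfLip G ρ) {x : Y} (hx : 2 * ‖x‖ ≤ ρ) :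
    ∃ y, ‖y‖ ≤ 2 * ‖x‖ ∧ y = x + G y := by
  set s : Set Y := closedBall 0 (2 * ‖x‖)
  have hmem : ∀ y, y ∈ s ↔ ‖y‖ ≤ 2 * ‖x‖ := fun y => by simp [s]
  have hsf : MapsTo (fun y => x + G y) s s := by
    intro y hy
    rw [hmem] at hy ⊢
    have h1 := hG.norm_le (hy.trans hx)
    have h2 := norm_add_le x (G y)
    linarith
  have hc : ContractingWith (1 / 2) (hsf.restrict (fun y => x + G y) s s) := by
    refine ⟨by rw [div_lt_one (by norm_num)]; norm_num, LipschitzWith.of_dist_le_mul ?_⟩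
    rintro ⟨y, hy⟩ ⟨z, hz⟩
    rw [hmem] at hy hz
    have := hG.lip y z (hy.trans hx) (hz.trans hx)
    rw [Subtype.dist_eq, Subtype.dist_eq, dist_eq_norm, dist_eq_norm]
    change ‖(x + G y) - (x + G z)‖ ≤ _ * ‖y - z‖
    simpa using this
  have h0 : (0 : Y) ∈ s := by rw [hmem]; simp
  obtain ⟨y, hy, hfix, -⟩ := hc.exists_fixedPoint' isClosed_closedBall.isComplete hsf h0
    (edist_ne_top _ _)
  exact ⟨y, (hmem y).1 hy, hfix.symm⟩

lemma solve_spec (hG : HalfLip G ρ) {x : Y} (hx : 2 * ‖x‖ ≤ ρ) :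
    ‖solve G x‖ ≤ 2 * ‖x‖ ∧ solve G x = x + G (solve G x) := by
  have h := hG.exists_solution hx
  rw [solve, dif_pos h]
  exact h.choose_spec

lemma norm_solve_le (hG : HalfLip G ρ) {x : Y} (hx : 2 * ‖x‖ ≤ ρ) :
    ‖solve G x‖ ≤ 2 * ‖x‖ := (hG.solve_spec hx).1

lemma solve_eq (hG : HalfLip G ρ) {x : Y} (hx : 2 * ‖x‖ ≤ ρ) :
    solve G x = x + G (solve G x) := (hG.solve_spec hx).2

/-- Subtracting the two equations, the difference of the `G` terms is at most half of ‖y - y'‖ and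
is absorbed on the left. Uniqueness and the Lipschitz bound for `solve` both follow. -/
lemma dist_le (hG : HalfLip G ρ) {x x' y y' : Y} (hy : ‖y‖ ≤ ρ) (hy' : ‖y'‖ ≤ ρ)
    (h : y = x + G y) (h' : y' = x' + G y') : ‖y - y'‖ ≤ 2 * ‖x - x'‖ := by
  have h1 := hG.lip y y' hy hy'
  have h2 : y - y' = (x - x') + (G y - G y') := by
    conv_lhs => rw [h, h']
    abel
  have h3 : ‖y - y'‖ ≤ ‖x - x'‖ + ‖G y - G y'‖ := by rw [h2]; exact norm_add_le _ _
  linarith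

lemma solve_unique (hG : HalfLip G ρ) {x y : Y} (hx : 2 * ‖x‖ ≤ ρ) (hy : ‖y‖ ≤ ρ)
    (h : y = x + G y) : solve G x = y := by
  have hs := hG.solve_spec hx
  have := hG.dist_le (hs.1.trans hx) hy hs.2 h
  rw [sub_self, norm_zero, mul_zero] at this
  exact sub_eq_zero.1 (norm_le_zero_iff.1 this)

lemma norm_solve_sub_le (hG : HalfLip G ρ) {x x' : Y} (hx : 2 * ‖x‖ ≤ ρ) (hx' : 2 * ‖x'‖ ≤ ρ) :
    ‖solve G x - solve G x'‖ ≤ 2 * ‖x - x'‖ :=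
  hG.dist_le ((hG.norm_solve_le hx).trans hx) ((hG.norm_solve_le hx').trans hx')
    (hG.solve_eq hx) (hG.solve_eq hx')

/-- By uniqueness, since `S` maps the solution for `x` to a solution for `S x`. Only additivity is
asked of `S`, so that complex conjugation is admitted besides roots of unity. -/
lemma solve_equivariant (hG : HalfLip G ρ) {S : Y → Y} (hadd : ∀ x y, S (x + y) = S x + S y)
    (hnorm : ∀ x, ‖S x‖ = ‖x‖) (hSG : ∀ y, G (S y) = S (G y)) {x : Y} (hx : 2 * ‖x‖ ≤ ρ) :
    solve G (S x) = S (solve G x) := by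
  refine hG.solve_unique (by rwa [hnorm]) ?_ ?_
  · rw [hnorm]; exact (hG.norm_solve_le hx).trans hx
  · rw [hSG, ← hadd, ← hG.solve_eq hx]

variable [NormedSpace ℂ Y]

lemma norm_fderiv_le (hG : HalfLip G ρ) {y : Y} (hy : ‖y‖ < ρ) : ‖fderiv ℂ G y‖ ≤ 1 / 2 := by
  have hn : ball (0 : Y) ρ ∈ 𝓝 y := isOpen_ball.mem_nhds (by simpa using hy)
  refine norm_fderiv_le_of_lipschitzOn ℂ (C := 1 / 2) hn ?_ |>.trans (by simp)
  refine LipschitzOnWith.of_dist_le_mul fun a ha b hb => ?_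
  have := hG.lip a b (by simpa using (mem_ball_zero_iff.1 ha).le)
    (by simpa using (mem_ball_zero_iff.1 hb).le)
  simpa [dist_eq_norm] using this

/-- Inverse function theorem for id - G, whose derivative is invertible by a Neumann series because
‖G'‖ ≤ 1/2. -/
lemma analyticAt_solve (hG : HalfLip G ρ) (hGc : ContDiff ℂ ω G) {x : Y} (hx : 2 * ‖x‖ < ρ) :
    AnalyticAt ℂ (solve G) x := by
  set y := solve G x with hy
  have hyρ : ‖y‖ < ρ := (hG.norm_solve_le hx.le).trans_lt hx
  set f : Y → Y := fun z => z - G z with hf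
  have hfc : ContDiff ℂ ω f := contDiff_id.sub hGc
  have hlt : ‖fderiv ℂ G y‖ < 1 := (hG.norm_fderiv_le hyρ).trans_lt (by norm_num)
  set e : Y ≃L[ℂ] Y := ContinuousLinearEquiv.unitsEquiv ℂ Y (Units.oneSub (fderiv ℂ G y) hlt)
  have hfd : HasFDerivAt f (e : Y →L[ℂ] Y) y := by
    have : (e : Y →L[ℂ] Y) = ContinuousLinearMap.id ℂ Y - fderiv ℂ G y := by
      ext v; simp [e, Units.oneSub]
    rw [this]
    exact (hasFDerivAt_id y).sub ((hGc.differentiable (by simp)) y).hasFDerivAt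
  have hfx : f y = x := by
    have := hG.solve_eq hx.le
    simp only [hf]; rw [sub_eq_iff_eq_add]; exact this
  have hloc := hfc.contDiffAt.to_localInverse hfd (by simp)
  rw [hfx] at hloc
  have hnear : ∀ᶠ x' in 𝓝 x, 2 * ‖x'‖ < ρ :=
    (continuous_const.mul continuous_norm).continuousAt.eventually_lt continuousAt_const hx
  have hcont : Tendsto (solve G) (𝓝 x) (𝓝 y) := by
    rw [tendsto_iff_norm_sub_tendsto_zero]
    have h0 : Tendsto (fun x' => 2 * ‖x' - x‖) (𝓝 x) (𝓝 0) := by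
      have : Continuous fun x' : Y => 2 * ‖x' - x‖ := by fun_prop
      simpa using this.tendsto x
    refine squeeze_zero' (Eventually.of_forall fun _ => norm_nonneg _) ?_ h0
    filter_upwards [hnear] with x' hx'
    exact hG.norm_solve_sub_le hx'.le hx.le
  -- The local inverse is a left inverse only near y; continuity of `solve G` at x is what brings
  -- `solve G x'` into that neighbourhood.
  have hev : ∀ᶠ x' in 𝓝 x, hfc.contDiffAt.localInverse hfd (by simp) x' = solve G x' := by
    have h1 := hcont.eventually
      ((hfc.contDiffAt.hasStrictFDerivAt' hfd (by simp)).eventually_left_inverse)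
    filter_upwards [h1, hnear] with x' hx' hx''
    have h2 : f (solve G x') = x' := by
      simp only [hf]; rw [sub_eq_iff_eq_add]; exact hG.solve_eq hx''.le
    rw [h2] at hx'
    exact hx'
  exact (hloc.congr_of_eventuallyEq (hev.mono fun _ h => h.symm)).analyticAt

lemma fderiv_solve (hG : HalfLip G ρ) (hGc : ContDiff ℂ ω G) {x : Y} (hx : 2 * ‖x‖ < ρ) (a : Y) :
    fderiv ℂ (solve G) x a = a + fderiv ℂ G (solve G x) (fderiv ℂ (solve G) x a) := by
  have hd := (hG.analyticAt_solve hGc hx).differentiableAt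
  have hnear : ∀ᶠ x' in 𝓝 x, 2 * ‖x'‖ < ρ :=
    (continuous_const.mul continuous_norm).continuousAt.eventually_lt continuousAt_const hx
  have hev : solve G =ᶠ[𝓝 x] fun x' => x' + G (solve G x') := by
    filter_upwards [hnear] with x' hx'
    exact hG.solve_eq hx'.le
  have h2 : HasFDerivAt (fun x' => x' + G (solve G x'))
      (ContinuousLinearMap.id ℂ Y + (fderiv ℂ G (solve G x)).comp (fderiv ℂ (solve G) x)) x :=
    (hasFDerivAt_id x).add
      (((hGc.differentiable (by simp)) (solve G x)).hasFDerivAt.comp x hd.hasFDerivAt)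
  have h3 : fderiv ℂ (solve G) x = _ := (h2.congr_of_eventuallyEq hev).fderiv
  conv_lhs => rw [h3]
  rfl

end HalfLip

end Solve

end MidpointNLS

end

noncomputable section

namespace MidpointNLS

open Set Filter Topology Metric Asymptotics
open scoped ContDiff Nat

/-! ### Homogeneous parts of analytic maps -/

section HomPart

variable {E F : Type*} [NormedAddCommGroup E] [NormedSpace ℂ E]
  [NormedAddCommGroup F] [NormedSpace ℂ F] [CompleteSpace F]

/-- The homogeneous part of degree `n` of the Taylor expansion of `f` at `0`. -/
def homPart (n : ℕ) (f : E → F) (x : E) : F :=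
  (n ! : ℂ)⁻¹ • iteratedFDeriv ℂ n f 0 (fun _ => x)

lemma homPart_smul (n : ℕ) (f : E → F) (c : ℂ) (x : E) :
    homPart n f (c • x) = c ^ n • homPart n f x := by
  have h := (iteratedFDeriv ℂ n f 0).map_smul_univ (fun _ => c) (fun _ => x)
  simp only [Finset.prod_const, Finset.card_univ, Fintype.card_fin] at h
  rw [homPart, h, smul_comm, homPart]

lemma homPart_sub {f g : E → F} (hf : AnalyticAt ℂ f 0) (hg : AnalyticAt ℂ g 0) (n : ℕ) (x : E) :
    homPart n (fun y => f y - g y) x = homPart n f x - homPart n g x := by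
  have h := iteratedFDeriv_sub_apply (𝕜 := ℂ) (i := n) (x := (0 : E)) hf.contDiffAt hg.contDiffAt
  have h' : (fun y => f y - g y) = f - g := rfl
  rw [homPart, h', h, _root_.sub_apply, smul_sub]
  rfl

/-- A power series is not unique as a family of multilinear maps, but its diagonal values are. -/
lemma exists_homPart_eq {f : E → F} (hf : AnalyticAt ℂ f 0) :
    ∃ p : FormalMultilinearSeries ℂ E F, HasFPowerSeriesAt f p 0 ∧
      ∀ n x, p n (fun _ => x) = homPart n f x := by
  obtain ⟨p, R, hp⟩ := hf
  refine ⟨p, ⟨R, hp⟩, fun n x => ?_⟩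
  have h := hp.factorial_smul x n
  rw [homPart, ← h, ← Nat.cast_smul_eq_nsmul ℂ, smul_smul,
    inv_mul_cancel₀ (Nat.cast_ne_zero.2 n.factorial_ne_zero), one_smul]

lemma eventually_hasSum_homPart {f : E → F} (hf : AnalyticAt ℂ f 0) :
    ∀ᶠ x in 𝓝 (0 : E), HasSum (fun n => homPart n f x) (f x) := by
  obtain ⟨p, hp, hpn⟩ := exists_homPart_eq hf
  filter_upwards [hp.eventually_hasSum] with x hx
  simpa [hpn] using hx

lemma tendsto_real_smul (x : E) : Tendsto (fun t : ℝ => t • x) (𝓝 0) (𝓝 0) := by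
  have : Continuous fun t : ℝ => t • x := by fun_prop
  simpa using this.tendsto 0

lemma homPart_real_smul (n : ℕ) (f : E → F) (t : ℝ) (x : E) :
    homPart n f (t • x) = t ^ n • homPart n f x := by
  have := homPart_smul n f (t : ℂ) x
  rw [Complex.coe_smul] at this
  rw [this, ← Complex.coe_smul, Complex.ofReal_pow]

lemma eventually_hasSum_real {f : E → F} (hf : AnalyticAt ℂ f 0) (x : E) :
    ∀ᶠ t in 𝓝 (0 : ℝ), HasSum (fun n => t ^ n • homPart n f x) (f (t • x)) := by
  filter_upwards [(tendsto_real_smul x).eventually (eventually_hasSum_homPart hf)] with t ht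
  simpa only [homPart_real_smul] using ht

/-- The power series in one real variable with the given coefficients. -/
def realSeries (a : ℕ → F) : FormalMultilinearSeries ℝ ℝ F :=
  fun n => ContinuousMultilinearMap.mkPiRing ℝ (Fin n) (a n)

lemma hasFPowerSeriesAt_realSeries {a : ℕ → F} {q : ℝ → F}
    (h : ∀ᶠ t in 𝓝 (0 : ℝ), HasSum (fun n => t ^ n • a n) (q t)) :
    HasFPowerSeriesAt q (realSeries a) 0 := by
  rw [hasFPowerSeriesAt_iff]
  simpa [realSeries, FormalMultilinearSeries.coeff] using h

/-- Any convergent expansion along the real ray through x identifies the homogeneous parts at x, by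
uniqueness of power series in one real variable. -/
lemma homPart_unique {f : E → F} (hf : AnalyticAt ℂ f 0) {x : E} {a : ℕ → F}
    (h : ∀ᶠ t in 𝓝 (0 : ℝ), HasSum (fun n => t ^ n • a n) (f (t • x))) (n : ℕ) :
    homPart n f x = a n := by
  have h1 := hasFPowerSeriesAt_realSeries (eventually_hasSum_real hf x)
  have h2 := hasFPowerSeriesAt_realSeries h
  have h3 := h1.eq_formalMultilinearSeries h2
  have h4 := congrArg (fun p => p.coeff n) h3
  simpa [realSeries, FormalMultilinearSeries.coeff] using h4

/-- Compare the two expansions along a real ray. Real linearity of `S` and `S'` suffices, so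
conjugations are allowed. -/
lemma homPart_map {f : E → F} (hf : AnalyticAt ℂ f 0) (S : E →L[ℝ] E) (S' : F →L[ℝ] F)
    (h : ∀ᶠ x in 𝓝 (0 : E), f (S x) = S' (f x)) (n : ℕ) (x : E) :
    homPart n f (S x) = S' (homPart n f x) := by
  refine homPart_unique hf ?_ n (a := fun n => S' (homPart n f x))
  filter_upwards [eventually_hasSum_real hf x, (tendsto_real_smul x).eventually h] with t ht ht'
  rw [← map_smul, ht']
  simpa using S'.hasSum ht

/-- Along the ray, once the lower parts vanish, the degree n term dominates all later ones, so it
cannot be O(|t|^(n+1)) unless it is zero. -/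
lemma homPart_eq_zero_of_isBigO {f : E → F} (hf : AnalyticAt ℂ f 0) {d : ℕ} {x : E}
    (h : (fun t : ℝ => f (t • x)) =O[𝓝 0] fun t : ℝ => |t| ^ d) (n : ℕ) (hn : n < d) :
    homPart n f x = 0 := by
  induction n using Nat.strong_induction_on with
  | _ n ih =>
  have h1 := (hasFPowerSeriesAt_realSeries (eventually_hasSum_real hf x)).isBigO_sub_partialSum_pow
    (n + 1)
  have h2 : ∀ t : ℝ, (realSeries fun n => homPart n f x).partialSum (n + 1) t
      = t ^ n • homPart n f x := by
    intro t
    rw [FormalMultilinearSeries.partialSum, Finset.sum_range_succ, Finset.sum_eq_zero]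
    · simp [realSeries]
    · intro m hm
      rw [Finset.mem_range] at hm
      simp [realSeries, ih m hm (hm.trans hn)]
  simp only [h2, zero_add, Real.norm_eq_abs] at h1
  have h3 : (fun t : ℝ => |t| ^ d) =O[𝓝 0] fun t : ℝ => |t| ^ (n + 1) := by
    refine IsBigO.of_bound 1 ?_
    have : ∀ᶠ t in 𝓝 (0 : ℝ), |t| < 1 := by
      have : Continuous fun t : ℝ => |t| := continuous_abs
      exact this.continuousAt.eventually_lt continuousAt_const (by simp)
    filter_upwards [this] with t ht
    rw [one_mul, Real.norm_of_nonneg (by positivity), Real.norm_of_nonneg (by positivity)]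
    exact pow_le_pow_of_le_one (abs_nonneg t) ht.le hn
  have h4 : (fun t : ℝ => t ^ n • homPart n f x) =O[𝓝 0] fun t : ℝ => |t| ^ (n + 1) := by
    have := (h.trans h3).sub h1
    simpa using this
  obtain ⟨C, hC⟩ := h4.bound
  by_contra hne
  have hpos : 0 < ‖homPart n f x‖ := norm_pos_iff.2 hne
  have h5 : ∀ᶠ t in 𝓝 (0 : ℝ), C * |t| < ‖homPart n f x‖ := by
    have : Continuous fun t : ℝ => C * |t| := by fun_prop
    exact this.continuousAt.eventually_lt continuousAt_const (by simpa using hpos)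
  -- At a single small nonzero t, dividing the bound by |t|^n contradicts `h5`.
  obtain ⟨ε, hε, hball⟩ := Metric.eventually_nhds_iff.1 (hC.and h5)
  obtain ⟨h6, h7⟩ := hball (y := ε / 2) (by simp [abs_of_pos hε, hε])
  have hε2 : 0 < |ε / 2| := by positivity
  rw [norm_smul, norm_pow, Real.norm_eq_abs, Real.norm_of_nonneg (by positivity), pow_succ] at h6
  have : |ε / 2| ^ n * ‖homPart n f x‖ ≤ |ε / 2| ^ n * (C * |ε / 2|) := by
    calc _ ≤ _ := h6
      _ = _ := by ring
  have := le_of_mul_le_mul_left this (by positivity)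
  linarith

lemma isBigO_of_homPart_eq_zero {f : E → F} (hf : AnalyticAt ℂ f 0) {d : ℕ}
    (h : ∀ n < d, ∀ x, homPart n f x = 0) : f =O[𝓝 0] fun x => ‖x‖ ^ d := by
  obtain ⟨p, hp, hpn⟩ := exists_homPart_eq hf
  have h1 := hp.isBigO_sub_partialSum_pow d
  have h2 : ∀ y, p.partialSum d y = 0 := fun y =>
    Finset.sum_eq_zero fun n hn => by rw [hpn, h n (Finset.mem_range.1 hn)]
  simpa [h2] using h1

/-- A bounded holomorphic map on a ball: Cauchy estimates for its homogeneous parts. -/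
lemma norm_homPart_le {f : E → F} {ρ M : ℝ} (hf : ∀ y, ‖y‖ < ρ → AnalyticAt ℂ f y)
    (hM : ∀ y, ‖y‖ < ρ → ‖f y‖ ≤ M) {ρ' : ℝ} (h0 : 0 < ρ') (hlt : ρ' < ρ) (n : ℕ) (x : E) :
    ‖homPart n f x‖ ≤ M / ρ' ^ n * ‖x‖ ^ n := by
  have hfa : AnalyticAt ℂ f 0 := hf 0 (by simpa using h0.trans hlt)
  -- By homogeneity it suffices to treat vectors of norm at most ρ'; there Cauchy's estimate on the
  -- unit circle applies to z ↦ f(zx).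
  suffices H : ∀ x : E, ‖x‖ ≤ ρ' → ‖homPart n f x‖ ≤ M by
    rcases eq_or_ne x 0 with rfl | hx
    · have h1 : homPart n f (0 : E) = (0 : ℂ) ^ n • homPart n f (0 : E) := by
        rw [← homPart_smul, zero_smul]
      have h2 := H 0 (by simpa using h0.le)
      rcases Nat.eq_zero_or_pos n with rfl | hn
      · simpa using h2
      · rw [h1]; simp [hn.ne']
    · have hxp : 0 < ‖x‖ := norm_pos_iff.2 hx
      have h1 := H ((ρ' / ‖x‖) • x) (by
        rw [norm_smul, Real.norm_of_nonneg (by positivity)]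
        field_simp; exact le_rfl)
      rw [homPart_real_smul, norm_smul, Real.norm_of_nonneg (by positivity), div_pow] at h1
      rw [div_mul_eq_mul_div, le_div_iff₀ (by positivity)]
      rw [div_mul_eq_mul_div, div_le_iff₀ (by positivity)] at h1
      linarith
  intro x hx
  set q : ℂ → F := fun z => f (z • x) with hq
  have hz : ∀ z : ℂ, ‖z‖ ≤ 1 → ‖z • x‖ < ρ := fun z hz => by
    rw [norm_smul]
    calc ‖z‖ * ‖x‖ ≤ 1 * ‖x‖ := by gcongr
      _ < ρ := by linarith
  have hdiff : ∀ z : ℂ, ‖z‖ ≤ 1 → DifferentiableAt ℂ q z := fun z hz' =>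
    (hf _ (hz z hz')).differentiableAt.comp z (by fun_prop)
  have hdc : DiffContOnCl ℂ q (ball 0 1) := by
    refine DifferentiableOn.diffContOnCl fun z hz' => (hdiff z ?_).differentiableWithinAt
    rw [closure_ball _ one_ne_zero] at hz'
    simpa using hz'
  have hB := Complex.norm_iteratedDeriv_le_of_forall_mem_sphere_norm_le n one_pos hdc (C := M)
    (fun z hz' => hM _ (hz z (by simpa using (mem_sphere_zero_iff_norm.1 hz').le)))
  have hs : ∀ᶠ t in 𝓝 (0 : ℝ), HasSum
      (fun n => t ^ n • ((n ! : ℂ)⁻¹ • iteratedDeriv n q 0)) (f (t • x)) := by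
    have : ∀ᶠ t in 𝓝 (0 : ℝ), |t| < 1 :=
      continuous_abs.continuousAt.eventually_lt continuousAt_const (by simp)
    filter_upwards [this] with t ht
    have h1 := Complex.hasSum_taylorSeries_on_ball (f := q) (c := 0) (r := 1) (z := (t : ℂ))
      (hdc.differentiableOn.mono (by simp)) (by simpa using ht)
    simp only [sub_zero] at h1
    convert h1 using 2 with m
    · rw [← Complex.coe_smul, smul_comm, Complex.ofReal_pow]
    · rw [Complex.coe_smul]
  rw [homPart_unique hfa hs n, norm_smul, norm_inv, Complex.norm_natCast]
  rw [one_pow, div_one] at hB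
  rw [inv_mul_le_iff₀ (by positivity)]
  exact hB

/-- The expansion is valid on the whole ball of analyticity: f is holomorphic on a disc of radius R
> 1 in the complex line through x, and the one-variable Taylor series is evaluated at 1. -/
lemma hasSum_homPart {f : E → F} {ρ : ℝ} (hf : ∀ y, ‖y‖ < ρ → AnalyticAt ℂ f y) {x : E}
    (hx : ‖x‖ < ρ) : HasSum (fun n => homPart n f x) (f x) := by
  have hfa : AnalyticAt ℂ f 0 := hf 0 (by simpa using (norm_nonneg x).trans_lt hx)
  obtain ⟨R, hR1, hR⟩ : ∃ R : ℝ, 1 < R ∧ R * ‖x‖ < ρ := by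
    have h1 : ∀ᶠ R in 𝓝[>] (1 : ℝ), R * ‖x‖ < ρ := by
      refine nhdsWithin_le_nhds ?_
      exact (continuousAt_id.mul continuousAt_const).eventually_lt continuousAt_const
        (by simpa using hx)
    obtain ⟨R, h, h'⟩ := (h1.and self_mem_nhdsWithin).exists
    exact ⟨R, h', h⟩
  set q : ℂ → F := fun z => f (z • x) with hq
  have hdiff : DifferentiableOn ℂ q (ball 0 R) := fun z hz =>
    ((hf _ (by
      rw [norm_smul]
      refine lt_of_le_of_lt ?_ hR
      gcongr
      simpa using (mem_ball_zero_iff.1 hz).le)).differentiableAt.comp z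
        (by fun_prop)).differentiableWithinAt
  have hs : ∀ t : ℂ, ‖t‖ < R → HasSum
      (fun n => t ^ n • ((n ! : ℂ)⁻¹ • iteratedDeriv n q 0)) (q t) := by
    intro t ht
    have h1 := Complex.hasSum_taylorSeries_on_ball (f := q) (c := 0) (r := R) (z := t)
      (hdiff.mono (by simp)) (by simpa using ht)
    simp only [sub_zero] at h1
    convert h1 using 2 with m
    rw [smul_comm]
  have hs' : ∀ n, homPart n f x = (n ! : ℂ)⁻¹ • iteratedDeriv n q 0 := by
    refine homPart_unique hfa ?_
    have : ∀ᶠ t in 𝓝 (0 : ℝ), |t| < R :=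
      continuous_abs.continuousAt.eventually_lt continuousAt_const (by simp; linarith)
    filter_upwards [this] with t ht
    have := hs t (by simpa using ht)
    simpa only [← Complex.ofReal_pow, Complex.coe_smul, hq] using this
  have := hs 1 (by simpa using hR1)
  simpa [hs', hq] using this

/-- Cauchy's estimate for the derivative of a map that vanishes to order `d` at `0`. -/
lemma norm_fderiv_le_of_norm_le_pow {f : E → F} {ρ C : ℝ} {d : ℕ} (hd : 2 ≤ d) (hC : 0 ≤ C)
    (hf : ∀ y, ‖y‖ < ρ → AnalyticAt ℂ f y) (hb : ∀ y, ‖y‖ < ρ → ‖f y‖ ≤ C * ‖y‖ ^ d) {x : E}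
    (hx : 2 * ‖x‖ < ρ) : ‖fderiv ℂ f x‖ ≤ C * 2 ^ d * ‖x‖ ^ (d - 1) := by
  have hx1 : ‖x‖ < ρ := by linarith [norm_nonneg x]
  -- At x = 0 the disc used below degenerates; there the derivative vanishes because d ≥ 2.
  rcases eq_or_ne x 0 with rfl | hx0
  · have h0 : f 0 = 0 := by
      have := hb 0 hx1
      simpa [show d ≠ 0 by omega] using this
    have : HasFDerivAt f (0 : E →L[ℂ] F) 0 := by
      rw [hasFDerivAt_iff_isLittleO_nhds_zero]
      simp only [zero_add, h0, sub_zero, _root_.zero_apply]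
      have h1 : f =O[𝓝 0] fun y => ‖y‖ ^ d := by
        refine IsBigO.of_bound C ?_
        have hn : ball (0 : E) ρ ∈ 𝓝 0 := isOpen_ball.mem_nhds (by simpa using hx1)
        filter_upwards [hn] with y hy
        rw [Real.norm_of_nonneg (by positivity)]
        exact hb y (by simpa using hy)
      refine h1.trans_isLittleO ?_
      exact isLittleO_norm_pow_id (by omega)
    rw [this.fderiv, norm_zero]
    positivity
  · have hxp : 0 < ‖x‖ := norm_pos_iff.2 hx0
    refine ContinuousLinearMap.opNorm_le_bound _ (by positivity) fun a => ?_
    rcases eq_or_ne a 0 with rfl | ha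
    · simp
    have hap : 0 < ‖a‖ := norm_pos_iff.2 ha
    set q : ℂ → F := fun z => f (x + z • a) with hq
    have hR : 0 < ‖x‖ / ‖a‖ := by positivity
    -- On the line x + za, the disc of radius ‖x‖/‖a‖ stays in the ball of radius 2‖x‖, whence the
    -- factor 2^d.
    have hz : ∀ z : ℂ, ‖z‖ ≤ ‖x‖ / ‖a‖ → ‖x + z • a‖ ≤ 2 * ‖x‖ := fun z hz => by
      refine (norm_add_le _ _).trans ?_
      rw [norm_smul]
      rw [le_div_iff₀ hap] at hz
      linarith
    have hda : ∀ z : ℂ, ‖z‖ ≤ ‖x‖ / ‖a‖ → HasDerivAt q (fderiv ℂ f (x + z • a) a) z := by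
      intro z hz'
      have h1 := (hf _ ((hz z hz').trans_lt hx)).differentiableAt.hasFDerivAt
      have h2 : HasDerivAt (fun z : ℂ => x + z • a) a z := by
        simpa using ((hasDerivAt_id z).smul_const a).const_add x
      exact h1.comp_hasDerivAt z h2
    have hdc : DiffContOnCl ℂ q (ball 0 (‖x‖ / ‖a‖)) := by
      refine DifferentiableOn.diffContOnCl fun z hz' =>
        (hda z ?_).differentiableAt.differentiableWithinAt
      rw [closure_ball _ hR.ne'] at hz'
      simpa using hz'
    have h1 := Complex.norm_deriv_le_of_forall_mem_sphere_norm_le hR hdc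
      (C := C * (2 * ‖x‖) ^ d) (fun z hz' => by
        have hz'' := hz z (mem_sphere_zero_iff_norm.1 hz').le
        refine (hb _ (hz''.trans_lt hx)).trans ?_
        gcongr)
    have h2 := (hda 0 (by simpa using hR.le)).deriv
    rw [zero_smul, add_zero] at h2
    rw [h2] at h1
    refine h1.trans (le_of_eq ?_)
    obtain ⟨m, rfl⟩ : ∃ m, d = m + 1 := ⟨d - 1, by omega⟩
    rw [Nat.add_sub_cancel]
    field_simp
    ring

end HomPart

end MidpointNLS

end

noncomputable section

namespace MidpointNLS

open Set Filter Topology Metric Asymptotics MeasureTheory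
open scoped ContDiff Nat unitInterval

/-! ### Time-one flows of small vector fields -/

section Flow

variable {E : Type*} [NormedAddCommGroup E] [NormedSpace ℂ E]

/-- The extension of a curve on `[0, 1]` to the real line by constants. -/
def extendCurve (Y : C(I, E)) : ℝ → E := IccExtend zero_le_one Y

lemma continuous_extendCurve (Y : C(I, E)) : Continuous (extendCurve Y) :=
  Y.continuous.Icc_extend'

lemma extendCurve_apply (Y : C(I, E)) {t : ℝ} (ht : t ∈ Icc (0 : ℝ) 1) :
    extendCurve Y t = Y ⟨t, ht⟩ := IccExtend_of_mem _ _ ht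

lemma norm_extendCurve_le (Y : C(I, E)) (t : ℝ) : ‖extendCurve Y t‖ ≤ ‖Y‖ :=
  Y.norm_coe_le_norm _

lemma intervalIntegrable_extendCurve (Y : C(I, E)) (a b : ℝ) :
    IntervalIntegrable (extendCurve Y) volume a b :=
  (continuous_extendCurve Y).intervalIntegrable a b

/-- The integration operator `(J Y)(t) = ∫₀ᵗ Y`. -/
def volterra : C(I, E) →L[ℂ] C(I, E) :=
  LinearMap.mkContinuous
    { toFun := fun Y => ⟨fun t => ∫ s in (0 : ℝ)..t, extendCurve Y s,
        (intervalIntegral.continuous_primitive (intervalIntegrable_extendCurve Y) 0).comp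
          continuous_subtype_val⟩
      map_add' := fun Y Z => by
        ext t
        exact intervalIntegral.integral_add (intervalIntegrable_extendCurve Y _ _)
          (intervalIntegrable_extendCurve Z _ _)
      map_smul' := fun c Y => by
        ext t
        exact intervalIntegral.integral_smul c (extendCurve Y) }
    1 (fun Y => by
      rw [ContinuousMap.norm_le _ (by positivity)]
      intro t
      refine (intervalIntegral.norm_integral_le_of_norm_le_const
        (fun s _ => norm_extendCurve_le Y s)).trans ?_
      have h0 : (0 : ℝ) ≤ t := t.2.1
      have h1 : (t : ℝ) ≤ 1 := t.2.2
      rw [sub_zero, abs_of_nonneg h0, one_mul]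
      exact mul_le_of_le_one_right (norm_nonneg _) h1)

lemma volterra_apply (Y : C(I, E)) (t : I) :
    volterra Y t = ∫ s in (0 : ℝ)..t, extendCurve Y s := rfl

lemma norm_volterra_le (Y : C(I, E)) : ‖volterra Y‖ ≤ ‖Y‖ := by
  have h : ‖(volterra : C(I, E) →L[ℂ] C(I, E))‖ ≤ 1 :=
    LinearMap.mkContinuous_norm_le _ zero_le_one _
  simpa using ContinuousLinearMap.le_of_opNorm_le _ h Y

/-- Composition of curves with a (continuous) vector field. -/
def nemytskii (X : E → E) (Y : C(I, E)) : C(I, E) := by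
  classical exact if h : Continuous X then ⟨fun t => X (Y t), h.comp Y.continuous⟩ else 0

/-- A continuous vector field acting analytically on curves. -/
structure SmoothField (X : E → E) : Prop where
  cont : Continuous X
  contDiff : ContDiff ℂ ω (nemytskii X)

lemma nemytskii_apply {X : E → E} (h : Continuous X) (Y : C(I, E)) (t : I) :
    nemytskii X Y t = X (Y t) := by
  rw [nemytskii, dif_pos h]; rfl

/-- Constant curves. -/
def constCurve : E →L[ℂ] C(I, E) :=
  LinearMap.mkContinuous
    { toFun := ContinuousMap.const I
      map_add' := fun _ _ => rfl
      map_smul' := fun _ _ => rfl } 1 (fun x => by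
        rw [ContinuousMap.norm_le _ (by positivity)]
        intro t; exact le_of_eq (by simp; rfl))

@[simp] lemma constCurve_apply (x : E) (t : I) : constCurve x t = x := rfl

lemma norm_constCurve (x : E) : ‖constCurve x‖ = ‖x‖ := by
  refine le_antisymm ?_ ?_
  · rw [ContinuousMap.norm_le _ (by positivity)]; intro t; simp
  · simpa using (constCurve x).norm_coe_le_norm 0

/-- Evaluation of curves. -/
def evalCurve (t : I) : C(I, E) →L[ℂ] E := ContinuousMap.evalCLM ℂ t

@[simp] lemma evalCurve_apply (t : I) (Y : C(I, E)) : evalCurve t Y = Y t := rfl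

lemma hasFDerivAt_evalCurve (t : I) (Y : C(I, E)) :
    HasFDerivAt (fun Y : C(I, E) => evalCurve t Y) (evalCurve t) Y :=
  ContinuousLinearMap.hasFDerivAt (E := C(I, E)) _

lemma hasFDerivAt_constCurve (x : E) : HasFDerivAt (fun x : E => constCurve x) constCurve x :=
  ContinuousLinearMap.hasFDerivAt (F := C(I, E)) _

lemma hasFDerivAt_volterra (Y : C(I, E)) :
    HasFDerivAt (fun Y : C(I, E) => volterra Y) volterra Y :=
  ContinuousLinearMap.hasFDerivAt (E := C(I, E)) (F := C(I, E)) _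

lemma contDiff_volterra : ContDiff ℂ ω (fun Y : C(I, E) => volterra Y) :=
  ContinuousLinearMap.contDiff (E := C(I, E)) (F := C(I, E)) _

namespace SmoothField

variable {X Z : E → E}

lemma contDiff_field (hX : SmoothField X) : ContDiff ℂ ω X := by
  have : X = fun x => evalCurve 0 (nemytskii X (constCurve x)) := by
    funext x; simp [nemytskii_apply hX.cont]
  rw [this]
  exact (evalCurve 0).contDiff.comp (hX.contDiff.comp constCurve.contDiff)

/-- Evaluation at t is linear and intertwines the action on curves with X, so the chain rule can be
applied on both sides. -/
lemma fderiv_nemytskii (hX : SmoothField X) (Y H : C(I, E)) (t : I) :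
    fderiv ℂ (nemytskii X) Y H t = fderiv ℂ X (Y t) (H t) := by
  have h1 : HasFDerivAt (fun Y => evalCurve t (nemytskii X Y))
      ((evalCurve t).comp (fderiv ℂ (nemytskii X) Y)) Y :=
    (hasFDerivAt_evalCurve t _).comp Y (hX.contDiff.differentiable (by simp) Y).hasFDerivAt
  have h2 : HasFDerivAt (fun Y => X (evalCurve t Y))
      ((fderiv ℂ X (Y t)).comp (evalCurve t)) Y :=
    (hX.contDiff_field.differentiable (by simp) (Y t)).hasFDerivAt.comp Y
      (hasFDerivAt_evalCurve t Y)
  have h3 : (fun Y => evalCurve t (nemytskii X Y)) = fun Y => X (evalCurve t Y) := by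
    funext Y; simp [nemytskii_apply hX.cont]
  rw [h3] at h1
  exact congrArg (fun L => L H) (h1.unique h2)

lemma zero : SmoothField (fun _ : E => (0 : E)) where
  cont := continuous_const
  contDiff := by
    have : nemytskii (fun _ : E => (0 : E)) = fun _ => 0 := by
      funext Y; ext t; simp [nemytskii_apply continuous_const]
    rw [this]; exact contDiff_const

lemma add (hX : SmoothField X) (hZ : SmoothField Z) : SmoothField (fun x => X x + Z x) where
  cont := hX.cont.add hZ.cont
  contDiff := by
    have : nemytskii (fun x => X x + Z x) = fun Y => nemytskii X Y + nemytskii Z Y := by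
      funext Y; ext t
      rw [nemytskii_apply (X := fun x => X x + Z x) (hX.cont.add hZ.cont)]
      simp [nemytskii_apply hX.cont, nemytskii_apply hZ.cont]
    rw [this]; exact hX.contDiff.add hZ.contDiff

end SmoothField

/-- Pointwise action of a multilinear map on curves. -/
def liftMultilinear {n : ℕ} (M : ContinuousMultilinearMap ℂ (fun _ : Fin n => E) E) :
    ContinuousMultilinearMap ℂ (fun _ : Fin n => C(I, E)) C(I, E) :=
  MultilinearMap.mkContinuous
    { toFun := fun Ys => ⟨fun t => M fun i => Ys i t, M.cont.comp (by fun_prop)⟩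
      map_update_add' := fun {inst} Ys i Y Z => by
        ext t
        have key : ∀ W : C(I, E), (fun j => Function.update Ys i W j t)
            = Function.update (fun j => Ys j t) i (W t) := fun W => by
          funext j
          rcases eq_or_ne j i with rfl | h <;> simp [*]
        simp [key]
      map_update_smul' := fun {inst} Ys i c Y => by
        ext t
        have key : ∀ W : C(I, E), (fun j => Function.update Ys i W j t)
            = Function.update (fun j => Ys j t) i (W t) := fun W => by
          funext j
          rcases eq_or_ne j i with rfl | h <;> simp [*]
        simp [key] }
    ‖M‖ (fun Ys => by
      rw [ContinuousMap.norm_le _ (by positivity)]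
      intro t
      refine (M.le_opNorm _).trans ?_
      gcongr with i
      exact (Ys i).norm_coe_le_norm t)

/-- On curves the field is again the diagonal of a bounded multilinear map, hence analytic. All
fields used below are finite sums of such fields. -/
lemma smoothField_multilinear {n : ℕ} (M : ContinuousMultilinearMap ℂ (fun _ : Fin n => E) E) :
    SmoothField (fun x => M fun _ => x) where
  cont := M.cont.comp (by fun_prop)
  contDiff := by
    have : nemytskii (fun x => M fun _ => x) = fun Y => liftMultilinear M fun _ => Y := by
      funext Y; ext t
      rw [nemytskii_apply (X := fun x => M fun _ => x) (M.cont.comp (by fun_prop))]; rfl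
    rw [this]
    exact (liftMultilinear M).contDiff.comp (contDiff_pi.2 fun _ => contDiff_id)

lemma smoothField_homPart (n : ℕ) (f : E → E) : SmoothField (homPart n f) :=
  smoothField_multilinear ((n ! : ℂ)⁻¹ • iteratedFDeriv ℂ n f 0)

/-- The solution on `[0, 1]` of `y' = X(y)`, `y(0) = x`. -/
def flowCurve (X : E → E) (x : E) : C(I, E) :=
  solve (fun Y => volterra (nemytskii X Y)) (constCurve x)

/-- The time-one flow of a small vector field. -/
def flowOne (X : E → E) (x : E) : E := flowCurve X x 1

variable {X Z : E → E} {ρ : ℝ}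

/-- The time interval has length one, so integration has norm at most 1 and the Lipschitz constant
1/2 survives. -/
lemma HalfLip.nemytskii (hX : HalfLip X ρ) (hc : Continuous X) :
    HalfLip (fun Y : C(I, E) => volterra (nemytskii X Y)) ρ where
  zero := by
    have : MidpointNLS.nemytskii X 0 = 0 := by
      ext t; simp [nemytskii_apply hc, hX.zero]
    simp [this]
  lip := fun Y Z hY hZ => by
    rw [← map_sub]
    refine (norm_volterra_le _).trans ?_
    rw [ContinuousMap.norm_le _ (by positivity)]
    intro t
    rw [ContinuousMap.sub_apply, nemytskii_apply hc, nemytskii_apply hc]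
    refine (hX.lip _ _ ((Y.norm_coe_le_norm t).trans hY) ((Z.norm_coe_le_norm t).trans hZ)).trans ?_
    gcongr
    exact (Y - Z).norm_coe_le_norm t

variable [CompleteSpace E]

lemma hasDerivAt_primitive (x : E) (Y : C(I, E)) (t : ℝ) :
    HasDerivAt (fun t => x + ∫ s in (0 : ℝ)..t, extendCurve Y s) (extendCurve Y t) t :=
  ((continuous_extendCurve Y).integral_hasStrictDerivAt 0 t).hasDerivAt.const_add x

section

variable (hX : HalfLip X ρ)

include hX

lemma norm_flowCurve_le (hc : Continuous X) {x : E} (hx : 2 * ‖x‖ ≤ ρ) :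
    ‖flowCurve X x‖ ≤ 2 * ‖x‖ := by
  have := (hX.nemytskii hc).norm_solve_le (x := constCurve x) (by rwa [norm_constCurve])
  rwa [norm_constCurve] at this

lemma norm_flowOne_le (hc : Continuous X) {x : E} (hx : 2 * ‖x‖ ≤ ρ) :
    ‖flowOne X x‖ ≤ 2 * ‖x‖ :=
  ((flowCurve X x).norm_coe_le_norm 1).trans (norm_flowCurve_le hX hc hx)

lemma flowCurve_eq (hc : Continuous X) {x : E} (hx : 2 * ‖x‖ ≤ ρ) :
    flowCurve X x = constCurve x + volterra (nemytskii X (flowCurve X x)) :=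
  (hX.nemytskii hc).solve_eq (by rwa [norm_constCurve])

lemma flowCurve_zero (hc : Continuous X) {x : E} (hx : 2 * ‖x‖ ≤ ρ) : flowCurve X x 0 = x := by
  rw [flowCurve_eq hX hc hx]
  simp [volterra_apply]

lemma hasDerivWithinAt_flowCurve (hc : Continuous X) {x : E} (hx : 2 * ‖x‖ ≤ ρ) {t : ℝ}
    (ht : t ∈ Icc (0 : ℝ) 1) :
    HasDerivWithinAt (extendCurve (flowCurve X x)) (X (extendCurve (flowCurve X x) t))
      (Icc 0 1) t := by
  have h1 := (hasDerivAt_primitive x (nemytskii X (flowCurve X x)) t).hasDerivWithinAt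
    (s := Icc 0 1)
  rw [extendCurve_apply _ ht, nemytskii_apply hc, ← extendCurve_apply _ ht] at h1
  have key : ∀ s ∈ Icc (0 : ℝ) 1, extendCurve (flowCurve X x) s
      = x + ∫ s' in (0 : ℝ)..s, extendCurve (nemytskii X (flowCurve X x)) s' := by
    intro s hs
    rw [extendCurve_apply _ hs]
    conv_lhs => rw [flowCurve_eq hX hc hx]
    rfl
  exact h1.congr key (key t ht)

lemma flowCurve_equivariant (hc : Continuous X) (S : E →L[ℝ] E) (hS : ∀ x, ‖S x‖ = ‖x‖)
    (hSX : ∀ x, X (S x) = S (X x)) {x : E} (hx : 2 * ‖x‖ ≤ ρ) (t : I) :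
    flowCurve X (S x) t = S (flowCurve X x t) := by
  have h := (hX.nemytskii hc).solve_equivariant
    (S := fun Y : C(I, E) => (⟨fun t => S (Y t), S.continuous.comp Y.continuous⟩ : C(I, E)))
    (fun Y Z => by ext t; simp) (fun Y => by
      refine le_antisymm ?_ ?_
      · rw [ContinuousMap.norm_le _ (by positivity)]
        intro t
        simpa [hS] using Y.norm_coe_le_norm t
      · rw [ContinuousMap.norm_le _ (by positivity)]
        intro t
        rw [← hS]
        exact (⟨fun t => S (Y t), S.continuous.comp Y.continuous⟩ : C(I, E)).norm_coe_le_norm t)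
    (fun Y => by
      ext t
      rw [volterra_apply]
      change _ = S (volterra _ t)
      rw [volterra_apply, ← ContinuousLinearMap.intervalIntegral_comp_comm S
        (intervalIntegrable_extendCurve _ _ _)]
      congr 1
      funext s
      change nemytskii X _ (projIcc 0 1 _ s) = S (nemytskii X _ (projIcc 0 1 _ s))
      rw [nemytskii_apply hc, nemytskii_apply hc, ← hSX]
      rfl)
    (x := constCurve x) (by rwa [norm_constCurve])
  have h' := congrArg (fun Y : C(I, E) => Y t) h
  exact h'

lemma flowOne_equivariant (hc : Continuous X) (S : E →L[ℝ] E) (hS : ∀ x, ‖S x‖ = ‖x‖)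
    (hSX : ∀ x, X (S x) = S (X x)) {x : E} (hx : 2 * ‖x‖ ≤ ρ) :
    flowOne X (S x) = S (flowOne X x) :=
  flowCurve_equivariant hX hc S hS hSX hx 1

lemma analyticAt_flowOne (hs : SmoothField X) {x : E} (hx : 2 * ‖x‖ < ρ) :
    AnalyticAt ℂ (flowOne X) x := by
  have h := (hX.nemytskii hs.cont).analyticAt_solve
    (contDiff_volterra.comp hs.contDiff) (x := constCurve x) (by rwa [norm_constCurve])
  exact (ContinuousLinearMap.analyticAt (evalCurve 1) _).comp
    (h.comp (ContinuousLinearMap.analyticAt constCurve x))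

/-- The time-one flow of a Hamiltonian vector field is symplectic. -/
lemma flowOne_symplectic (hs : SmoothField X) (B : E →L[ℂ] E →L[ℂ] ℂ)
    (hB : ∀ x a b, B (fderiv ℂ X x a) b + B a (fderiv ℂ X x b) = 0) {x : E} (hx : 2 * ‖x‖ < ρ)
    (a b : E) : B (fderiv ℂ (flowOne X) x a) (fderiv ℂ (flowOne X) x b) = B a b := by
  set G : C(I, E) → C(I, E) := fun Y => volterra (nemytskii X Y) with hG
  have hx' : 2 * ‖constCurve x‖ < ρ := by rwa [norm_constCurve]
  have hGl : HalfLip G ρ := hX.nemytskii hs.cont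
  have hGc : ContDiff ℂ ω G := contDiff_volterra.comp hs.contDiff
  set D := fderiv ℂ (solve G) (constCurve x) with hD
  set Y := flowCurve X x with hY
  have hfl : HasFDerivAt (flowOne X) ((evalCurve 1).comp (D.comp constCurve)) x := by
    have h1 := (hGl.analyticAt_solve hGc hx').differentiableAt.hasFDerivAt
    exact (hasFDerivAt_evalCurve 1 _).comp x (h1.comp x (hasFDerivAt_constCurve x))
  rw [hfl.fderiv]
  -- The variational equation along the orbit, in integrated form.
  have hvar : ∀ c : E, D (constCurve c)
      = constCurve c + volterra (fderiv ℂ (nemytskii X) Y (D (constCurve c))) := by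
    intro c
    have h1 := hGl.fderiv_solve hGc hx' (constCurve c)
    have h2 : fderiv ℂ G Y = volterra.comp (fderiv ℂ (nemytskii X) Y) :=
      ((hasFDerivAt_volterra _).comp Y
        (hs.contDiff.differentiable (by simp) Y).hasFDerivAt).fderiv
    rw [← hD] at h1
    conv_lhs => rw [h1]
    change _ + fderiv ℂ G Y _ = _
    rw [h2]; rfl
  -- The integral formula extends the variation to all real times, giving two-sided derivatives at
  -- the endpoints of [0, 1] as well.
  set z : E → ℝ → E := fun c t =>
    c + ∫ s in (0 : ℝ)..t, extendCurve (fderiv ℂ (nemytskii X) Y (D (constCurve c))) s with hz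
  have hzD : ∀ c (t : I), D (constCurve c) t = z c t := by
    intro c t
    conv_lhs => rw [hvar c]
    rfl
  have hzd : ∀ c, ∀ t (ht : t ∈ Icc (0 : ℝ) 1),
      HasDerivAt (z c) (fderiv ℂ X (Y ⟨t, ht⟩) (z c t)) t := by
    intro c t ht
    have h1 := hasDerivAt_primitive c (fderiv ℂ (nemytskii X) Y (D (constCurve c))) t
    rw [extendCurve_apply _ ht, hs.fderiv_nemytskii, hzD] at h1
    exact h1
  -- By the product rule the derivative of B(z_a, z_b) is exactly the expression that `hB` makes
  -- zero.
  have hq : ∀ t ∈ Icc (0 : ℝ) 1, HasDerivAt (fun t => B (z a t) (z b t)) 0 t := by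
    intro t ht
    have h1 : HasDerivAt (fun t => (B.restrictScalars ℝ) (z a t))
        (B (fderiv ℂ X (Y ⟨t, ht⟩) (z a t))) t :=
      (B.restrictScalars ℝ).hasFDerivAt.comp_hasDerivAt t (hzd a t ht)
    have h2 := ((ContinuousLinearMap.restrictScalarsL ℂ E ℂ ℝ ℝ).hasFDerivAt.comp_hasDerivAt t
      h1).clm_apply (hzd b t ht)
    have h3 := hB (Y ⟨t, ht⟩) (z a t) (z b t)
    exact (h3 ▸ h2 : _)
  have hconst := constant_of_has_deriv_right_zero (f := fun t => B (z a t) (z b t)) (a := 0)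
    (b := 1) (fun t ht => (hq t ht).continuousAt.continuousWithinAt)
    (fun t ht => (hq t ⟨ht.1, ht.2.le⟩).hasDerivWithinAt) 1 (by simp)
  have h0 : ∀ c, z c 0 = c := fun c => by simp [hz]
  simp only [h0] at hconst
  have h1 : ∀ c, ((evalCurve 1).comp (D.comp constCurve)) c = z c 1 := fun c => hzD c 1
  rw [h1, h1, hconst]

end

/-- `X` vanishes at `0` and has Lipschitz constant `C s ^ m` on balls of radius `s ≤ 1`. -/
structure PowLip (C : ℝ) (m : ℕ) (X : E → E) : Prop where
  zero : X 0 = 0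
  lip : ∀ s y z, s ≤ 1 → ‖y‖ ≤ s → ‖z‖ ≤ s → ‖X y - X z‖ ≤ C * s ^ m * ‖y - z‖

namespace PowLip

variable {C C' : ℝ} {m m' : ℕ}

lemma halfLip (h : PowLip C m X) (hρ1 : ρ ≤ 1) (hρ : C * ρ ^ m ≤ 1 / 2) :
    HalfLip X ρ :=
  ⟨h.zero, fun y z hy hz => (h.lip ρ y z hρ1 hy hz).trans (by gcongr)⟩

lemma norm_le (h : PowLip C m X) {s : ℝ} (hs : s ≤ 1) {y : E} (hy : ‖y‖ ≤ s) :
    ‖X y‖ ≤ C * s ^ m * ‖y‖ := by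
  have := h.lip s y 0 hs hy (by simpa using (norm_nonneg y).trans hy)
  simpa [h.zero] using this

/-- The restriction s ≤ 1 in the definition lets the higher power be absorbed into the lower one. -/
lemma add (h : PowLip C m X) (h' : PowLip C' m' Z) (hm : m ≤ m') (hC' : 0 ≤ C') :
    PowLip (C + C') m (fun x => X x + Z x) where
  zero := by simp [h.zero, h'.zero]
  lip := fun s y z hs hy hz => by
    have h1 := h.lip s y z hs hy hz
    have h2 := h'.lip s y z hs hy hz
    have h0 : 0 ≤ s := (norm_nonneg y).trans hy
    have h3 : s ^ m' ≤ s ^ m := pow_le_pow_of_le_one h0 hs hm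
    have h4 : C' * s ^ m' * ‖y - z‖ ≤ C' * s ^ m * ‖y - z‖ := by gcongr
    have h5 : X y + Z y - (X z + Z z) = (X y - X z) + (Z y - Z z) := by abel
    rw [h5]
    refine (norm_add_le _ _).trans ?_
    linarith

lemma zero_field (m : ℕ) : PowLip 0 m (fun _ : E => (0 : E)) :=
  ⟨rfl, fun s y z _ _ _ => by simp⟩

end PowLip

/-- Homogeneous maps with a bound are Lipschitz. -/
lemma norm_sub_le_of_norm_le_pow {F : Type*} [NormedAddCommGroup F] [NormedSpace ℂ F]
    [CompleteSpace F] {f : E → F} {C : ℝ} {d : ℕ} (hd : 2 ≤ d) (hC : 0 ≤ C)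
    (hf : ContDiff ℂ ω f) (hb : ∀ x, ‖f x‖ ≤ C * ‖x‖ ^ d) {s : ℝ} {y z : E} (hy : ‖y‖ ≤ s)
    (hz : ‖z‖ ≤ s) : ‖f y - f z‖ ≤ C * 2 ^ d * s ^ (d - 1) * ‖y - z‖ := by
  refine (convex_closedBall (0 : E) s).norm_image_sub_le_of_norm_fderiv_le (𝕜 := ℂ)
    (fun x _ => hf.differentiable (by simp) x) (fun x hx => ?_) (by simpa using hz)
    (by simpa using hy)
  have h := norm_fderiv_le_of_norm_le_pow (ρ := 2 * ‖x‖ + 1) hd hC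
    (fun y _ => hf.contDiffAt.analyticAt) (fun y _ => hb y) (x := x) (by linarith)
  refine h.trans ?_
  gcongr
  simpa using hx

lemma powLip_of_homogeneous {C : ℝ} {d : ℕ} (hd : 2 ≤ d) (hC : 0 ≤ C) (hX : ContDiff ℂ ω X)
    (hb : ∀ x, ‖X x‖ ≤ C * ‖x‖ ^ d) : PowLip (C * 2 ^ d) (d - 1) X where
  zero := by
    have := hb 0
    simpa [show d ≠ 0 by omega] using this
  lip := fun _ _ _ _ hy hz => norm_sub_le_of_norm_le_pow hd hC hX hb hy hz

/-- Comparison of the time-one flows of `X + Z` and `X`. -/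
lemma norm_flowOne_add_sub_le {C C' : ℝ} {m m' : ℕ} (hX : PowLip C m X) (hZ : PowLip C' m' Z)
    (hXc : Continuous X) (hZc : Continuous Z) (hC : 0 ≤ C) (hC' : 0 ≤ C') (hm : m ≤ m')
    (hρ1 : ρ ≤ 1) (hρ : (C + C') * ρ ^ m ≤ 1 / 2) {x : E} (hx : 2 * ‖x‖ ≤ ρ) :
    ‖flowOne (fun y => X y + Z y) x - flowOne X x - Z x‖
      ≤ C' * (3 * C + C') * (2 * ‖x‖) ^ (m + m' + 1) := by
  have hρ0 : 0 ≤ ρ := by linarith [norm_nonneg x]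
  have hXh : HalfLip X ρ := hX.halfLip hρ1 (by
    refine le_trans ?_ hρ
    gcongr
    linarith)
  have hSh : HalfLip (fun y => X y + Z y) ρ := (hX.add hZ hm hC').halfLip hρ1 hρ
  have hSc : Continuous fun y => X y + Z y := hXc.add hZc
  set s := 2 * ‖x‖ with hs
  have hs0 : 0 ≤ s := by positivity
  have hs1 : s ≤ 1 := hx.trans hρ1
  set Y := flowCurve (fun y => X y + Z y) x with hY
  set W := flowCurve X x with hW
  have hYs : ‖Y‖ ≤ s := norm_flowCurve_le hSh hSc hx
  have hWs : ‖W‖ ≤ s := norm_flowCurve_le hXh hXc hx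
  have hYt : ∀ t, ‖Y t‖ ≤ s := fun t => (Y.norm_coe_le_norm t).trans hYs
  have hWt : ∀ t, ‖W t‖ ≤ s := fun t => (W.norm_coe_le_norm t).trans hWs
  have hYe : Y = constCurve x + volterra (nemytskii (fun y => X y + Z y) Y) :=
    flowCurve_eq hSh hSc hx
  have hWe : W = constCurve x + volterra (nemytskii X W) := flowCurve_eq hXh hXc hx
  have hN : nemytskii (fun y => X y + Z y) Y = nemytskii X Y + nemytskii Z Y := by
    ext t; simp [nemytskii_apply hSc, nemytskii_apply hXc, nemytskii_apply hZc]
  have hZY : ‖nemytskii Z Y‖ ≤ C' * s ^ (m' + 1) := by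
    rw [ContinuousMap.norm_le _ (by positivity)]
    intro t
    rw [nemytskii_apply hZc, pow_succ, ← mul_assoc]
    refine (hZ.norm_le hs1 (hYt t)).trans ?_
    gcongr
    exact hYt t
  have hXYW : ‖nemytskii X Y - nemytskii X W‖ ≤ C * s ^ m * ‖Y - W‖ := by
    rw [ContinuousMap.norm_le _ (by positivity)]
    intro t
    rw [ContinuousMap.sub_apply, nemytskii_apply hXc, nemytskii_apply hXc]
    refine (hX.lip s _ _ hs1 (hYt t) (hWt t)).trans ?_
    gcongr
    exact (Y - W).norm_coe_le_norm t
  have hYW : Y - W = volterra ((nemytskii X Y - nemytskii X W) + nemytskii Z Y) := by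
    conv_lhs => rw [hYe, hWe, hN]
    simp only [map_add, map_sub]
    abel
  -- The two orbits differ only through Z; the factor 2 comes from absorbing half of ‖Y - W‖.
  have hYWn : ‖Y - W‖ ≤ 2 * C' * s ^ (m' + 1) := by
    have h1 : ‖Y - W‖ ≤ ‖nemytskii X Y - nemytskii X W‖ + ‖nemytskii Z Y‖ := by
      conv_lhs => rw [hYW]
      exact (norm_volterra_le _).trans (norm_add_le _ _)
    have h2 : C * s ^ m ≤ 1 / 2 := by
      refine le_trans ?_ hρ
      gcongr
      linarith
    have h3 : C * s ^ m * ‖Y - W‖ ≤ 1 / 2 * ‖Y - W‖ := by gcongr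
    linarith
  have hYc : ‖Y - constCurve x‖ ≤ (C + C') * s ^ (m + 1) := by
    have h1 : Y - constCurve x = volterra (nemytskii (fun y => X y + Z y) Y) := by
      conv_lhs => rw [hYe]
      abel
    rw [h1]
    refine (norm_volterra_le _).trans ?_
    rw [ContinuousMap.norm_le _ (by positivity)]
    intro t
    rw [nemytskii_apply hSc, pow_succ, ← mul_assoc]
    refine ((hX.add hZ hm hC').norm_le hs1 (hYt t)).trans ?_
    gcongr
    exact hYt t
  have hZd : ‖nemytskii Z Y - constCurve (Z x)‖ ≤ C' * s ^ m' * ((C + C') * s ^ (m + 1)) := by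
    rw [ContinuousMap.norm_le _ (by positivity)]
    intro t
    rw [ContinuousMap.sub_apply, nemytskii_apply hZc, constCurve_apply]
    refine (hZ.lip s _ _ hs1 (hYt t) (by rw [hs]; linarith [norm_nonneg x])).trans ?_
    gcongr
    exact ((Y - constCurve x).norm_coe_le_norm t).trans hYc
  -- Z x is the integral of a constant curve over [0, 1]. What remains are the differences of X on
  -- the two orbits and of Z on the orbit and at its starting point; each gains a Lipschitz factor
  -- and has order m + m' + 1.
  have hfin : flowOne (fun y => X y + Z y) x - flowOne X x - Z x
      = volterra ((nemytskii X Y - nemytskii X W) + (nemytskii Z Y - constCurve (Z x))) 1 := by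
    have h1 : volterra (constCurve (Z x)) 1 = Z x := by
      rw [volterra_apply]
      have : extendCurve (constCurve (Z x)) = fun _ => Z x := rfl
      rw [this]; simp
    have h2 : flowOne (fun y => X y + Z y) x - flowOne X x = (Y - W) 1 := rfl
    rw [h2, hYW]
    simp only [map_add, map_sub, ContinuousMap.add_apply, ContinuousMap.sub_apply, h1]
    abel
  rw [hfin]
  refine (ContinuousMap.norm_coe_le_norm _ _).trans ((norm_volterra_le _).trans
    ((norm_add_le _ _).trans ((add_le_add hXYW hZd).trans ?_)))
  calc C * s ^ m * ‖Y - W‖ + C' * s ^ m' * ((C + C') * s ^ (m + 1))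
      ≤ C * s ^ m * (2 * C' * s ^ (m' + 1)) + C' * s ^ m' * ((C + C') * s ^ (m + 1)) := by gcongr
    _ = C' * (3 * C + C') * s ^ (m + m' + 1) := by ring

end Flow

end MidpointNLS

end

noncomputable section

namespace MidpointNLS

open Set Filter Topology Metric Asymptotics MeasureTheory
open scoped ContDiff Nat

/-! ### Backward error analysis for a complexified midpoint scheme -/

section Homogeneous

variable {E F : Type*} [NormedAddCommGroup E] [NormedSpace ℂ E]
  [NormedAddCommGroup F] [NormedSpace ℂ F] [CompleteSpace F]

lemma isBigO_ray {f : E → F} {d : ℕ} (h : f =O[𝓝 0] fun x => ‖x‖ ^ d) (x : E) :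
    (fun t : ℝ => f (t • x)) =O[𝓝 0] fun t : ℝ => |t| ^ d := by
  have h1 := h.comp_tendsto (tendsto_real_smul x)
  refine h1.trans (IsBigO.of_bound (‖x‖ ^ d) (Eventually.of_forall fun t => ?_))
  simp only [Function.comp, norm_pow, norm_smul, Real.norm_eq_abs, abs_abs, mul_pow, abs_mul,
    abs_pow, abs_norm]
  exact le_of_eq (mul_comm _ _)

lemma homPart_of_homogeneous {f : E → F} (hf : AnalyticAt ℂ f 0) {d : ℕ} {x : E}
    (h : ∀ t : ℝ, f (t • x) = t ^ d • f x) (n : ℕ) :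
    homPart n f x = if n = d then f x else 0 := by
  refine homPart_unique hf (a := fun n => if n = d then f x else 0)
    (Eventually.of_forall fun t => ?_) n
  have : (fun n => t ^ n • (if n = d then f x else 0)) = fun n => if n = d then f (t • x) else 0 := by
    funext n
    split_ifs with hn
    · rw [hn, h]
    · simp
  rw [this]
  exact hasSum_ite_eq d (f (t • x))

lemma eventually_norm_lt {ρ : ℝ} (hρ : 0 < ρ) : ∀ᶠ x in 𝓝 (0 : E), 2 * ‖x‖ < ρ :=
  (continuous_const.mul continuous_norm).continuousAt.eventually_lt continuousAt_const
    (by simpa using hρ)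

lemma exists_radius {C : ℝ} (hC : 0 ≤ C) {m : ℕ} (hm : m ≠ 0) :
    ∃ ρ : ℝ, 0 < ρ ∧ ρ ≤ 1 ∧ C * ρ ^ m ≤ 1 / 2 := by
  refine ⟨1 / (2 * (C + 1)), by positivity, ?_, ?_⟩
  · rw [div_le_one (by positivity)]; linarith
  · have h1 : 1 / (2 * (C + 1)) ≤ 1 := by rw [div_le_one (by positivity)]; linarith
    have h2 : (1 / (2 * (C + 1))) ^ m ≤ 1 / (2 * (C + 1)) :=
      pow_le_of_le_one (by positivity) h1 hm
    refine (mul_le_mul_of_nonneg_left h2 hC).trans ?_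
    rw [mul_one_div, div_le_div_iff₀ (by positivity) (by norm_num)]
    linarith

/-- Differentiate the homogeneity relation in x; one factor t comes from the chain rule and is
cancelled, hence `t ≠ 0`. -/
lemma fderiv_real_smul {f : E → F} (hf : Differentiable ℂ f) {d : ℕ}
    (h : ∀ (t : ℝ) x, f (t • x) = t ^ (d + 1) • f x) {t : ℝ} (ht : t ≠ 0) (x a : E) :
    fderiv ℂ f (t • x) a = t ^ d • fderiv ℂ f x a := by
  have h1 : HasFDerivAt (fun y : E => f (t • y)) ((fderiv ℂ f (t • x)).comp
      ((t : ℂ) • ContinuousLinearMap.id ℂ E)) x := by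
    refine (hf (t • x)).hasFDerivAt.comp x ?_
    exact (((t : ℂ) • ContinuousLinearMap.id ℂ E).hasFDerivAt (x := x)).congr_of_eventuallyEq
      (Eventually.of_forall fun y => by simp)
  have h3 : HasFDerivAt (fun y : E => f (t • y)) (((t : ℂ) ^ (d + 1)) • fderiv ℂ f x) x := by
    have h2 : (fun y : E => f (t • y)) = fun y => ((t : ℂ) ^ (d + 1)) • f y := by
      funext y
      rw [h, ← Complex.ofReal_pow, Complex.coe_smul]
    rw [h2]
    exact (hf x).hasFDerivAt.const_smul _
  have h4 := congrArg (fun L => L a) (h1.unique h3)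
  simp only [ContinuousLinearMap.comp_apply, _root_.smul_apply, ContinuousLinearMap.id_apply,
    map_smul, pow_succ'] at h4
  rw [mul_smul] at h4
  have h5 := smul_right_injective F (Complex.ofReal_ne_zero.2 ht) h4
  simpa [← Complex.ofReal_pow] using h5

end Homogeneous

/-- The data of the complexified midpoint scheme `x ↦ x + T g(y)`, `y = x + g(y) / 2`:
a homogeneous nonlinearity `g`, linear operators `T` and `S = T⁻¹`, and a bilinear form `B`
which the scheme preserves. -/
structure MidpointSystem (r : ℕ) (C : ℝ) (E : Type) [NormedAddCommGroup E] [NormedSpace ℂ E] where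
  g : E → E
  T : E →L[ℂ] E
  S : E →L[ℂ] E
  B : E →L[ℂ] E →L[ℂ] ℂ
  contDiff_g : ContDiff ℂ ω g
  g_le : ∀ x, ‖g x‖ ≤ C * ‖x‖ ^ (2 * r + 1)
  g_smul : ∀ (c : ℂ) x, g (c • x) = c ^ (2 * r + 1) • g x
  T_le : ∀ x, ‖T x‖ ≤ ‖x‖
  S_T : ∀ x, S (T x) = x
  -- That is, S is the identity plus a B-skew operator. This is the property that balances the
  -- quadratic term in `scheme_symplectic`.
  B_S : ∀ x y, B (S x) y + B x (S y) = 2 * B x y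
  B_g : ∀ x a b, B (T (fderiv ℂ g x a)) b + B a (T (fderiv ℂ g x b)) = 0

namespace MidpointSystem

variable {r : ℕ} {C : ℝ} {E : Type} [NormedAddCommGroup E] [NormedSpace ℂ E]
  (s : MidpointSystem r C E)

/-- The internal stage `y = x + g(y) / 2`. -/
def stage : E → E := solve fun y => (1 / 2 : ℂ) • s.g y

/-- The numerical scheme. -/
def scheme (x : E) : E := x + s.T (s.g (s.stage x))

/-- The truncated modified vector field: the sum of the first `N` coefficients. -/
def fieldSum : ℕ → E → E
  | 0 => fun _ => 0
  | N + 1 => fun x => fieldSum N x +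
      homPart (2 * r * (N + 1) + 1) (fun y => s.scheme y - flowOne (fieldSum N) y) x

/-- The difference of the scheme and the time-one flow of the truncated modified field. -/
def defect (N : ℕ) (x : E) : E := s.scheme x - flowOne (s.fieldSum N) x

/-- The coefficients of the modified vector field. -/
def field (N : ℕ) : E → E := homPart (2 * r * (N + 1) + 1) (s.defect N)

lemma fieldSum_succ (N : ℕ) :
    s.fieldSum (N + 1) = fun x => s.fieldSum N x + s.field N x := rfl

lemma fieldSum_succ_apply (N : ℕ) (x : E) :
    s.fieldSum (N + 1) x = s.fieldSum N x + s.field N x := rfl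

lemma fieldSum_eq_sum (N : ℕ) (x : E) :
    s.fieldSum N x = ∑ k ∈ Finset.range N, s.field k x := by
  induction N with
  | zero => rfl
  | succ N ih => rw [fieldSum_succ_apply, Finset.sum_range_succ, ih]

lemma smoothField_field (N : ℕ) : SmoothField (s.field N) := smoothField_homPart _ _

lemma smoothField_fieldSum (N : ℕ) : SmoothField (s.fieldSum N) := by
  induction N with
  | zero => exact SmoothField.zero
  | succ N ih => exact ih.add (s.smoothField_field N)

lemma field_real_smul (N : ℕ) [CompleteSpace E] (t : ℝ) (x : E) :
    s.field N (t • x) = t ^ (2 * r * (N + 1) + 1) • s.field N x :=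
  homPart_real_smul _ _ _ _

lemma stageMap_halfLip {ρ : ℝ} (hg : HalfLip s.g ρ) :
    HalfLip (fun y => (1 / 2 : ℂ) • s.g y) ρ where
  zero := by simp [hg.zero]
  lip := fun y z hy hz => by
    rw [← smul_sub, norm_smul]
    refine le_trans ?_ (hg.lip y z hy hz)
    have : ‖(1 / 2 : ℂ)‖ ≤ 1 := by norm_num
    exact mul_le_of_le_one_left (norm_nonneg _) this

lemma contDiff_stageMap : ContDiff ℂ ω (fun y => (1 / 2 : ℂ) • s.g y) :=
  contDiff_const.smul s.contDiff_g

variable [CompleteSpace E] {ρ : ℝ}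

lemma powLip_g (hr : 1 ≤ r) (hC : 0 ≤ C) : PowLip (C * 2 ^ (2 * r + 1)) (2 * r) s.g :=
  powLip_of_homogeneous (by omega) hC s.contDiff_g s.g_le

/-! ### The scheme on a small ball. -/

section Small

variable (hg : HalfLip s.g ρ)

include hg

lemma norm_stage_le {x : E} (hx : 2 * ‖x‖ ≤ ρ) : ‖s.stage x‖ ≤ 2 * ‖x‖ :=
  (s.stageMap_halfLip hg).norm_solve_le hx

lemma stage_eq {x : E} (hx : 2 * ‖x‖ ≤ ρ) : s.stage x = x + (1 / 2 : ℂ) • s.g (s.stage x) :=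
  (s.stageMap_halfLip hg).solve_eq hx

lemma norm_scheme_le {x : E} (hx : 2 * ‖x‖ ≤ ρ) : ‖s.scheme x‖ ≤ 2 * ‖x‖ := by
  have h1 := s.norm_stage_le hg hx
  have h2 := hg.norm_le (h1.trans hx)
  have h3 := s.T_le (s.g (s.stage x))
  have h4 := norm_add_le x (s.T (s.g (s.stage x)))
  rw [scheme]
  linarith

lemma analyticAt_stage {x : E} (hx : 2 * ‖x‖ < ρ) : AnalyticAt ℂ s.stage x :=
  (s.stageMap_halfLip hg).analyticAt_solve s.contDiff_stageMap hx

lemma analyticAt_scheme {x : E} (hx : 2 * ‖x‖ < ρ) : AnalyticAt ℂ s.scheme x :=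
  analyticAt_id.add ((s.T.analyticAt _).comp
    (s.contDiff_g.contDiffAt.analyticAt.comp (s.analyticAt_stage hg hx)))

lemma scheme_equivariant (S : E →L[ℝ] E) (hS : ∀ x, ‖S x‖ = ‖x‖)
    (hSg : ∀ x, s.g (S x) = S (s.g x)) (hST : ∀ x, s.T (S x) = S (s.T x)) {x : E}
    (hx : 2 * ‖x‖ ≤ ρ) : s.scheme (S x) = S (s.scheme x) := by
  have h : s.stage (S x) = S (s.stage x) := by
    refine (s.stageMap_halfLip hg).solve_equivariant (fun x y => map_add S x y) hS (fun y => ?_) hx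
    have h1 : ∀ z : E, (1 / 2 : ℂ) • z = (1 / 2 : ℝ) • z := fun z => by
      rw [← Complex.coe_smul]; norm_num
    rw [hSg, h1, h1, map_smul]
  rw [scheme, h, hSg, hST, ← map_add, scheme]

/-- The scheme preserves the bilinear form. -/
lemma scheme_symplectic {x : E} (hx : 2 * ‖x‖ < ρ) (a b : E) :
    s.B (fderiv ℂ s.scheme x a) (fderiv ℂ s.scheme x b) = s.B a b := by
  set y := s.stage x with hy
  set D := fderiv ℂ s.stage x with hD
  have hstage : ∀ c, D c = c + (1 / 2 : ℂ) • fderiv ℂ s.g y (D c) := by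
    intro c
    have h1 := (s.stageMap_halfLip hg).fderiv_solve s.contDiff_stageMap hx c
    rw [fderiv_fun_const_smul (s.contDiff_g.differentiable (by simp) _)] at h1
    exact h1
  have hsch : ∀ c, fderiv ℂ s.scheme x c = c + s.T (fderiv ℂ s.g y (D c)) := by
    intro c
    have h1 : HasFDerivAt s.scheme (ContinuousLinearMap.id ℂ E +
        s.T.comp ((fderiv ℂ s.g y).comp D)) x :=
      (hasFDerivAt_id x).add (s.T.hasFDerivAt.comp x
        ((s.contDiff_g.differentiable (by simp) y).hasFDerivAt.comp x
          (s.analyticAt_stage hg hx).differentiableAt.hasFDerivAt))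
    rw [h1.fderiv]; rfl
  -- The variation of x is recovered from that of the stage; inserting S T = 1 expresses the
  -- correction through the increment of the scheme.
  have hdy : ∀ c, c = D c - (1 / 2 : ℂ) • s.S (s.T (fderiv ℂ s.g y (D c))) := by
    intro c
    rw [s.S_T, eq_sub_iff_add_eq]
    exact (hstage c).symm
  rw [hsch, hsch]
  set p := s.T (fderiv ℂ s.g y (D a)) with hp
  set q := s.T (fderiv ℂ s.g y (D b)) with hq
  have h1 := s.B_g y (D a) (D b)
  have h2 := s.B_S p q
  have ha : s.B a q = s.B (D a) q - (1 / 2) * s.B (s.S p) q := by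
    conv_lhs => rw [hdy a]
    simp [hp]
  have hb : s.B p b = s.B p (D b) - (1 / 2) * s.B p (s.S q) := by
    conv_lhs => rw [hdy b]
    simp [hq]
  simp only [map_add, _root_.add_apply]
  rw [ha, hb]
  -- `B_g` removes the terms linear in the increments p, q, and `B_S` turns ½(B(Sp,q) + B(p,Sq))
  -- into B(p,q), cancelling the quadratic term.
  linear_combination h1 - (1 / 2) * h2

lemma isBigO_scheme_sub_id :
    ∀ x : E, 2 * ‖x‖ ≤ ρ → ‖s.scheme x - x‖ ≤ |C| * 2 ^ (2 * r + 1) * ‖x‖ ^ (2 * r + 1) := by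
  intro x hx
  rw [scheme, add_sub_cancel_left]
  refine (s.T_le _).trans ((s.g_le _).trans ?_)
  rw [mul_assoc, ← mul_pow]
  refine mul_le_mul (le_abs_self C) ?_ (by positivity) (abs_nonneg _)
  gcongr
  exact s.norm_stage_le hg hx

end Small

lemma flowOne_fieldSum_zero {x : E} (hx : 2 * ‖x‖ ≤ ρ) : flowOne (s.fieldSum 0) x = x := by
  have h0 : HalfLip (s.fieldSum 0) ρ := ⟨rfl, fun y z _ _ => by simp [fieldSum]⟩
  have h1 := flowCurve_eq h0 continuous_const hx
  have h2 : nemytskii (s.fieldSum 0) (flowCurve (s.fieldSum 0) x) = 0 := by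
    ext t; rw [nemytskii_apply (X := s.fieldSum 0) continuous_const]; rfl
  rw [h2, map_zero, add_zero] at h1
  rw [flowOne, h1]; rfl

/-- The ball of radius `ρ` is small for the scheme and the `N`-th truncated modified field. -/
structure Small (N : ℕ) (ρ : ℝ) : Prop where
  pos : 0 < ρ
  le_one : ρ ≤ 1
  g : HalfLip s.g ρ
  fieldSum : HalfLip (s.fieldSum N) ρ

namespace Small

variable {s} {N : ℕ} (h : s.Small N ρ)

include h

lemma analyticAt_defect {x : E} (hx : 2 * ‖x‖ < ρ) : AnalyticAt ℂ (s.defect N) x :=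
  (s.analyticAt_scheme h.g hx).sub (analyticAt_flowOne h.fieldSum (s.smoothField_fieldSum N) hx)

lemma analyticAt_defect_zero : AnalyticAt ℂ (s.defect N) 0 :=
  h.analyticAt_defect (by simpa using h.pos)

lemma norm_defect_le {x : E} (hx : 2 * ‖x‖ ≤ ρ) : ‖s.defect N x‖ ≤ 2 := by
  have h1 := s.norm_scheme_le h.g hx
  have h2 := norm_flowOne_le h.fieldSum (s.smoothField_fieldSum N).cont hx
  have h3 := norm_sub_le (s.scheme x) (flowOne (s.fieldSum N) x)
  have := h.le_one
  rw [defect]; linarith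

lemma norm_homPart_defect_le (n : ℕ) (x : E) :
    ‖homPart n (s.defect N) x‖ ≤ 2 / (ρ / 4) ^ n * ‖x‖ ^ n := by
  have := h.pos
  exact norm_homPart_le (ρ := ρ / 2) (fun y hy => h.analyticAt_defect (by linarith))
    (fun y hy => h.norm_defect_le (by linarith)) (by linarith) (by linarith) n x

lemma hasSum_homPart_defect {x : E} (hx : 2 * ‖x‖ < ρ) :
    HasSum (fun n => homPart n (s.defect N) x) (s.defect N x) :=
  hasSum_homPart (ρ := ρ / 2) (fun y hy => h.analyticAt_defect (by linarith)) (by linarith)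

lemma homPart_defect_equivariant (S : E →L[ℝ] E) (hS : ∀ x, ‖S x‖ = ‖x‖)
    (hSg : ∀ x, s.g (S x) = S (s.g x)) (hST : ∀ x, s.T (S x) = S (s.T x))
    (hSX : ∀ x, s.fieldSum N (S x) = S (s.fieldSum N x)) (n : ℕ) (x : E) :
    homPart n (s.defect N) (S x) = S (homPart n (s.defect N) x) := by
  refine homPart_map h.analyticAt_defect_zero S S ?_ n x
  filter_upwards [eventually_norm_lt h.pos] with y hy
  rw [defect, s.scheme_equivariant h.g S hS hSg hST hy.le,
    flowOne_equivariant h.fieldSum (s.smoothField_fieldSum N).cont S hS hSX hy.le, ← map_sub]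
  rfl

end Small

/-- A common smallness radius for all truncation orders gives equivariance of all coefficients. -/
lemma fieldSum_equivariant (hsm : ∀ N, ∃ ρ, s.Small N ρ) (S : E →L[ℝ] E) (hS : ∀ x, ‖S x‖ = ‖x‖)
    (hSg : ∀ x, s.g (S x) = S (s.g x)) (hST : ∀ x, s.T (S x) = S (s.T x)) (N : ℕ) (x : E) :
    s.fieldSum N (S x) = S (s.fieldSum N x) := by
  induction N generalizing x with
  | zero => simp [fieldSum]
  | succ N ih =>
    obtain ⟨ρ, hρ⟩ := hsm N
    rw [fieldSum_succ_apply, fieldSum_succ_apply, map_add, ← ih, field,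
      hρ.homPart_defect_equivariant S hS hSg hST ih]

lemma homPart_defect_equivariant (hsm : ∀ N, ∃ ρ, s.Small N ρ) (S : E →L[ℝ] E)
    (hS : ∀ x, ‖S x‖ = ‖x‖) (hSg : ∀ x, s.g (S x) = S (s.g x))
    (hST : ∀ x, s.T (S x) = S (s.T x)) (N n : ℕ) (x : E) :
    homPart n (s.defect N) (S x) = S (homPart n (s.defect N) x) :=
  (hsm N).choose_spec.homPart_defect_equivariant S hS hSg hST
    (s.fieldSum_equivariant hsm S hS hSg hST N) n x

/-- Only the degrees `2 r l + 1` occur. -/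
lemma homPart_defect_eq_zero (hr : 1 ≤ r) (hsm : ∀ N, ∃ ρ, s.Small N ρ) (N : ℕ) {n : ℕ}
    (hn : ∀ l, n ≠ 2 * r * l + 1) (x : E) : homPart n (s.defect N) x = 0 := by
  -- For a primitive 2r-th root of unity ζ^(2r+1) = ζ, so g, and with it the defect, commutes with
  -- multiplication by ζ. A nonzero part of degree n then forces ζ^n = ζ.
  have hζ := Complex.isPrimitiveRoot_exp (2 * r) (by omega)
  set ζ := Complex.exp (2 * Real.pi * Complex.I / ((2 * r : ℕ) : ℂ)) with hζd
  have hnorm : ‖ζ‖ = 1 := hζ.norm'_eq_one (by omega)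
  set S : E →L[ℝ] E := (ζ • ContinuousLinearMap.id ℂ E).restrictScalars ℝ with hS
  have hSx : ∀ x, S x = ζ • x := fun x => rfl
  have h1 := s.homPart_defect_equivariant hsm S (fun x => by rw [hSx, norm_smul, hnorm, one_mul])
    (fun x => by rw [hSx, s.g_smul, pow_succ, hζ.pow_eq_one, one_mul, hSx])
    (fun x => by rw [hSx, map_smul, hSx]) N n x
  rw [hSx, hSx, homPart_smul] at h1
  by_contra hne
  have h2 : ζ ^ n = ζ := smul_left_injective ℂ hne h1
  -- Degree 0 would give ζ = 1, impossible as 2r ≥ 2.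
  rcases Nat.eq_zero_or_pos n with rfl | hpos
  · rw [pow_zero] at h2
    have := hζ.eq_orderOf
    rw [← h2, orderOf_one] at this
    omega
  · obtain ⟨m, rfl⟩ : ∃ m, n = m + 1 := ⟨n - 1, by omega⟩
    have hζ0 : ζ ≠ 0 := hζ.ne_zero (by omega)
    have h3 : ζ ^ m = 1 := by
      rw [pow_succ] at h2
      exact mul_right_cancel₀ hζ0 (by rw [h2, one_mul])
    obtain ⟨l, hl⟩ := (hζ.pow_eq_one_iff_dvd m).1 h3
    exact hn l (by rw [hl])

end MidpointSystem

end MidpointNLS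

end

noncomputable section

namespace MidpointNLS

open Set Filter Topology Metric Asymptotics MeasureTheory
open scoped ContDiff Nat

namespace MidpointSystem

/-! ### Radii and Lipschitz constants common to all systems. -/

section Uniform

/-- The quantifier order is the point: the radius is fixed before the space and the system, which
later carry K, δx and h. -/
lemma exists_small_of_powLip {r : ℕ} (hr : 1 ≤ r) {C L : ℝ} (hC : 0 ≤ C) (hL : 0 ≤ L) (N : ℕ) :
    ∃ ρ : ℝ, 0 < ρ ∧ ∀ (E : Type) [NormedAddCommGroup E] [NormedSpace ℂ E] [CompleteSpace E]
      (s : MidpointSystem r C E), PowLip L (2 * r) (s.fieldSum N) → s.Small N ρ := by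
  obtain ⟨ρ, h0, h1, h2⟩ := exists_radius (C := L + C * 2 ^ (2 * r + 1)) (by positivity)
    (m := 2 * r) (by omega)
  refine ⟨ρ, h0, fun E _ _ _ s hs => ⟨h0, h1, ?_, ?_⟩⟩
  · refine (s.powLip_g hr hC).halfLip h1 (le_trans ?_ h2)
    gcongr
    linarith
  · refine hs.halfLip h1 (le_trans ?_ h2)
    gcongr
    linarith [show 0 ≤ C * 2 ^ (2 * r + 1) by positivity]

lemma norm_field_le {r : ℕ} {C : ℝ} {E : Type} [NormedAddCommGroup E] [NormedSpace ℂ E]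
    [CompleteSpace E] {s : MidpointSystem r C E} {N : ℕ} {ρ : ℝ} (h : s.Small N ρ) (x : E) :
    ‖s.field N x‖ ≤
      2 / (ρ / 4) ^ (2 * r * (N + 1) + 1) * ‖x‖ ^ (2 * r * (N + 1) + 1) :=
  h.norm_homPart_defect_le _ x

lemma two_le_degree {r : ℕ} (hr : 1 ≤ r) (N : ℕ) : 2 ≤ 2 * r * (N + 1) + 1 := by
  have : 1 ≤ r * (N + 1) := Nat.mul_pos hr N.succ_pos
  rw [mul_assoc]; omega

lemma powLip_field {r : ℕ} (hr : 1 ≤ r) {C : ℝ} {E : Type} [NormedAddCommGroup E]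
    [NormedSpace ℂ E] [CompleteSpace E] {s : MidpointSystem r C E} {N : ℕ} {ρ : ℝ}
    (h : s.Small N ρ) :
    PowLip (2 / (ρ / 4) ^ (2 * r * (N + 1) + 1) * 2 ^ (2 * r * (N + 1) + 1)) (2 * r * (N + 1))
      (s.field N) := by
  have := h.pos
  exact powLip_of_homogeneous (two_le_degree hr N) (by positivity)
    (s.smoothField_field N).contDiff_field (norm_field_le h)

/-- Induction: a common radius at level N bounds the next coefficient by Cauchy's estimate, hence
its Lipschitz constant, hence yields a common constant at level N + 1. -/
lemma exists_powLip {r : ℕ} (hr : 1 ≤ r) {C : ℝ} (hC : 0 ≤ C) (N : ℕ) :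
    ∃ L : ℝ, 0 ≤ L ∧ ∀ (E : Type) [NormedAddCommGroup E] [NormedSpace ℂ E] [CompleteSpace E]
      (s : MidpointSystem r C E), PowLip L (2 * r) (s.fieldSum N) := by
  induction N with
  | zero => exact ⟨0, le_rfl, fun E _ _ _ s => PowLip.zero_field _⟩
  | succ N ih =>
    obtain ⟨L, hL, h⟩ := ih
    obtain ⟨ρ, hρ, hs⟩ := exists_small_of_powLip hr hC hL N
    refine ⟨L + 2 / (ρ / 4) ^ (2 * r * (N + 1) + 1) * 2 ^ (2 * r * (N + 1) + 1), by positivity,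
      fun E _ _ _ s => ?_⟩
    exact (h E s).add (powLip_field hr (hs E s (h E s)))
      (Nat.le_mul_of_pos_right _ N.succ_pos) (by positivity)

/-- A smallness radius which is the same for all systems. -/
theorem exists_small {r : ℕ} (hr : 1 ≤ r) {C : ℝ} (hC : 0 ≤ C) (N : ℕ) :
    ∃ ρ : ℝ, 0 < ρ ∧ ∀ (E : Type) [NormedAddCommGroup E] [NormedSpace ℂ E] [CompleteSpace E]
      (s : MidpointSystem r C E), s.Small N ρ := by
  obtain ⟨L, hL, h⟩ := exists_powLip hr hC N
  obtain ⟨ρ, hρ, hs⟩ := exists_small_of_powLip hr hC hL N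
  exact ⟨ρ, hρ, fun E _ _ _ s => hs E s (h E s)⟩

end Uniform

/-! ### Order of the defect and Hamiltonian nature of the coefficients. -/

variable {r : ℕ} {C : ℝ} {E : Type} [NormedAddCommGroup E] [NormedSpace ℂ E] [CompleteSpace E]
  (s : MidpointSystem r C E)

lemma small (hr : 1 ≤ r) (hC : 0 ≤ C) (N : ℕ) : ∃ ρ, s.Small N ρ := by
  obtain ⟨ρ, -, h⟩ := exists_small hr hC N
  exact ⟨ρ, h E s⟩

/-- The difference of the scheme and the flow of the next truncation, to leading order. -/
def nextDefect (N : ℕ) (x : E) : E := s.defect N x - s.field N x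

variable (hr : 1 ≤ r) (hC : 0 ≤ C)

include hr hC

lemma analyticAt_field (N : ℕ) (x : E) : AnalyticAt ℂ (s.field N) x :=
  (s.smoothField_field N).contDiff_field.contDiffAt.analyticAt

lemma eventually_analyticAt_nextDefect (N : ℕ) :
    ∀ᶠ x in 𝓝 (0 : E), AnalyticAt ℂ (s.nextDefect N) x := by
  obtain ⟨ρ, hρ⟩ := s.small hr hC N
  filter_upwards [eventually_norm_lt hρ.pos] with x hx
  exact (hρ.analyticAt_defect hx).sub (s.analyticAt_field hr hC N x)

/-- Degrees below 2r(N+1)+1 vanish by assumption, that degree is subtracted off, and the degrees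
strictly between it and 2r(N+2)+1 never occur. -/
lemma isBigO_nextDefect_of_isBigO {N : ℕ}
    (h : s.defect N =O[𝓝 0] fun x => ‖x‖ ^ (2 * r * (N + 1) + 1)) :
    s.nextDefect N =O[𝓝 0] fun x => ‖x‖ ^ (2 * r * (N + 1 + 1) + 1) := by
  obtain ⟨ρ, hρ⟩ := s.small hr hC N
  refine isBigO_of_homPart_eq_zero
    (s.eventually_analyticAt_nextDefect hr hC N).self_of_nhds fun n hn x => ?_
  have h1 : homPart n (s.nextDefect N) x = homPart n (s.defect N) x - homPart n (s.field N) x :=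
    homPart_sub hρ.analyticAt_defect_zero (s.analyticAt_field hr hC N 0) n x
  rw [h1, homPart_of_homogeneous (s.analyticAt_field hr hC N 0)
    (fun t => s.field_real_smul N t x)]
  split_ifs with hd
  · rw [hd, field, sub_self]
  · rw [sub_zero]
    by_cases hl : ∃ l, n = 2 * r * l + 1
    · obtain ⟨l, rfl⟩ := hl
      refine homPart_eq_zero_of_isBigO hρ.analyticAt_defect_zero (isBigO_ray h x) _ ?_
      have h2 : l < N + 1 + 1 := by
        by_contra hl
        have := Nat.mul_le_mul_left (2 * r) (not_lt.1 hl)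
        omega
      have h3 : l ≠ N + 1 := fun h => hd (by rw [h])
      have h4 : l < N + 1 := by omega
      have := Nat.mul_lt_mul_of_pos_left h4 (show 0 < 2 * r by omega)
      omega
    · push Not at hl
      exact s.homPart_defect_eq_zero hr (s.small hr hC) N hl x

/-- The scheme agrees with the flow of the truncated modified field up to order `2 r (N + 1)`. -/
theorem isBigO_defect (N : ℕ) :
    s.defect N =O[𝓝 0] fun x => ‖x‖ ^ (2 * r * (N + 1) + 1) := by
  induction N with
  | zero =>
    obtain ⟨ρ, hρ⟩ := s.small hr hC 0
    refine IsBigO.of_bound (|C| * 2 ^ (2 * r + 1)) ?_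
    filter_upwards [eventually_norm_lt hρ.pos] with x hx
    rw [defect, s.flowOne_fieldSum_zero hx.le, Real.norm_of_nonneg (by positivity), zero_add,
      mul_one]
    exact s.isBigO_scheme_sub_id hρ.g x hx.le
  | succ N ih =>
    have h1 := s.isBigO_nextDefect_of_isBigO hr hC ih
    obtain ⟨L, hL, hLs⟩ := exists_powLip hr hC N
    obtain ⟨ρ₀, hρ₀⟩ := s.small hr hC N
    have hp := hρ₀.pos
    set L' := 2 / (ρ₀ / 4) ^ (2 * r * (N + 1) + 1) * 2 ^ (2 * r * (N + 1) + 1) with hL'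
    have hL'0 : 0 ≤ L' := by positivity
    obtain ⟨ρ, hρ0, hρ1, hρ⟩ := exists_radius (C := L + L') (by positivity) (m := 2 * r) (by omega)
    -- Adding the new coefficient to the field changes the flow by that coefficient up to order 2r +
    -- 2r(N+1) + 1, which is the order required at the next level.
    have h2 : (fun x => flowOne (s.fieldSum (N + 1)) x - flowOne (s.fieldSum N) x - s.field N x)
        =O[𝓝 0] fun x => ‖x‖ ^ (2 * r * (N + 1 + 1) + 1) := by
      refine IsBigO.of_bound (L' * (3 * L + L') * 2 ^ (2 * r * (N + 1 + 1) + 1)) ?_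
      filter_upwards [eventually_norm_lt hρ0] with x hx
      have h3 := norm_flowOne_add_sub_le (hLs E s) (powLip_field hr hρ₀)
        (s.smoothField_fieldSum N).cont (s.smoothField_field N).cont hL hL'0
        (Nat.le_mul_of_pos_right _ N.succ_pos) hρ1 hρ hx.le
      rw [← fieldSum_succ] at h3
      refine h3.trans (le_of_eq ?_)
      rw [Real.norm_of_nonneg (by positivity), mul_pow]
      ring
    refine (h1.sub h2).congr_left fun x => ?_
    rw [nextDefect, defect, defect]
    abel

lemma isBigO_nextDefect (N : ℕ) :
    s.nextDefect N =O[𝓝 0] fun x => ‖x‖ ^ (2 * r * (N + 1 + 1) + 1) :=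
  s.isBigO_nextDefect_of_isBigO hr hC (s.isBigO_defect hr hC N)

lemma homPart_defect_eq_zero_of_le (N n : ℕ) (hn : n ≤ 2 * r * N + 1) (x : E) :
    homPart n (s.defect N) x = 0 := by
  obtain ⟨ρ, hρ⟩ := s.small hr hC N
  refine homPart_eq_zero_of_isBigO hρ.analyticAt_defect_zero
    (isBigO_ray (s.isBigO_defect hr hC N) x) n (lt_of_le_of_lt hn ?_)
  have := Nat.mul_lt_mul_of_pos_left (Nat.lt_succ_self N) (show 0 < 2 * r by omega)
  exact Nat.succ_lt_succ this

/-- The leading coefficient of the modified field. -/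
lemma field_zero (x : E) : s.field 0 x = s.T (s.g x) := by
  obtain ⟨ρ, hρ⟩ := s.small hr hC 0
  have hTg : AnalyticAt ℂ (fun x => s.T (s.g x)) 0 :=
    (s.T.analyticAt _).comp s.contDiff_g.contDiffAt.analyticAt
  have hhom : ∀ t : ℝ, s.T (s.g (t • x)) = t ^ (2 * r + 1) • s.T (s.g x) := fun t => by
    rw [← Complex.coe_smul, s.g_smul, map_smul, ← Complex.ofReal_pow, Complex.coe_smul]
  -- The zero field has the identity as its flow, so this is T(g(stage) - g(x)): a Lipschitz factor
  -- of order 2r times stage - x of order 2r+1. Since 4r+1 > 2r+1, the part of degree 2r+1 vanishes.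
  have h1 : (fun x => s.defect 0 x - s.T (s.g x)) =O[𝓝 0] fun x => ‖x‖ ^ (4 * r + 1) := by
    refine IsBigO.of_bound (C * 2 ^ (2 * r + 1) * 2 ^ (2 * r) * (C * 2 ^ (2 * r + 1))) ?_
    filter_upwards [eventually_norm_lt hρ.pos] with x hx
    have hst := s.norm_stage_le hρ.g hx.le
    rw [defect, s.flowOne_fieldSum_zero hx.le, scheme, add_sub_cancel_left, ← map_sub,
      Real.norm_of_nonneg (by positivity)]
    refine (s.T_le _).trans (((s.powLip_g hr hC).lip (2 * ‖x‖) _ _ (hx.le.trans hρ.le_one) hst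
      (by linarith [norm_nonneg x])).trans ?_)
    have h2 : ‖s.stage x - x‖ ≤ C * 2 ^ (2 * r + 1) * ‖x‖ ^ (2 * r + 1) := by
      conv_lhs => rw [s.stage_eq hρ.g hx.le]
      rw [add_sub_cancel_left, norm_smul]
      have h3 : ‖(1 / 2 : ℂ)‖ ≤ 1 := by norm_num
      refine (mul_le_of_le_one_left (norm_nonneg _) h3).trans ((s.g_le _).trans ?_)
      rw [mul_assoc, ← mul_pow]
      gcongr
    calc _ ≤ C * 2 ^ (2 * r + 1) * (2 * ‖x‖) ^ (2 * r) *
          (C * 2 ^ (2 * r + 1) * ‖x‖ ^ (2 * r + 1)) := by gcongr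
      _ = _ := by rw [mul_pow]; ring
  have h2 := homPart_eq_zero_of_isBigO (hρ.analyticAt_defect_zero.sub hTg) (isBigO_ray h1 x)
    (2 * r + 1) (by omega)
  have h3 := homPart_sub hρ.analyticAt_defect_zero hTg (2 * r + 1) x
  rw [homPart_of_homogeneous hTg hhom, if_pos rfl] at h3
  have h4 : homPart (2 * r + 1) (s.defect 0) x - s.T (s.g x) = 0 := h3.symm.trans h2
  rw [field, zero_add, mul_one]
  exact sub_eq_zero.1 h4

omit [CompleteSpace E] hr hC in
lemma tendsto_of_norm_sub_le {u : ℝ → E} {a : E} {K : ℝ}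
    (h : ∀ᶠ t in 𝓝[≠] (0 : ℝ), ‖u t - a‖ ≤ K * |t|) : Tendsto u (𝓝[≠] 0) (𝓝 a) := by
  rw [tendsto_iff_norm_sub_tendsto_zero]
  have h0 : Tendsto (fun t : ℝ => K * |t|) (𝓝[≠] 0) (𝓝 0) := by
    have : Continuous fun t : ℝ => K * |t| := by fun_prop
    simpa using (this.tendsto 0).mono_left nhdsWithin_le_nhds
  exact squeeze_zero' (Eventually.of_forall fun _ => norm_nonneg _) h h0

/-- The derivative of a map of order `d + 1` is of order `d`. -/
lemma exists_norm_fderiv_ray_le {f : E → E} {d : ℕ} (hd : 1 ≤ d)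
    (hf : ∀ᶠ x in 𝓝 (0 : E), AnalyticAt ℂ f x)
    (hO : f =O[𝓝 0] fun x => ‖x‖ ^ (d + 1)) (x a : E) :
    ∃ K : ℝ, ∀ᶠ t in 𝓝 (0 : ℝ), ‖fderiv ℂ f (t • x) a‖ ≤ K * |t| ^ d := by
  obtain ⟨K, hK0, hK⟩ := hO.exists_nonneg
  obtain ⟨ρ, hρ, hb⟩ := Metric.eventually_nhds_iff.1 (hf.and hK.bound)
  simp only [dist_zero_right] at hb
  refine ⟨K * 2 ^ (d + 1) * ‖x‖ ^ d * ‖a‖, ?_⟩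
  filter_upwards [(tendsto_real_smul x).eventually (eventually_norm_lt hρ)] with t ht
  have h1 := norm_fderiv_le_of_norm_le_pow (d := d + 1) (by omega) hK0 (fun y hy => (hb hy).1)
    (fun y hy => by
      have := (hb hy).2
      rwa [Real.norm_of_nonneg (by positivity)] at this) ht
  refine (ContinuousLinearMap.le_of_opNorm_le _ h1 a).trans (le_of_eq ?_)
  rw [Nat.add_sub_cancel, norm_smul, mul_pow, Real.norm_eq_abs]
  ring

omit [CompleteSpace E] hr hC in
/-- Comparison of the leading terms of two symplectic maps. -/
lemma bilinear_leading_term (B : E →L[ℂ] E →L[ℂ] ℂ) {a b α β : E} {p q u v : ℝ → E} {d : ℕ}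
    (hd : 1 ≤ d) (hp : Tendsto p (𝓝[≠] 0) (𝓝 a)) (hq : Tendsto q (𝓝[≠] 0) (𝓝 b))
    (hu : Tendsto u (𝓝[≠] 0) (𝓝 α)) (hv : Tendsto v (𝓝[≠] 0) (𝓝 β))
    (h : ∀ᶠ t in 𝓝[≠] (0 : ℝ), B (p t - t ^ d • u t) (q t - t ^ d • v t) = B (p t) (q t)) :
    B α b + B a β = 0 := by
  have hB : Continuous fun z : E × E => B z.1 z.2 := by fun_prop
  have h1 : Tendsto (fun t => B (u t) (q t) + B (p t) (v t) - ((t : ℂ) ^ d) * B (u t) (v t))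
      (𝓝[≠] 0) (𝓝 (B α b + B a β - 0 * B α β)) := by
    refine Tendsto.sub (Tendsto.add ?_ ?_) (Tendsto.mul ?_ ?_)
    · exact (hB.tendsto (α, b)).comp (hu.prodMk_nhds hq)
    · exact (hB.tendsto (a, β)).comp (hp.prodMk_nhds hv)
    · have : Continuous fun t : ℝ => (t : ℂ) ^ d := by fun_prop
      have h2 := (this.tendsto 0).mono_left (nhdsWithin_le_nhds (s := {0}ᶜ))
      simpa [show d ≠ 0 by omega] using h2
    · exact (hB.tendsto (α, β)).comp (hu.prodMk_nhds hv)
  rw [zero_mul, sub_zero] at h1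
  refine tendsto_nhds_unique h1 (tendsto_const_nhds.congr' ?_)
  filter_upwards [h, self_mem_nhdsWithin] with t ht ht0
  have hc : ∀ y : E, t ^ d • y = ((t : ℂ) ^ d) • y := fun y => by
    rw [← Complex.ofReal_pow, Complex.coe_smul]
  simp only [hc, map_sub, map_smul, _root_.sub_apply, _root_.smul_apply, smul_eq_mul] at ht
  have hne : (t : ℂ) ^ d ≠ 0 := pow_ne_zero _ (Complex.ofReal_ne_zero.2 ht0)
  -- Expanding the hypothesis, every surviving term carries a factor t^d, which is divided out
  -- before t → 0.
  have h3 : (t : ℂ) ^ d * (B (u t) (q t) + B (p t) (v t) - ((t : ℂ) ^ d) * B (u t) (v t)) = 0 := by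
    linear_combination -ht
  exact ((mul_eq_zero.1 h3).resolve_left hne).symm

/-- The coefficients of the modified vector field are Hamiltonian. -/
theorem field_hamiltonian (N : ℕ) (x a b : E) :
    s.B (fderiv ℂ (s.field N) x a) b + s.B a (fderiv ℂ (s.field N) x b) = 0 := by
  induction N using Nat.strong_induction_on generalizing x a b with
  | _ N ih =>
  obtain ⟨ρ, hρ⟩ := s.small hr hC N
  have hsum : ∀ x a b, s.B (fderiv ℂ (s.fieldSum N) x a) b
      + s.B a (fderiv ℂ (s.fieldSum N) x b) = 0 := by
    intro x a b
    have h1 : s.fieldSum N = fun x => ∑ k ∈ Finset.range N, s.field k x := by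
      funext x; exact s.fieldSum_eq_sum N x
    have h2 : fderiv ℂ (s.fieldSum N) x = ∑ k ∈ Finset.range N, fderiv ℂ (s.field k) x := by
      rw [h1]
      exact fderiv_fun_sum fun k _ => (s.analyticAt_field hr hC k x).differentiableAt
    rw [h2]
    simp only [_root_.sum_apply, map_sum]
    rw [← Finset.sum_add_distrib]
    exact Finset.sum_eq_zero fun k hk => ih k (Finset.mem_range.1 hk) x a b
  set d := 2 * r * (N + 1) with hd
  have hd2 : 2 ≤ d := by
    have : 1 ≤ r * (N + 1) := Nat.mul_pos hr N.succ_pos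
    rw [hd, mul_assoc]; omega
  have hray : ∀ᶠ t in 𝓝[≠] (0 : ℝ), 2 * ‖t • x‖ < ρ :=
    nhdsWithin_le_nhds ((tendsto_real_smul x).eventually (eventually_norm_lt hρ.pos))
  have hscheme : ∀ c, Tendsto (fun t : ℝ => fderiv ℂ s.scheme (t • x) c) (𝓝[≠] 0) (𝓝 c) := by
    intro c
    have hO : (fun x => s.scheme x - x) =O[𝓝 0] fun x => ‖x‖ ^ (2 * r + 1) := by
      refine IsBigO.of_bound (|C| * 2 ^ (2 * r + 1)) ?_
      filter_upwards [eventually_norm_lt hρ.pos] with y hy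
      rw [Real.norm_of_nonneg (by positivity)]
      exact s.isBigO_scheme_sub_id hρ.g y hy.le
    have han : ∀ᶠ x in 𝓝 (0 : E), AnalyticAt ℂ (fun x => s.scheme x - x) x := by
      filter_upwards [eventually_norm_lt hρ.pos] with y hy
      exact (s.analyticAt_scheme hρ.g hy).sub analyticAt_id
    obtain ⟨K, hK⟩ := exists_norm_fderiv_ray_le hr hC (d := 2 * r) (by omega) han hO x c
    refine tendsto_of_norm_sub_le (K := |K|) ?_
    have hsmall : ∀ᶠ t in 𝓝[≠] (0 : ℝ), |t| < 1 :=
      nhdsWithin_le_nhds (continuous_abs.continuousAt.eventually_lt continuousAt_const (by simp))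
    filter_upwards [hray, nhdsWithin_le_nhds hK, hsmall] with t ht hKt ht1
    have h1 : fderiv ℂ (fun x => s.scheme x - x) (t • x)
        = fderiv ℂ s.scheme (t • x) - ContinuousLinearMap.id ℂ E :=
      ((s.analyticAt_scheme hρ.g ht).differentiableAt.hasFDerivAt.sub (hasFDerivAt_id _)).fderiv
    rw [h1] at hKt
    refine hKt.trans ?_
    gcongr
    · exact le_abs_self K
    · exact pow_le_of_le_one (abs_nonneg t) ht1.le (by omega)
  -- Along the ray the derivatives of scheme and flow differ by t^d times this expression, by
  -- homogeneity of the coefficient; the next defect contributes only O(t).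
  have hnext : ∀ c, Tendsto (fun t : ℝ => fderiv ℂ (s.field N) x c
      + (t ^ d)⁻¹ • fderiv ℂ (s.nextDefect N) (t • x) c) (𝓝[≠] 0)
      (𝓝 (fderiv ℂ (s.field N) x c)) := by
    intro c
    -- The available order 2r(N+2)+1 is at least d + 2; one order is lost on differentiating and d
    -- more on dividing by t^d.
    have hO : s.nextDefect N =O[𝓝 0] fun x => ‖x‖ ^ (d + 1 + 1) := by
      refine (s.isBigO_nextDefect hr hC N).trans ?_
      refine IsBigO.of_bound 1 ?_
      filter_upwards [eventually_norm_lt (E := E) (one_pos)] with y hy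
      rw [one_mul, Real.norm_of_nonneg (by positivity), Real.norm_of_nonneg (by positivity)]
      refine pow_le_pow_of_le_one (norm_nonneg _) (by linarith [norm_nonneg y]) ?_
      rw [hd, mul_add (2 * r) (N + 1) 1]
      omega
    obtain ⟨K, hK⟩ := exists_norm_fderiv_ray_le hr hC (d := d + 1) (by omega)
      (s.eventually_analyticAt_nextDefect hr hC N) hO x c
    refine tendsto_of_norm_sub_le (K := K) ?_
    filter_upwards [nhdsWithin_le_nhds hK, self_mem_nhdsWithin] with t hKt ht0
    have ht0' : 0 < |t| := abs_pos.2 ht0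
    rw [add_sub_cancel_left, norm_smul, norm_inv, norm_pow, Real.norm_eq_abs,
      inv_mul_le_iff₀ (by positivity)]
    refine hKt.trans (le_of_eq ?_)
    ring
  refine bilinear_leading_term s.B (d := d) (by omega) (hscheme a) (hscheme b) (hnext a) (hnext b) ?_
  filter_upwards [hray, self_mem_nhdsWithin] with t ht ht0
  have ht0' : t ^ d ≠ 0 := pow_ne_zero _ ht0
  have hflow : ∀ c, fderiv ℂ s.scheme (t • x) c - t ^ d • (fderiv ℂ (s.field N) x c
      + (t ^ d)⁻¹ • fderiv ℂ (s.nextDefect N) (t • x) c)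
      = fderiv ℂ (flowOne (s.fieldSum N)) (t • x) c := by
    intro c
    have h1 := (s.analyticAt_scheme hρ.g ht).differentiableAt.hasFDerivAt
    have h2 := (analyticAt_flowOne hρ.fieldSum (s.smoothField_fieldSum N)
      ht).differentiableAt.hasFDerivAt
    have h3 := (s.analyticAt_field hr hC N (t • x)).differentiableAt.hasFDerivAt
    have h4 : fderiv ℂ (s.nextDefect N) (t • x) = _ := ((h1.sub h2).sub h3).fderiv
    have h5 : fderiv ℂ (s.field N) (t • x) c = t ^ d • fderiv ℂ (s.field N) x c :=
      fderiv_real_smul (fun y => (s.analyticAt_field hr hC N y).differentiableAt)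
        (fun t y => s.field_real_smul N t y) ht0 x c
    rw [smul_add, smul_smul, mul_inv_cancel₀ ht0', one_smul, h4]
    simp only [_root_.sub_apply]
    rw [h5]
    abel
  rw [hflow, hflow, s.scheme_symplectic hρ.g ht,
    flowOne_symplectic hρ.fieldSum (s.smoothField_fieldSum N) s.B hsum ht]

end MidpointSystem

end MidpointNLS

end

noncomputable section

namespace MidpointNLS

open Finset

/-! ### The discrete norm -/

section Grid

variable {K : ℕ}

lemma zeroExt_coe (u : V K) (j : Grid K) : zeroExt u j = u j := by
  rw [zeroExt, dif_pos j.2]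

lemma zeroExt_of_notMem (u : V K) {j : ℤ} (hj : j ∉ Icc (-(K : ℤ)) K) : zeroExt u j = 0 :=
  dif_neg hj

lemma zeroExt_add (u v : V K) (j : ℤ) : zeroExt (u + v) j = zeroExt u j + zeroExt v j := by
  by_cases hj : j ∈ Icc (-(K : ℤ)) K <;> simp [zeroExt, hj]

lemma zeroExt_smul (c : ℂ) (u : V K) (j : ℤ) : zeroExt (c • u) j = c * zeroExt u j := by
  by_cases hj : j ∈ Icc (-(K : ℤ)) K <;> simp [zeroExt, hj]

lemma zeroExt_mul (u v : V K) (j : ℤ) : zeroExt (u * v) j = zeroExt u j * zeroExt v j := by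
  by_cases hj : j ∈ Icc (-(K : ℤ)) K <;> simp [zeroExt, hj]

lemma zeroExt_star (u : V K) (j : ℤ) : zeroExt (star u) j = star (zeroExt u j) := by
  by_cases hj : j ∈ Icc (-(K : ℤ)) K <;> simp [zeroExt, hj]

lemma sum_grid {M : Type*} [AddCommMonoid M] (f : ℤ → M) :
    ∑ j : Grid K, f j = ∑ j ∈ Icc (-(K : ℤ)) K, f j := by
  exact Finset.sum_coe_sort (Icc (-(K : ℤ)) K) f

/-- The difference operator together with the identity, weighted so that its Euclidean norm is the
discrete norm. -/
def gridEmbed (K : ℕ) (δx : ℝ) :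
    V K →ₗ[ℂ] EuclideanSpace ℂ (↥(Icc (-(K : ℤ) - 1) (K : ℤ)) ⊕ Grid K) where
  toFun u := WithLp.toLp 2 (Sum.elim
    (fun j => (Real.sqrt (2 / δx) : ℂ) * (zeroExt u ((j : ℤ) + 1) - zeroExt u j))
    (fun j => (Real.sqrt δx : ℂ) * u j))
  map_add' u v := by
    ext (j | j)
    · simp only [zeroExt_add, Sum.elim_inl, PiLp.add_apply]; ring
    · simp only [Sum.elim_inr, Pi.add_apply, PiLp.add_apply]; ring
  map_smul' c u := by
    ext (j | j)
    · simp only [zeroExt_smul, Sum.elim_inl, PiLp.smul_apply, smul_eq_mul, RingHom.id_apply]; ring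
    · simp only [Sum.elim_inr, Pi.smul_apply, PiLp.smul_apply, smul_eq_mul, RingHom.id_apply]; ring

variable {δx : ℝ}

lemma norm_gridEmbed (hδ : 0 < δx) (u : V K) : ‖gridEmbed K δx u‖ = dnorm δx u := by
  rw [EuclideanSpace.norm_eq, dnorm, Fintype.sum_sum_type]
  congr 1
  have h1 : ∀ a : ℂ, ‖(Real.sqrt (2 / δx) : ℂ) * a‖ ^ 2 = 2 * δx * (‖a‖ ^ 2 / δx ^ 2) := fun a => by
    rw [norm_mul, mul_pow, Complex.norm_real, Real.norm_of_nonneg (Real.sqrt_nonneg _),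
      Real.sq_sqrt (by positivity)]
    field_simp
  have h2 : ∀ a : ℂ, ‖(Real.sqrt δx : ℂ) * a‖ ^ 2 = δx * ‖a‖ ^ 2 := fun a => by
    rw [norm_mul, mul_pow, Complex.norm_real, Real.norm_of_nonneg (Real.sqrt_nonneg _),
      Real.sq_sqrt hδ.le]
  congr 1
  · rw [mul_sum, ← Finset.sum_coe_sort (Icc (-(K : ℤ) - 1) (K : ℤ))
      fun i => 2 * δx * (‖zeroExt u (i + 1) - zeroExt u i‖ ^ 2 / δx ^ 2)]
    exact Finset.sum_congr rfl fun j _ => h1 _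
  · rw [mul_sum]
    exact Finset.sum_congr rfl fun j _ => h2 _

lemma dnorm_sq (hδ : 0 < δx) (u : V K) : dnorm δx u ^ 2 =
    2 * δx * ∑ j ∈ Icc (-(K : ℤ) - 1) (K : ℤ), ‖zeroExt u (j + 1) - zeroExt u j‖ ^ 2 / δx ^ 2
      + δx * ∑ j : Grid K, ‖u j‖ ^ 2 := by
  rw [dnorm, Real.sq_sqrt]
  positivity

lemma dnorm_nonneg (u : V K) : 0 ≤ dnorm δx u := Real.sqrt_nonneg _

lemma sum_norm_sq_le (hδ : 0 < δx) (u : V K) : δx * ∑ j : Grid K, ‖u j‖ ^ 2 ≤ dnorm δx u ^ 2 := by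
  rw [dnorm_sq hδ]
  have : 0 ≤ 2 * δx * ∑ j ∈ Icc (-(K : ℤ) - 1) (K : ℤ),
    ‖zeroExt u (j + 1) - zeroExt u j‖ ^ 2 / δx ^ 2 := by positivity
  linarith

lemma gridEmbed_injective (hδ : 0 < δx) : Function.Injective (gridEmbed K δx) := by
  rw [← LinearMap.ker_eq_bot, LinearMap.ker_eq_bot']
  intro u hu
  funext j
  have h : gridEmbed K δx u (Sum.inr j) = 0 := by rw [hu]; rfl
  have h1 : (Real.sqrt δx : ℂ) * u j = 0 := h
  have h2 : (Real.sqrt δx : ℂ) ≠ 0 := Complex.ofReal_ne_zero.2 (Real.sqrt_pos.2 hδ).ne'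
  exact (mul_eq_zero.1 h1).resolve_left h2

lemma dnorm_star (u : V K) : dnorm δx (star u) = dnorm δx u := by
  simp only [dnorm, zeroExt_star, ← star_sub, norm_star, Pi.star_apply]

lemma sum_Icc_succ (f : ℤ → ℝ) (hf : f (-(K : ℤ) - 1) = 0) (hf' : f ((K : ℤ) + 1) = 0) :
    ∑ j ∈ Icc (-(K : ℤ) - 1) K, f j = ∑ j ∈ Icc (-(K : ℤ)) K, f j ∧
    ∑ j ∈ Icc (-(K : ℤ) - 1) K, f (j + 1) = ∑ j ∈ Icc (-(K : ℤ)) K, f j := by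
  have hK : (0 : ℤ) ≤ K := Int.natCast_nonneg K
  constructor
  · symm
    refine Finset.sum_subset (fun j hj => ?_) fun j hj hj' => ?_
    · rw [mem_Icc] at hj ⊢; omega
    · rw [mem_Icc] at hj hj'
      rw [show j = -(K : ℤ) - 1 by omega, hf]
  · have h1 : ∑ j ∈ Icc (-(K : ℤ) - 1) K, f (j + 1) = ∑ j ∈ Icc (-(K : ℤ)) ((K : ℤ) + 1), f j := by
      refine Finset.sum_nbij' (fun j => j + 1) (fun j => j - 1) ?_ ?_ ?_ ?_ ?_
      · intro j hj; rw [mem_Icc] at hj ⊢; omega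
      · intro j hj; rw [mem_Icc] at hj ⊢; omega
      · intro j _; ring
      · intro j _; ring
      · intro j _; rfl
    rw [h1]
    symm
    refine Finset.sum_subset (fun j hj => ?_) fun j hj hj' => ?_
    · rw [mem_Icc] at hj ⊢; omega
    · rw [mem_Icc] at hj hj'
      rw [show j = (K : ℤ) + 1 by omega, hf']

/-- The discrete Sobolev inequality. -/
lemma norm_apply_le_dnorm (hδ : 0 < δx) (u : V K) (j : Grid K) : ‖u j‖ ≤ dnorm δx u := by
  set a : ℤ → ℂ := zeroExt u with ha
  -- t_k bounds |a_(k+1)|² - |a_k|² by the arithmetic-geometric mean inequality with weight δx.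
  -- Summing from the left end, where the extension vanishes, bounds |u_j|².
  set t : ℤ → ℝ := fun k => ‖a (k + 1) - a k‖ ^ 2 / δx + δx * (‖a (k + 1)‖ ^ 2 + ‖a k‖ ^ 2) / 2
    with ht
  have ht0 : ∀ k, 0 ≤ t k := fun k => by positivity
  have hstep : ∀ k, ‖a (k + 1)‖ ^ 2 ≤ ‖a k‖ ^ 2 + t k := by
    intro k
    have h1 : ‖a (k + 1)‖ ≤ ‖a k‖ + ‖a (k + 1) - a k‖ := by
      have := norm_add_le (a k) (a (k + 1) - a k)
      rwa [add_sub_cancel] at this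
    set p := ‖a (k + 1)‖
    set q := ‖a k‖
    set d := ‖a (k + 1) - a k‖
    have hp : 0 ≤ p := norm_nonneg _
    have hq : 0 ≤ q := norm_nonneg _
    have hd : 0 ≤ d := norm_nonneg _
    have h2 : p ^ 2 - q ^ 2 ≤ d * (p + q) := by nlinarith
    have h3 : d * (p + q) ≤ d ^ 2 / δx + δx * (p + q) ^ 2 / 4 := by
      have h5 : d ^ 2 / δx + δx * (p + q) ^ 2 / 4 - d * (p + q)
          = (d - δx * (p + q) / 2) ^ 2 / δx := by field_simp; ring
      have h6 : 0 ≤ (d - δx * (p + q) / 2) ^ 2 / δx := by positivity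
      linarith
    have h4 : δx * (p + q) ^ 2 / 4 ≤ δx * (p ^ 2 + q ^ 2) / 2 := by
      nlinarith [mul_nonneg hδ.le (sq_nonneg (p - q))]
    simp only [ht]
    linarith
  have hind : ∀ m : ℤ, -(K : ℤ) - 1 ≤ m → ‖a m‖ ^ 2 ≤ ∑ k ∈ Ico (-(K : ℤ) - 1) m, t k := by
    intro m hm
    induction m, hm using Int.leInduction with
    | base =>
      have : a (-(K : ℤ) - 1) = 0 := zeroExt_of_notMem u (by rw [mem_Icc]; omega)
      simp [this]
    | succ m hm ih =>
      have h1 : Ico (-(K : ℤ) - 1) (m + 1) = insert m (Ico (-(K : ℤ) - 1) m) := by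
        ext i; simp only [mem_Ico, mem_insert]; omega
      rw [h1, Finset.sum_insert (by simp)]
      linarith [hstep m]
  have hj := mem_Icc.1 j.2
  have h1 := hind j (by omega)
  have h2 : ∑ k ∈ Ico (-(K : ℤ) - 1) (j : ℤ), t k ≤ ∑ k ∈ Icc (-(K : ℤ) - 1) (K : ℤ), t k :=
    Finset.sum_le_sum_of_subset_of_nonneg (fun k hk => by rw [mem_Ico] at hk; rw [mem_Icc]; omega)
      fun k _ _ => ht0 k
  obtain ⟨h3, h4⟩ := sum_Icc_succ (K := K) (fun k => ‖a k‖ ^ 2)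
    (by rw [ha, zeroExt_of_notMem u (by rw [mem_Icc]; omega)]; simp)
    (by rw [ha, zeroExt_of_notMem u (by rw [mem_Icc]; omega)]; simp)
  -- The total is the squared norm with only half of its difference part.
  have h5 : ∑ k ∈ Icc (-(K : ℤ) - 1) (K : ℤ), t k
      = (∑ k ∈ Icc (-(K : ℤ) - 1) (K : ℤ), ‖a (k + 1) - a k‖ ^ 2) / δx
        + δx * ∑ k ∈ Icc (-(K : ℤ)) (K : ℤ), ‖a k‖ ^ 2 := by
    simp only [ht, Finset.sum_add_distrib, ← Finset.sum_div, ← Finset.mul_sum]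
    rw [h3, h4]
    ring
  have h6 : ∑ k ∈ Icc (-(K : ℤ)) (K : ℤ), ‖a k‖ ^ 2 = ∑ j : Grid K, ‖u j‖ ^ 2 := by
    rw [← sum_grid fun k => ‖a k‖ ^ 2]
    exact Finset.sum_congr rfl fun i _ => by rw [ha, zeroExt_coe]
  have h7 : ‖u j‖ ^ 2 ≤ dnorm δx u ^ 2 := by
    rw [dnorm_sq hδ, ← h6]
    rw [ha, zeroExt_coe] at h1
    refine h1.trans (h2.trans ?_)
    rw [h5, ← Finset.sum_div]
    have h8 : (0 : ℝ) ≤ ∑ k ∈ Icc (-(K : ℤ) - 1) (K : ℤ), ‖a (k + 1) - a k‖ ^ 2 := by positivity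
    have h9 : 2 * δx * ((∑ k ∈ Icc (-(K : ℤ) - 1) (K : ℤ), ‖a (k + 1) - a k‖ ^ 2) / δx ^ 2)
        = 2 * ((∑ k ∈ Icc (-(K : ℤ) - 1) (K : ℤ), ‖a (k + 1) - a k‖ ^ 2) / δx) := by
      field_simp
    have h10 : 0 ≤ (∑ k ∈ Icc (-(K : ℤ) - 1) (K : ℤ), ‖a (k + 1) - a k‖ ^ 2) / δx := by positivity
    linarith
  exact le_of_sq_le_sq h7 (dnorm_nonneg u)

lemma norm_zeroExt_le_dnorm (hδ : 0 < δx) (u : V K) (j : ℤ) : ‖zeroExt u j‖ ≤ dnorm δx u := by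
  by_cases hj : j ∈ Icc (-(K : ℤ)) K
  · rw [show zeroExt u j = u ⟨j, hj⟩ from zeroExt_coe u ⟨j, hj⟩]
    exact norm_apply_le_dnorm hδ u _
  · rw [zeroExt_of_notMem u hj, norm_zero]
    exact dnorm_nonneg u

/-- The discrete norm is submultiplicative up to a factor. -/
lemma dnorm_mul_le (hδ : 0 < δx) (u v : V K) :
    dnorm δx (u * v) ≤ 2 * dnorm δx u * dnorm δx v := by
  refine le_of_sq_le_sq ?_ (by have := dnorm_nonneg (δx := δx) u;
                               have := dnorm_nonneg (δx := δx) v; positivity)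
  set U := dnorm δx u with hU
  set W := dnorm δx v with hW
  have hU0 : 0 ≤ U := dnorm_nonneg u
  have hW0 : 0 ≤ W := dnorm_nonneg v
  have h1 : ∀ j, ‖zeroExt (u * v) (j + 1) - zeroExt (u * v) j‖ ^ 2 / δx ^ 2
      ≤ 2 * U ^ 2 * (‖zeroExt v (j + 1) - zeroExt v j‖ ^ 2 / δx ^ 2)
        + 2 * W ^ 2 * (‖zeroExt u (j + 1) - zeroExt u j‖ ^ 2 / δx ^ 2) := by
    intro j
    -- Discrete Leibniz rule; the undifferenced factors are bounded by the Sobolev inequality.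
    have h2 : zeroExt (u * v) (j + 1) - zeroExt (u * v) j
        = zeroExt u (j + 1) * (zeroExt v (j + 1) - zeroExt v j)
          + (zeroExt u (j + 1) - zeroExt u j) * zeroExt v j := by
      rw [zeroExt_mul, zeroExt_mul]; ring
    have h3 : ‖zeroExt (u * v) (j + 1) - zeroExt (u * v) j‖
        ≤ U * ‖zeroExt v (j + 1) - zeroExt v j‖ + ‖zeroExt u (j + 1) - zeroExt u j‖ * W := by
      rw [h2]
      refine (norm_add_le _ _).trans ?_
      rw [norm_mul, norm_mul]
      gcongr
      · exact norm_zeroExt_le_dnorm hδ u _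
      · exact norm_zeroExt_le_dnorm hδ v _
    have h4 : ‖zeroExt (u * v) (j + 1) - zeroExt (u * v) j‖ ^ 2
        ≤ 2 * U ^ 2 * ‖zeroExt v (j + 1) - zeroExt v j‖ ^ 2
          + 2 * W ^ 2 * ‖zeroExt u (j + 1) - zeroExt u j‖ ^ 2 := by
      refine (pow_le_pow_left₀ (norm_nonneg _) h3 2).trans ?_
      nlinarith [sq_nonneg (U * ‖zeroExt v (j + 1) - zeroExt v j‖
        - ‖zeroExt u (j + 1) - zeroExt u j‖ * W)]
    calc _ ≤ (2 * U ^ 2 * ‖zeroExt v (j + 1) - zeroExt v j‖ ^ 2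
          + 2 * W ^ 2 * ‖zeroExt u (j + 1) - zeroExt u j‖ ^ 2) / δx ^ 2 := by gcongr
      _ = _ := by ring
  have h2 : ∀ j : Grid K, ‖(u * v) j‖ ^ 2 ≤ U ^ 2 * ‖v j‖ ^ 2 := by
    intro j
    rw [Pi.mul_apply, norm_mul, mul_pow]
    gcongr
    exact norm_apply_le_dnorm hδ u j
  have h3 := Finset.sum_le_sum (s := Icc (-(K : ℤ) - 1) (K : ℤ)) fun j _ => h1 j
  have h4 := Finset.sum_le_sum (s := (univ : Finset (Grid K))) fun j _ => h2 j
  rw [Finset.sum_add_distrib, ← Finset.mul_sum, ← Finset.mul_sum] at h3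
  rw [← Finset.mul_sum] at h4
  have hu := dnorm_sq hδ u
  have hv := dnorm_sq hδ v
  have huv := dnorm_sq hδ (u * v)
  rw [← hU] at hu
  rw [← hW] at hv
  set su := ∑ j ∈ Icc (-(K : ℤ) - 1) (K : ℤ), ‖zeroExt u (j + 1) - zeroExt u j‖ ^ 2 / δx ^ 2
  set sv := ∑ j ∈ Icc (-(K : ℤ) - 1) (K : ℤ), ‖zeroExt v (j + 1) - zeroExt v j‖ ^ 2 / δx ^ 2
  set lu := ∑ j : Grid K, ‖u j‖ ^ 2
  set lv := ∑ j : Grid K, ‖v j‖ ^ 2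
  have hlu : 0 ≤ δx * lu := by positivity
  have hlv : 0 ≤ δx * lv := by positivity
  have h5 := mul_le_mul_of_nonneg_left h3 (show 0 ≤ 2 * δx by positivity)
  have h6 := mul_le_mul_of_nonneg_left h4 hδ.le
  have h7 : 0 ≤ W ^ 2 * (δx * lu) := by positivity
  have h8 : 0 ≤ U ^ 2 * (δx * lv) := by positivity
  rw [huv]
  calc _ ≤ 2 * δx * (2 * U ^ 2 * sv + 2 * W ^ 2 * su) + δx * (U ^ 2 * lv) := add_le_add h5 h6
    _ ≤ 2 * U ^ 2 * (2 * δx * sv + δx * lv) + 2 * W ^ 2 * (2 * δx * su + δx * lu) := by linarith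
    _ = (2 * U * W) ^ 2 := by rw [← hu, ← hv]; ring

lemma dnorm_mul_pow_le (hδ : 0 < δx) (u v : V K) (m : ℕ) :
    dnorm δx (u * v ^ m) ≤ 2 ^ m * dnorm δx u * dnorm δx v ^ m := by
  induction m with
  | zero => simp
  | succ m ih =>
    have h1 := dnorm_mul_le hδ (u * v ^ m) v
    have h2 := dnorm_nonneg (δx := δx) v
    rw [pow_succ, ← mul_assoc]
    calc _ ≤ 2 * dnorm δx (u * v ^ m) * dnorm δx v := h1
      _ ≤ 2 * (2 ^ m * dnorm δx u * dnorm δx v ^ m) * dnorm δx v := by gcongr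
      _ = _ := by ring

/-- The Cauchy–Schwarz inequality for the discrete `L²` pairing. -/
lemma abs_pairing_le (hδ : 0 < δx) (u v : V K) :
    |δx * (∑ j : Grid K, u j * star (v j)).im| ≤ dnorm δx u * dnorm δx v := by
  have h1 : |(∑ j : Grid K, u j * star (v j)).im| ≤ ∑ j : Grid K, ‖u j‖ * ‖v j‖ := by
    refine (Complex.abs_im_le_norm _).trans ((norm_sum_le _ _).trans ?_)
    exact Finset.sum_le_sum fun j _ => by rw [norm_mul, norm_star]
  have h2 := Finset.sum_mul_sq_le_sq_mul_sq (univ : Finset (Grid K)) (fun j => ‖u j‖)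
    (fun j => ‖v j‖)
  rw [abs_mul, abs_of_pos hδ]
  have h0 : (0 : ℝ) ≤ ∑ j : Grid K, ‖u j‖ * ‖v j‖ := by positivity
  refine le_trans (mul_le_mul_of_nonneg_left h1 hδ.le) (le_of_sq_le_sq ?_
    (mul_nonneg (dnorm_nonneg u) (dnorm_nonneg v)))
  rw [mul_pow, mul_pow]
  have hu := sum_norm_sq_le hδ u
  have hv := sum_norm_sq_le hδ v
  calc δx ^ 2 * (∑ j : Grid K, ‖u j‖ * ‖v j‖) ^ 2
      ≤ δx ^ 2 * ((∑ j : Grid K, ‖u j‖ ^ 2) * ∑ j : Grid K, ‖v j‖ ^ 2) := by gcongr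
    _ = (δx * ∑ j : Grid K, ‖u j‖ ^ 2) * (δx * ∑ j : Grid K, ‖v j‖ ^ 2) := by ring
    _ ≤ _ := by gcongr

end Grid

end MidpointNLS

end

noncomputable section

namespace MidpointNLS

open Finset
open scoped ComplexConjugate

/-! ### The discrete Laplacian and its resolvents -/

section Resolvent

variable {K : ℕ} {δx : ℝ}

lemma lapA_conjTranspose (K : ℕ) (δx : ℝ) : (lapA K δx)ᴴ = lapA K δx := by
  ext i j
  rw [Matrix.conjTranspose_apply, lapA, lapA]
  have h1 : ((j : ℤ) = i) = ((i : ℤ) = j) := propext eq_comm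
  have h2 : ((j : ℤ) = i + 1 ∨ (i : ℤ) = j + 1) = ((i : ℤ) = j + 1 ∨ (j : ℤ) = i + 1) :=
    propext or_comm
  simp only [h1, h2]
  split_ifs <;> simp

lemma lapA_transpose (K : ℕ) (δx : ℝ) : (lapA K δx)ᵀ = lapA K δx := by
  ext i j
  rw [Matrix.transpose_apply, lapA, lapA]
  have h1 : ((j : ℤ) = i) = ((i : ℤ) = j) := propext eq_comm
  have h2 : ((j : ℤ) = i + 1 ∨ (i : ℤ) = j + 1) = ((i : ℤ) = j + 1 ∨ (j : ℤ) = i + 1) :=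
    propext or_comm
  simp only [h1, h2]

lemma lapA_mulVec (u : V K) (i : Grid K) : (lapA K δx *ᵥ u) i =
    ((δx ^ 2 : ℝ) : ℂ)⁻¹ * (2 * zeroExt u i - zeroExt u (i + 1) - zeroExt u (i - 1)) := by
  have hpick : ∀ m : ℤ, ∑ j ∈ Icc (-(K : ℤ)) K, (if j = m then zeroExt u j else 0)
      = zeroExt u m := by
    intro m
    rw [Finset.sum_ite_eq']
    split_ifs with hm
    · rfl
    · exact (zeroExt_of_notMem u hm).symm
  rw [Matrix.mulVec, dotProduct]
  have h1 : ∀ j : Grid K, lapA K δx i j * u j = ((δx ^ 2 : ℝ) : ℂ)⁻¹ *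
      (2 * (if (j : ℤ) = i then zeroExt u j else 0) - (if (j : ℤ) = i + 1 then zeroExt u j else 0)
        - (if (j : ℤ) = i - 1 then zeroExt u j else 0)) := by
    intro j
    rw [lapA, zeroExt_coe, mul_assoc]
    congr 1
    split_ifs <;> first | omega | ring
  rw [Finset.sum_congr rfl fun j _ => h1 j, sum_grid fun j => ((δx ^ 2 : ℝ) : ℂ)⁻¹ *
      (2 * (if j = i then zeroExt u j else 0) - (if j = i + 1 then zeroExt u j else 0)
        - (if j = i - 1 then zeroExt u j else 0)), ← Finset.mul_sum, Finset.sum_sub_distrib,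
      Finset.sum_sub_distrib, ← Finset.mul_sum, hpick, hpick, hpick]

/-- Summation by parts. -/
lemma sum_conj_diff_mul_diff (hδ : 0 < δx) (u v : V K) :
    ∑ j ∈ Icc (-(K : ℤ) - 1) (K : ℤ),
      conj (zeroExt u (j + 1) - zeroExt u j) * (zeroExt v (j + 1) - zeroExt v j)
      = (δx ^ 2 : ℝ) * ∑ j : Grid K, conj (u j) * (lapA K δx *ᵥ v) j := by
  have hK : (0 : ℤ) ≤ K := Int.natCast_nonneg K
  set a := zeroExt u with ha
  set b := zeroExt v with hb
  have ha0 : ∀ j, j ∉ Icc (-(K : ℤ)) K → a j = 0 := fun j hj => zeroExt_of_notMem u hj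
  have h1 : ∑ j ∈ Icc (-(K : ℤ) - 1) (K : ℤ), conj (a (j + 1)) * (b (j + 1) - b j)
      = ∑ j ∈ Icc (-(K : ℤ)) K, conj (a j) * (b j - b (j - 1)) := by
    have h2 : ∑ j ∈ Icc (-(K : ℤ) - 1) (K : ℤ), conj (a (j + 1)) * (b (j + 1) - b j)
        = ∑ j ∈ Icc (-(K : ℤ)) ((K : ℤ) + 1), conj (a j) * (b j - b (j - 1)) := by
      refine Finset.sum_nbij' (fun j => j + 1) (fun j => j - 1) ?_ ?_ ?_ ?_ ?_
      · intro j hj; rw [mem_Icc] at hj ⊢; omega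
      · intro j hj; rw [mem_Icc] at hj ⊢; omega
      · intro j _; ring
      · intro j _; ring
      · intro j _; rw [add_sub_cancel_right]
    rw [h2]
    symm
    refine Finset.sum_subset (fun j hj => ?_) fun j _ hj' => ?_
    · rw [mem_Icc] at hj ⊢; omega
    · rw [ha0 j hj']; simp
  have h3 : ∑ j ∈ Icc (-(K : ℤ) - 1) (K : ℤ), conj (a j) * (b (j + 1) - b j)
      = ∑ j ∈ Icc (-(K : ℤ)) K, conj (a j) * (b (j + 1) - b j) := by
    symm
    refine Finset.sum_subset (fun j hj => ?_) fun j _ hj' => ?_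
    · rw [mem_Icc] at hj ⊢; omega
    · rw [ha0 j hj']; simp
  have hδ2 : ((δx ^ 2 : ℝ) : ℂ) ≠ 0 := Complex.ofReal_ne_zero.2 (by positivity)
  simp only [map_sub, sub_mul, Finset.sum_sub_distrib]
  rw [h1, h3, ← Finset.sum_sub_distrib, Finset.mul_sum,
    ← sum_grid fun j => conj (a j) * (b j - b (j - 1)) - conj (a j) * (b (j + 1) - b j)]
  refine Finset.sum_congr rfl fun j _ => ?_
  rw [lapA_mulVec, ← zeroExt_coe u j, ← ha, ← hb]
  field_simp
  ring

/-- Summation by parts turns the difference part into a pairing with A. The inner product thus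
involves only A and the ℓ² pairing, so A is self-adjoint for it. -/
lemma inner_gridEmbed (hδ : 0 < δx) (u v : V K) :
    inner ℂ (gridEmbed K δx u) (gridEmbed K δx v)
      = 2 * δx * ∑ j : Grid K, conj (u j) * (lapA K δx *ᵥ v) j
        + δx * ∑ j : Grid K, conj (u j) * v j := by
  rw [PiLp.inner_apply, Fintype.sum_sum_type]
  have hδc : (δx : ℂ) ≠ 0 := Complex.ofReal_ne_zero.2 hδ.ne'
  have hsq : ∀ x : ℝ, 0 ≤ x → (Real.sqrt x : ℂ) * (Real.sqrt x : ℂ) = x := fun x hx => by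
    rw [← Complex.ofReal_mul, Real.mul_self_sqrt hx]
  congr 1
  · have h1 := sum_conj_diff_mul_diff hδ u v
    have h2 : 2 * (δx : ℂ) * ∑ j : Grid K, conj (u j) * (lapA K δx *ᵥ v) j
        = (2 / δx : ℝ) * ((δx ^ 2 : ℝ) * ∑ j : Grid K, conj (u j) * (lapA K δx *ᵥ v) j) := by
      push_cast; field_simp
    rw [h2, ← h1, Finset.mul_sum, ← Finset.sum_coe_sort (Icc (-(K : ℤ) - 1) (K : ℤ)) fun j =>
      ((2 / δx : ℝ) : ℂ) * (conj (zeroExt u (j + 1) - zeroExt u j) *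
        (zeroExt v (j + 1) - zeroExt v j))]
    refine Finset.sum_congr rfl fun j _ => ?_
    rw [RCLike.inner_apply]
    change (Real.sqrt (2 / δx) : ℂ) * (zeroExt v ((j : ℤ) + 1) - zeroExt v j) *
      conj ((Real.sqrt (2 / δx) : ℂ) * (zeroExt u ((j : ℤ) + 1) - zeroExt u j)) = _
    rw [map_mul, Complex.conj_ofReal, ← hsq (2 / δx) (by positivity)]
    ring
  · rw [Finset.mul_sum]
    refine Finset.sum_congr rfl fun j _ => ?_
    rw [RCLike.inner_apply]
    change (Real.sqrt δx : ℂ) * v j * conj ((Real.sqrt δx : ℂ) * u j) = _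
    rw [map_mul, Complex.conj_ofReal]
    have := hsq δx hδ.le
    linear_combination (v j * conj (u j)) * this

lemma sum_conj_mul_lapA (u v : V K) :
    ∑ j : Grid K, conj (u j) * (lapA K δx *ᵥ v) j
      = ∑ j : Grid K, conj ((lapA K δx *ᵥ u) j) * v j := by
  have h1 : star u ⬝ᵥ (lapA K δx *ᵥ v) = star (lapA K δx *ᵥ u) ⬝ᵥ v := by
    rw [Matrix.dotProduct_mulVec, Matrix.star_mulVec, lapA_conjTranspose]
  exact h1

/-- The cross term is the real part of i times a real number. All resolvent bounds follow, uniformly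
in the parameters. -/
lemma dnorm_add_lapA_sq (hδ : 0 < δx) (κ : ℝ) (w : V K) :
    dnorm δx (w + (Complex.I * κ) • (lapA K δx *ᵥ w)) ^ 2
      = dnorm δx w ^ 2 + κ ^ 2 * dnorm δx (lapA K δx *ᵥ w) ^ 2 := by
  set L := gridEmbed K δx with hL
  have hreal : inner ℂ (L w) (L (lapA K δx *ᵥ w)) = inner ℂ (L (lapA K δx *ᵥ w)) (L w) := by
    rw [hL, inner_gridEmbed hδ, inner_gridEmbed hδ, sum_conj_mul_lapA,
      sum_conj_mul_lapA w w]
  have him : (inner ℂ (L w) (L (lapA K δx *ᵥ w))).im = 0 := by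
    have h1 := inner_conj_symm (𝕜 := ℂ) (L w) (L (lapA K δx *ᵥ w))
    rw [hreal] at h1
    rw [hreal]
    exact Complex.conj_eq_iff_im.1 h1
  rw [← norm_gridEmbed hδ, ← norm_gridEmbed hδ, ← norm_gridEmbed hδ, ← hL, map_add, map_smul,
    norm_add_sq (𝕜 := ℂ), inner_smul_right, norm_smul, mul_pow]
  have h2 : RCLike.re (Complex.I * (κ : ℂ) * inner ℂ (L w) (L (lapA K δx *ᵥ w))) = 0 := by
    rw [RCLike.re_eq_complex_re, mul_assoc, Complex.I_mul_re, Complex.im_ofReal_mul, him]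
    simp
  have h3 : ‖Complex.I * (κ : ℂ)‖ ^ 2 = κ ^ 2 := by
    rw [norm_mul, Complex.norm_I, one_mul, Complex.norm_real, Real.norm_eq_abs, sq_abs]
  rw [h2, h3]
  ring

lemma opPlus_mulVec (h : ℝ) (w : V K) :
    opPlus K δx h *ᵥ w = w + (Complex.I * (h / 2 : ℝ)) • (lapA K δx *ᵥ w) := by
  rw [opPlus, Matrix.add_mulVec, Matrix.one_mulVec, Matrix.smul_mulVec]
  push_cast
  rw [mul_div_assoc]

lemma opMinus_eq (h : ℝ) : opMinus K δx h = opPlus K δx (-h) := by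
  rw [opMinus, opPlus, sub_eq_add_neg, ← neg_smul]
  push_cast
  congr 2
  ring

lemma dnorm_opPlus_sq (hδ : 0 < δx) (h : ℝ) (w : V K) : dnorm δx (opPlus K δx h *ᵥ w) ^ 2
    = dnorm δx w ^ 2 + (h / 2) ^ 2 * dnorm δx (lapA K δx *ᵥ w) ^ 2 := by
  rw [opPlus_mulVec, dnorm_add_lapA_sq hδ]

lemma dnorm_opPlus_eq (hδ : 0 < δx) (h : ℝ) (w : V K) :
    dnorm δx (opPlus K δx h *ᵥ w) = dnorm δx (opMinus K δx h *ᵥ w) := by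
  have h1 := dnorm_opPlus_sq hδ h w
  have h2 := dnorm_opPlus_sq hδ (-h) w
  rw [← opMinus_eq] at h2
  refine (sq_eq_sq₀ (dnorm_nonneg _) (dnorm_nonneg _)).1 ?_
  rw [h1, h2]; ring

lemma dnorm_le_opPlus (hδ : 0 < δx) (h : ℝ) (w : V K) :
    dnorm δx w ≤ dnorm δx (opPlus K δx h *ᵥ w) := by
  refine le_of_sq_le_sq ?_ (dnorm_nonneg _)
  rw [dnorm_opPlus_sq hδ]
  have : 0 ≤ (h / 2) ^ 2 * dnorm δx (lapA K δx *ᵥ w) ^ 2 := by positivity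
  linarith

lemma eq_zero_of_dnorm_eq_zero (hδ : 0 < δx) {u : V K} (hu : dnorm δx u = 0) : u = 0 := by
  rw [← norm_gridEmbed hδ, norm_eq_zero] at hu
  exact gridEmbed_injective hδ (by rw [hu, map_zero])

lemma dnorm_zero (hδ : 0 < δx) : dnorm δx (0 : V K) = 0 := by
  rw [← norm_gridEmbed hδ, map_zero, norm_zero]

lemma isUnit_opPlus (hδ : 0 < δx) (h : ℝ) : IsUnit (opPlus K δx h) := by
  rw [← Matrix.mulVec_injective_iff_isUnit]
  have hinj : Function.Injective (Matrix.mulVecLin (opPlus K δx h)) := by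
    rw [← LinearMap.ker_eq_bot, LinearMap.ker_eq_bot']
    intro w hw
    refine eq_zero_of_dnorm_eq_zero hδ (le_antisymm ?_ (dnorm_nonneg w))
    have := dnorm_le_opPlus hδ h w
    rw [show opPlus K δx h *ᵥ w = 0 from hw, dnorm_zero hδ] at this
    exact this
  exact hinj

lemma opPlus_mul_inv (hδ : 0 < δx) (h : ℝ) : opPlus K δx h * (opPlus K δx h)⁻¹ = 1 :=
  Matrix.mul_nonsing_inv _ ((Matrix.isUnit_iff_isUnit_det _).1 (isUnit_opPlus hδ h))

lemma opMinus_mul_inv (hδ : 0 < δx) (h : ℝ) : opMinus K δx h * (opMinus K δx h)⁻¹ = 1 := by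
  rw [opMinus_eq]; exact opPlus_mul_inv hδ _

lemma opPlus_inv_mul (hδ : 0 < δx) (h : ℝ) : (opPlus K δx h)⁻¹ * opPlus K δx h = 1 :=
  Matrix.nonsing_inv_mul _ ((Matrix.isUnit_iff_isUnit_det _).1 (isUnit_opPlus hδ h))

lemma opMinus_inv_mul (hδ : 0 < δx) (h : ℝ) : (opMinus K δx h)⁻¹ * opMinus K δx h = 1 := by
  rw [opMinus_eq]; exact opPlus_inv_mul hδ _

lemma opPlus_inv_mulVec (hδ : 0 < δx) (h : ℝ) (u : V K) :
    opPlus K δx h *ᵥ ((opPlus K δx h)⁻¹ *ᵥ u) = u := by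
  rw [Matrix.mulVec_mulVec, opPlus_mul_inv hδ, Matrix.one_mulVec]

lemma opMinus_inv_mulVec (hδ : 0 < δx) (h : ℝ) (u : V K) :
    opMinus K δx h *ᵥ ((opMinus K δx h)⁻¹ *ᵥ u) = u := by
  rw [Matrix.mulVec_mulVec, opMinus_mul_inv hδ, Matrix.one_mulVec]

lemma dnorm_opPlus_inv_le (hδ : 0 < δx) (h : ℝ) (u : V K) :
    dnorm δx ((opPlus K δx h)⁻¹ *ᵥ u) ≤ dnorm δx u := by
  have := dnorm_le_opPlus hδ h ((opPlus K δx h)⁻¹ *ᵥ u)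
  rwa [opPlus_inv_mulVec hδ] at this

lemma dnorm_opMinus_inv_le (hδ : 0 < δx) (h : ℝ) (u : V K) :
    dnorm δx ((opMinus K δx h)⁻¹ *ᵥ u) ≤ dnorm δx u := by
  rw [opMinus_eq]; exact dnorm_opPlus_inv_le hδ _ u

/-- 1 + ihA/2 and 1 - ihA/2 lengthen every vector equally. -/
lemma dnorm_stab (hδ : 0 < δx) (h : ℝ) (u : V K) : dnorm δx (stab K δx h *ᵥ u) = dnorm δx u := by
  rw [stab, ← Matrix.mulVec_mulVec, dnorm_opPlus_eq hδ, opMinus_inv_mulVec hδ]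

lemma opPlus_add_opMinus (h : ℝ) : opPlus K δx h + opMinus K δx h = (2 : ℂ) • 1 := by
  rw [opPlus, opMinus, two_smul]; abel

lemma opPlus_transpose (h : ℝ) : (opPlus K δx h)ᵀ = opPlus K δx h := by
  rw [opPlus, Matrix.transpose_add, Matrix.transpose_one, Matrix.transpose_smul, lapA_transpose]

lemma opMinus_transpose (h : ℝ) : (opMinus K δx h)ᵀ = opMinus K δx h := by
  rw [opMinus_eq, opPlus_transpose]

lemma opPlus_inv_transpose (h : ℝ) : ((opPlus K δx h)⁻¹)ᵀ = (opPlus K δx h)⁻¹ := by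
  rw [Matrix.transpose_nonsing_inv, opPlus_transpose]

lemma opMinus_inv_transpose (h : ℝ) : ((opMinus K δx h)⁻¹)ᵀ = (opMinus K δx h)⁻¹ := by
  rw [Matrix.transpose_nonsing_inv, opMinus_transpose]

lemma opPlus_conjTranspose (h : ℝ) : (opPlus K δx h)ᴴ = opMinus K δx h := by
  rw [opPlus, opMinus, Matrix.conjTranspose_add, Matrix.conjTranspose_one,
    Matrix.conjTranspose_smul, lapA_conjTranspose, sub_eq_add_neg, ← neg_smul]
  congr 2
  simp [neg_div]

lemma opMinus_conjTranspose (h : ℝ) : (opMinus K δx h)ᴴ = opPlus K δx h := by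
  rw [opMinus_eq, opPlus_conjTranspose, opMinus_eq, neg_neg]

/-- Conjugation exchanges the two resolvents, which is why the second component of a pair always
carries the opposite one. -/
lemma star_opPlus_inv (h : ℝ) (u : V K) :
    star ((opPlus K δx h)⁻¹ *ᵥ u) = (opMinus K δx h)⁻¹ *ᵥ star u := by
  rw [Matrix.star_mulVec, Matrix.conjTranspose_nonsing_inv, opPlus_conjTranspose,
    ← Matrix.mulVec_transpose, opMinus_inv_transpose]

lemma star_opMinus_inv (h : ℝ) (u : V K) :
    star ((opMinus K δx h)⁻¹ *ᵥ u) = (opPlus K δx h)⁻¹ *ᵥ star u := by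
  rw [Matrix.star_mulVec, Matrix.conjTranspose_nonsing_inv, opMinus_conjTranspose,
    ← Matrix.mulVec_transpose, opPlus_inv_transpose]

lemma opMinus_mul_stab (hδ : 0 < δx) (h : ℝ) :
    opMinus K δx h * stab K δx h = opPlus K δx h := by
  have h1 : opPlus K δx h = (2 : ℂ) • 1 - opMinus K δx h := by
    rw [← opPlus_add_opMinus (K := K) (δx := δx) h, add_sub_cancel_right]
  have h2 : opMinus K δx h * opPlus K δx h = opPlus K δx h * opMinus K δx h := by
    rw [h1, mul_sub, sub_mul]; simp
  rw [stab, ← mul_assoc, h2, mul_assoc, opMinus_mul_inv hδ, mul_one]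

/-- Half the sum of `u` and `R(hA) v` is `(1 - i h A / 2)⁻¹` applied to the internal stage. -/
lemma half_add_stab (hδ : 0 < δx) (h : ℝ) (u v : V K) :
    (1 / 2 : ℂ) • (u + stab K δx h *ᵥ v) = (opMinus K δx h)⁻¹ *ᵥ
      (u + (1 / 2 : ℂ) • (opPlus K δx h *ᵥ (v - u))) := by
  have hD : opMinus K δx h *ᵥ ((1 / 2 : ℂ) • (u + stab K δx h *ᵥ v))
      = u + (1 / 2 : ℂ) • (opPlus K δx h *ᵥ (v - u)) := by
    have h1 : opMinus K δx h *ᵥ u = (2 : ℂ) • u - opPlus K δx h *ᵥ u := by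
      -- The two operators add up to 2, so (1 - ihA/2)u can be traded for 2u - (1 + ihA/2)u.
      rw [eq_sub_iff_add_eq, ← Matrix.add_mulVec, add_comm, opPlus_add_opMinus,
        Matrix.smul_mulVec, Matrix.one_mulVec]
    rw [Matrix.mulVec_smul, Matrix.mulVec_add, Matrix.mulVec_mulVec, opMinus_mul_stab hδ, h1,
      Matrix.mulVec_sub]
    module
  rw [← hD, Matrix.mulVec_mulVec, opMinus_inv_mul hδ, Matrix.one_mulVec]

end Resolvent

end MidpointNLS

end

noncomputable section

namespace MidpointNLS

open Finset
open scoped ContDiff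

/-! ### The complexified scheme on the grid -/

/-- Grid functions, normed by the discrete norm. -/
def DSpace (K : ℕ) (_δx : ℝ) : Type := V K

section DSpace

variable {K : ℕ} {δx : ℝ}

instance : AddCommGroup (DSpace K δx) := inferInstanceAs (AddCommGroup (V K))

instance : Module ℂ (DSpace K δx) := inferInstanceAs (Module ℂ (V K))

instance : FiniteDimensional ℂ (DSpace K δx) := inferInstanceAs (FiniteDimensional ℂ (V K))

/-- The identification of `DSpace` with grid functions. -/
def gridEquiv (K : ℕ) (δx : ℝ) : DSpace K δx ≃ₗ[ℂ] V K := LinearEquiv.refl ℂ (V K)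

variable [hδ : Fact (0 < δx)]

instance : NormedAddCommGroup (DSpace K δx) :=
  NormedAddCommGroup.induced (DSpace K δx) _ ((gridEmbed K δx).comp (gridEquiv K δx).toLinearMap)
    ((gridEmbed_injective hδ.out).comp (gridEquiv K δx).injective)

instance : NormedSpace ℂ (DSpace K δx) :=
  NormedSpace.induced ℂ (DSpace K δx) _ ((gridEmbed K δx).comp (gridEquiv K δx).toLinearMap)

instance : CompleteSpace (DSpace K δx) := FiniteDimensional.complete ℂ _

/-- The identification of `DSpace` with grid functions, as a homeomorphism. -/
def toV (K : ℕ) (δx : ℝ) [Fact (0 < δx)] : DSpace K δx ≃L[ℂ] V K :=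
  (gridEquiv K δx).toContinuousLinearEquiv

lemma norm_eq_dnorm (u : DSpace K δx) : ‖u‖ = dnorm δx (toV K δx u) :=
  norm_gridEmbed hδ.out (gridEquiv K δx u)

lemma norm_toV_symm (u : V K) : ‖(toV K δx).symm u‖ = dnorm δx u := by
  rw [norm_eq_dnorm, ContinuousLinearEquiv.apply_symm_apply]

end DSpace

/-! ### The polarized nonlinearity. -/

section Pair

variable {K : ℕ} {δx : ℝ}

lemma dnorm_smul (hδ : 0 < δx) (c : ℂ) (u : V K) : dnorm δx (c • u) = ‖c‖ * dnorm δx u := by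
  rw [← norm_gridEmbed hδ, ← norm_gridEmbed hδ, map_smul, norm_smul]

lemma dnorm_neg (hδ : 0 < δx) (u : V K) : dnorm δx (-u) = dnorm δx u := by
  rw [← norm_gridEmbed hδ, ← norm_gridEmbed hδ, map_neg, norm_neg]

lemma dnorm_add_le (hδ : 0 < δx) (u v : V K) : dnorm δx (u + v) ≤ dnorm δx u + dnorm δx v := by
  rw [← norm_gridEmbed hδ, ← norm_gridEmbed hδ, ← norm_gridEmbed hδ, map_add]
  exact norm_add_le _ _

/-- The polarized nonlinearity `i λ p^{r+1} q^r`. -/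
def pairField (r : ℕ) (lam : ℝ) (p q : V K) : V K :=
  (Complex.I * lam) • (p ^ (r + 1) * q ^ r)

lemma dnorm_pairField_le (hδ : 0 < δx) (r : ℕ) {lam : ℝ} (hlam : lam = 1 ∨ lam = -1) (p q : V K) :
    dnorm δx (pairField r lam p q) ≤ 4 ^ r * dnorm δx p ^ (r + 1) * dnorm δx q ^ r := by
  have hl : ‖Complex.I * (lam : ℂ)‖ = 1 := by rcases hlam with rfl | rfl <;> simp
  rw [pairField, dnorm_smul hδ, hl, one_mul]
  have h1 := dnorm_mul_pow_le hδ (p ^ (r + 1)) q r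
  have h2 := dnorm_mul_pow_le hδ p p r
  rw [← pow_succ'] at h2
  have hp := dnorm_nonneg (δx := δx) p
  have hq := dnorm_nonneg (δx := δx) q
  calc _ ≤ 2 ^ r * dnorm δx (p ^ (r + 1)) * dnorm δx q ^ r := h1
    _ ≤ 2 ^ r * (2 ^ r * dnorm δx p * dnorm δx p ^ r) * dnorm δx q ^ r := by gcongr
    _ = (2 * 2) ^ r * dnorm δx p ^ (r + 1) * dnorm δx q ^ r := by rw [mul_pow]; ring
    _ = _ := by norm_num

lemma pairField_star (r : ℕ) (lam : ℝ) (u : V K) :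
    pairField r lam u (star u) = Complex.I • nonlin r lam u := by
  funext j
  simp only [pairField, nonlin, Pi.smul_apply, Pi.mul_apply, Pi.pow_apply, Pi.star_apply,
    smul_eq_mul]
  have h : ((‖u j‖ ^ (2 * r) : ℝ) : ℂ) = u j ^ r * star (u j) ^ r := by
    rw [pow_mul, ← mul_pow, Complex.star_def, Complex.mul_conj, Complex.normSq_eq_norm_sq]
    push_cast; rfl
  rw [h]; ring

/-- The sign, produced by conjugating i, explains the minus in the second component of `pairNonlin`.
-/
lemma star_pairField (r : ℕ) (lam : ℝ) (p q : V K) :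
    star (pairField r lam p q) = -pairField r lam (star p) (star q) := by
  funext j
  simp [pairField]

lemma sum_mulVec_mul {M : Matrix (Grid K) (Grid K) ℂ} (hM : Mᵀ = M) (u v : V K) :
    ∑ j, (M *ᵥ u) j * v j = ∑ j, u j * (M *ᵥ v) j := by
  have h1 : (M *ᵥ u) ⬝ᵥ v = u ⬝ᵥ (M *ᵥ v) := by
    rw [Matrix.dotProduct_mulVec, ← Matrix.mulVec_transpose, hM]
  exact h1

end Pair

/-! ### Pairs of grid functions as a midpoint system. -/

section System

variable (r : ℕ) (lam : ℝ) (K : ℕ) (δx h : ℝ) [hδ : Fact (0 < δx)]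

/-- Pairs of grid functions; the pairs `(u, ū)` are the real points. -/
abbrev PairSpace : Type := DSpace K δx × DSpace K δx

/-- A matrix as an operator on grid functions with the discrete norm. -/
def matOp (M : Matrix (Grid K) (Grid K) ℂ) : DSpace K δx →L[ℂ] DSpace K δx :=
  LinearMap.toContinuousLinearMap
    (((gridEquiv K δx).symm.toLinearMap.comp M.mulVecLin).comp (gridEquiv K δx).toLinearMap)

variable {K δx}

variable (K δx)

/-- First component. -/
def fstV : PairSpace K δx →L[ℂ] V K :=
  (toV K δx : DSpace K δx →L[ℂ] V K).comp (ContinuousLinearMap.fst ℂ _ _)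

/-- Second component. -/
def sndV : PairSpace K δx →L[ℂ] V K :=
  (toV K δx : DSpace K δx →L[ℂ] V K).comp (ContinuousLinearMap.snd ℂ _ _)

/-- A pair of grid functions. -/
def mkPair (p q : V K) : PairSpace K δx := ((toV K δx).symm p, (toV K δx).symm q)

variable {K δx}

@[simp] lemma fstV_mkPair (p q : V K) : fstV K δx (mkPair K δx p q) = p :=
  (toV K δx).apply_symm_apply p

@[simp] lemma sndV_mkPair (p q : V K) : sndV K δx (mkPair K δx p q) = q :=
  (toV K δx).apply_symm_apply q

lemma pair_ext {x y : PairSpace K δx} (h1 : fstV K δx x = fstV K δx y)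
    (h2 : sndV K δx x = sndV K δx y) : x = y :=
  Prod.ext ((toV K δx).injective h1) ((toV K δx).injective h2)

lemma norm_pair (x : PairSpace K δx) :
    ‖x‖ = max (dnorm δx (fstV K δx x)) (dnorm δx (sndV K δx x)) := by
  rw [Prod.norm_def, norm_eq_dnorm, norm_eq_dnorm]; rfl

lemma dnorm_fstV_le (x : PairSpace K δx) : dnorm δx (fstV K δx x) ≤ ‖x‖ := by
  rw [norm_pair]; exact le_max_left _ _

lemma dnorm_sndV_le (x : PairSpace K δx) : dnorm δx (sndV K δx x) ≤ ‖x‖ := by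
  rw [norm_pair]; exact le_max_right _ _

lemma norm_mkPair (p q : V K) : ‖mkPair K δx p q‖ = max (dnorm δx p) (dnorm δx q) := by
  rw [norm_pair, fstV_mkPair, sndV_mkPair]

lemma contDiff_mkPair {X : Type*} [NormedAddCommGroup X] [NormedSpace ℂ X] {p q : X → V K}
    (hp : ContDiff ℂ ω p) (hq : ContDiff ℂ ω q) : ContDiff ℂ ω fun x => mkPair K δx (p x) (q x) :=
  ((toV K δx).symm.contDiff.comp hp).prodMk ((toV K δx).symm.contDiff.comp hq)

variable (K δx)

/-- Diagonal operators on pairs. -/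
def pairOp (M N : Matrix (Grid K) (Grid K) ℂ) : PairSpace K δx →L[ℂ] PairSpace K δx :=
  (matOp K δx M).prodMap (matOp K δx N)

variable {K δx}

@[simp] lemma fstV_pairOp (M N : Matrix (Grid K) (Grid K) ℂ) (x : PairSpace K δx) :
    fstV K δx (pairOp K δx M N x) = M *ᵥ fstV K δx x := rfl

@[simp] lemma sndV_pairOp (M N : Matrix (Grid K) (Grid K) ℂ) (x : PairSpace K δx) :
    sndV K δx (pairOp K δx M N x) = N *ᵥ sndV K δx x := rfl

variable (K δx)

/-- The nonlinearity on pairs. -/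
def pairNonlin (x : PairSpace K δx) : PairSpace K δx :=
  mkPair K δx (pairField r lam (fstV K δx x) (sndV K δx x))
    (-pairField r lam (sndV K δx x) (fstV K δx x))

/-- The symplectic form on pairs. -/
def pairForm : PairSpace K δx →L[ℂ] PairSpace K δx →L[ℂ] ℂ :=
  LinearMap.toContinuousBilinearMap <| LinearMap.mk₂ ℂ
    (fun x y => ∑ j : Grid K, (fstV K δx x j * sndV K δx y j - sndV K δx x j * fstV K δx y j))
    (fun x x' y => by simp only [map_add, Pi.add_apply, ← Finset.sum_add_distrib]; congr; ext; ring)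
    (fun c x y => by
      simp only [map_smul, Pi.smul_apply, smul_eq_mul, Finset.mul_sum]; congr; ext; ring)
    (fun x y y' => by simp only [map_add, Pi.add_apply, ← Finset.sum_add_distrib]; congr; ext; ring)
    (fun c x y => by
      simp only [map_smul, Pi.smul_apply, smul_eq_mul, Finset.mul_sum]; congr; ext; ring)

variable {K δx}

lemma pairForm_apply (x y : PairSpace K δx) : pairForm K δx x y =
    ∑ j : Grid K, (fstV K δx x j * sndV K δx y j - sndV K δx x j * fstV K δx y j) := rfl

/-- The form pairs first with second components, so the adjoint of diag(M, N) for symmetric M, N is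
diag(N, M). -/
lemma pairForm_pairOp {M N : Matrix (Grid K) (Grid K) ℂ} (hM : Mᵀ = M) (hN : Nᵀ = N)
    (x y : PairSpace K δx) :
    pairForm K δx (pairOp K δx M N x) y = pairForm K δx x (pairOp K δx N M y) := by
  simp only [pairForm_apply, Finset.sum_sub_distrib, fstV_pairOp, sndV_pairOp, sum_mulVec_mul hM,
    sum_mulVec_mul hN]

variable {r lam}

lemma norm_pairNonlin_le (hlam : lam = 1 ∨ lam = -1) (x : PairSpace K δx) :
    ‖pairNonlin r lam K δx x‖ ≤ 4 ^ r * ‖x‖ ^ (2 * r + 1) := by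
  have h1 := dnorm_fstV_le x
  have h2 := dnorm_sndV_le x
  have h3 := dnorm_nonneg (δx := δx) (fstV K δx x)
  have h4 := dnorm_nonneg (δx := δx) (sndV K δx x)
  have key : 4 ^ r * ‖x‖ ^ (r + 1) * ‖x‖ ^ r = 4 ^ r * ‖x‖ ^ (2 * r + 1) := by ring
  rw [pairNonlin, norm_mkPair, dnorm_neg hδ.out]
  refine max_le ?_ ?_
  · refine (dnorm_pairField_le hδ.out r hlam _ _).trans (le_trans ?_ key.le)
    gcongr
  · refine (dnorm_pairField_le hδ.out r hlam _ _).trans (le_trans ?_ key.le)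
    gcongr

variable (r lam)

lemma contDiff_pairField {X : Type*} [NormedAddCommGroup X] [NormedSpace ℂ X] {p q : X → V K}
    (hp : ContDiff ℂ ω p) (hq : ContDiff ℂ ω q) :
    ContDiff ℂ ω fun x => pairField r lam (p x) (q x) := by
  rw [contDiff_pi] at hp hq ⊢
  intro j
  exact contDiff_const.mul (((hp j).pow _).mul ((hq j).pow _))

lemma contDiff_pairNonlin : ContDiff ℂ ω (pairNonlin r lam K δx) :=
  contDiff_mkPair (contDiff_pairField r lam (fstV K δx).contDiff (sndV K δx).contDiff)
    (contDiff_pairField r lam (sndV K δx).contDiff (fstV K δx).contDiff).neg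

lemma pairNonlin_smul (c : ℂ) (x : PairSpace K δx) :
    pairNonlin r lam K δx (c • x) = c ^ (2 * r + 1) • pairNonlin r lam K δx x := by
  refine pair_ext ?_ ?_
  · rw [map_smul, pairNonlin, pairNonlin, fstV_mkPair, fstV_mkPair, map_smul, map_smul]
    funext j
    simp only [pairField, Pi.smul_apply, Pi.mul_apply, Pi.pow_apply, smul_eq_mul]
    ring
  · rw [map_smul, pairNonlin, pairNonlin, sndV_mkPair, sndV_mkPair, map_smul, map_smul]
    funext j
    simp only [pairField, Pi.smul_apply, Pi.mul_apply, Pi.pow_apply, Pi.neg_apply, smul_eq_mul]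
    ring

lemma hasDerivAt_pairField (p q α β : V K) (j : Grid K) :
    HasDerivAt (fun z : ℂ => pairField r lam (p + z • α) (q + z • β) j)
      (Complex.I * lam * ((r + 1) * p j ^ r * q j ^ r * α j
        + r * p j ^ (r + 1) * q j ^ (r - 1) * β j)) 0 := by
  have hlin : ∀ a b : ℂ, HasDerivAt (fun z : ℂ => a + z * b) b 0 := fun a b => by
    simpa using ((hasDerivAt_id (0 : ℂ)).mul_const b).const_add a
  have h1 := (((hlin (p j) (α j)).pow (r + 1)).mul ((hlin (q j) (β j)).pow r)).const_mul
    (Complex.I * lam)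
  refine h1.congr_deriv ?_
  simp only [zero_mul, add_zero, Nat.add_sub_cancel, Pi.pow_apply]
  push_cast
  ring

lemma fderiv_pairNonlin (x a : PairSpace K δx) (j : Grid K) :
    fstV K δx (fderiv ℂ (pairNonlin r lam K δx) x a) j
      = Complex.I * lam * ((r + 1) * fstV K δx x j ^ r * sndV K δx x j ^ r * fstV K δx a j
        + r * fstV K δx x j ^ (r + 1) * sndV K δx x j ^ (r - 1) * sndV K δx a j) ∧
    sndV K δx (fderiv ℂ (pairNonlin r lam K δx) x a) j
      = -(Complex.I * lam * ((r + 1) * sndV K δx x j ^ r * fstV K δx x j ^ r * sndV K δx a j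
        + r * sndV K δx x j ^ (r + 1) * fstV K δx x j ^ (r - 1) * fstV K δx a j)) := by
  have hd : HasDerivAt (fun z : ℂ => pairNonlin r lam K δx (x + z • a))
      (fderiv ℂ (pairNonlin r lam K δx) x a) 0 := by
    have h1 : HasDerivAt (fun z : ℂ => x + z • a) a 0 := by
      simpa using ((hasDerivAt_id (0 : ℂ)).smul_const a).const_add x
    have h2 := ((contDiff_pairNonlin r lam).differentiable (by simp)
      (x + (0 : ℂ) • a)).hasFDerivAt.comp_hasDerivAt (0 : ℂ) h1
    rw [zero_smul, add_zero] at h2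
    exact h2
  have h1 := hasDerivAt_pi.1 ((fstV K δx).hasFDerivAt.comp_hasDerivAt (0 : ℂ) hd) j
  have h2 := hasDerivAt_pi.1 ((sndV K δx).hasFDerivAt.comp_hasDerivAt (0 : ℂ) hd) j
  constructor
  · refine h1.unique ((hasDerivAt_pairField r lam _ _ _ _ j).congr_of_eventuallyEq
      (Filter.Eventually.of_forall fun z => ?_))
    simp [pairNonlin]
  · refine h2.unique ((hasDerivAt_pairField r lam _ _ _ _ j).neg.congr_of_eventuallyEq
      (Filter.Eventually.of_forall fun z => ?_))
    simp [pairNonlin]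

/-- The nonlinearity is, up to normalization, the Hamiltonian field of ∑ (p_j q_j)^(r+1); the
identity expresses the symmetry of second derivatives, and cancels gridpoint by gridpoint. -/
lemma pairForm_fderiv_pairNonlin (x a b : PairSpace K δx) :
    pairForm K δx (fderiv ℂ (pairNonlin r lam K δx) x a) b
      + pairForm K δx a (fderiv ℂ (pairNonlin r lam K δx) x b) = 0 := by
  rw [pairForm_apply, pairForm_apply, ← Finset.sum_add_distrib]
  refine Finset.sum_eq_zero fun j _ => ?_
  rw [(fderiv_pairNonlin r lam x a j).1, (fderiv_pairNonlin r lam x a j).2,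
    (fderiv_pairNonlin r lam x b j).1, (fderiv_pairNonlin r lam x b j).2]
  ring

variable (K δx)

/-- The complexified midpoint scheme for the nonlinear Schrödinger equation on the grid. -/
def gridSystem (hlam : lam = 1 ∨ lam = -1) : MidpointSystem r (4 ^ r) (PairSpace K δx) where
  g x := pairNonlin r lam K δx (pairOp K δx (opMinus K δx h)⁻¹ (opPlus K δx h)⁻¹ x)
  T := pairOp K δx (opPlus K δx h)⁻¹ (opMinus K δx h)⁻¹
  S := pairOp K δx (opPlus K δx h) (opMinus K δx h)
  B := pairForm K δx
  contDiff_g := (contDiff_pairNonlin r lam).comp (ContinuousLinearMap.contDiff _)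
  g_le x := by
    refine (norm_pairNonlin_le hlam _).trans ?_
    gcongr
    rw [norm_pair, norm_pair, fstV_pairOp, sndV_pairOp]
    exact max_le_max (dnorm_opMinus_inv_le hδ.out h _) (dnorm_opPlus_inv_le hδ.out h _)
  g_smul c x := by rw [map_smul, pairNonlin_smul]
  T_le x := by
    rw [norm_pair, norm_pair, fstV_pairOp, sndV_pairOp]
    exact max_le_max (dnorm_opPlus_inv_le hδ.out h _) (dnorm_opMinus_inv_le hδ.out h _)
  S_T x := by
    refine pair_ext ?_ ?_
    · rw [fstV_pairOp, fstV_pairOp, opPlus_inv_mulVec hδ.out]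
    · rw [sndV_pairOp, sndV_pairOp, opMinus_inv_mulVec hδ.out]
  B_S x y := by
    rw [pairForm_pairOp (opPlus_transpose h) (opMinus_transpose h), ← map_add]
    have h1 : pairOp K δx (opMinus K δx h) (opPlus K δx h) y
        + pairOp K δx (opPlus K δx h) (opMinus K δx h) y = (2 : ℂ) • y := by
      refine pair_ext ?_ ?_
      · rw [map_add, fstV_pairOp, fstV_pairOp, ← Matrix.add_mulVec, add_comm, opPlus_add_opMinus,
          Matrix.smul_mulVec, Matrix.one_mulVec, map_smul]
      · rw [map_add, sndV_pairOp, sndV_pairOp, ← Matrix.add_mulVec, opPlus_add_opMinus,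
          Matrix.smul_mulVec, Matrix.one_mulVec, map_smul]
    rw [h1, map_smul, smul_eq_mul]
  B_g x a b := by
    have h1 : ∀ c, fderiv ℂ (fun x => pairNonlin r lam K δx
        (pairOp K δx (opMinus K δx h)⁻¹ (opPlus K δx h)⁻¹ x)) x c
        = fderiv ℂ (pairNonlin r lam K δx) (pairOp K δx (opMinus K δx h)⁻¹ (opPlus K δx h)⁻¹ x)
          (pairOp K δx (opMinus K δx h)⁻¹ (opPlus K δx h)⁻¹ c) := by
      intro c
      have h2 := (((contDiff_pairNonlin r lam).differentiable (by simp)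
        (pairOp K δx (opMinus K δx h)⁻¹ (opPlus K δx h)⁻¹ x)).hasFDerivAt.comp x
          (ContinuousLinearMap.hasFDerivAt _)).fderiv
      exact congrArg (fun L => L c) h2
    -- T is the adjoint of the operator inside g. Composing a Hamiltonian field with an operator
    -- inside and its adjoint outside keeps it Hamiltonian.
    rw [h1, h1, pairForm_pairOp (opPlus_inv_transpose h) (opMinus_inv_transpose h),
      ← pairForm_pairOp (opMinus_inv_transpose h) (opPlus_inv_transpose h)]
    exact pairForm_fderiv_pairNonlin r lam _ _ _

end System

end MidpointNLS

end

noncomputable section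

namespace MidpointNLS

open Finset Filter Topology
open scoped ContDiff

/-! ### Real points -/

section RealPoints

variable {K : ℕ} {δx : ℝ}

/-- The real symplectic form on grid functions (without the weight `δx`). -/
def imForm (u v : V K) : ℝ := (∑ j : Grid K, u j * star (v j)).im

lemma imForm_add_left (u u' v : V K) : imForm (u + u') v = imForm u v + imForm u' v := by
  simp [imForm, add_mul, Finset.sum_add_distrib]

lemma imForm_add_right (u v v' : V K) : imForm u (v + v') = imForm u v + imForm u v' := by
  simp [imForm, mul_add, Finset.sum_add_distrib]

lemma imForm_smul_left (t : ℝ) (u v : V K) : imForm (t • u) v = t * imForm u v := by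
  simp [imForm, mul_assoc, Finset.mul_sum]

lemma imForm_smul_right (t : ℝ) (u v : V K) : imForm u (t • v) = t * imForm u v := by
  simp only [imForm, Pi.smul_apply, star_smul, star_trivial, mul_smul_comm, ← Finset.smul_sum,
    Complex.smul_im, smul_eq_mul]

lemma imForm_swap (u v : V K) : imForm u v = -imForm v u := by
  have h : ∑ j : Grid K, u j * star (v j) = star (∑ j : Grid K, v j * star (u j)) := by
    rw [star_sum]
    exact Finset.sum_congr rfl fun j _ => by rw [star_mul, star_star]
  rw [imForm, h, Complex.star_def, Complex.conj_im]; rfl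

variable [hδ : Fact (0 < δx)]

variable (K δx)

/-- The embedding of the real points `u ↦ (u, ū)`. -/
def realPair : V K →L[ℝ] PairSpace K δx :=
  (((toV K δx).symm : V K →L[ℂ] DSpace K δx).restrictScalars ℝ).prod
    ((((toV K δx).symm : V K →L[ℂ] DSpace K δx).restrictScalars ℝ).comp
      ((starL' ℝ : V K ≃L[ℝ] V K) : V K →L[ℝ] V K))

/-- The conjugation `(p, q) ↦ (q̄, p̄)`, whose fixed points are the real points. -/
def conjPair : PairSpace K δx →L[ℝ] PairSpace K δx :=
  ((((toV K δx).symm : V K →L[ℂ] DSpace K δx).restrictScalars ℝ).comp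
    ((starL' ℝ : V K ≃L[ℝ] V K) : V K →L[ℝ] V K)).comp ((sndV K δx).restrictScalars ℝ) |>.prod <|
  ((((toV K δx).symm : V K →L[ℂ] DSpace K δx).restrictScalars ℝ).comp
    ((starL' ℝ : V K ≃L[ℝ] V K) : V K →L[ℝ] V K)).comp ((fstV K δx).restrictScalars ℝ)

variable {K δx}

lemma realPair_apply (u : V K) : realPair K δx u = mkPair K δx u (star u) := rfl

lemma conjPair_apply (x : PairSpace K δx) :
    conjPair K δx x = mkPair K δx (star (sndV K δx x)) (star (fstV K δx x)) := rfl

@[simp] lemma fstV_realPair (u : V K) : fstV K δx (realPair K δx u) = u := fstV_mkPair _ _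

@[simp] lemma sndV_realPair (u : V K) : sndV K δx (realPair K δx u) = star u := sndV_mkPair _ _

lemma norm_realPair (u : V K) : ‖realPair K δx u‖ = dnorm δx u := by
  rw [realPair_apply, norm_mkPair, dnorm_star, max_self]

lemma norm_conjPair (x : PairSpace K δx) : ‖conjPair K δx x‖ = ‖x‖ := by
  rw [conjPair_apply, norm_mkPair, dnorm_star, dnorm_star, norm_pair, max_comm]

lemma conjPair_realPair (u : V K) : conjPair K δx (realPair K δx u) = realPair K δx u := by
  rw [conjPair_apply, fstV_realPair, sndV_realPair, star_star, realPair_apply]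

lemma eq_realPair_of_conjPair_eq {x : PairSpace K δx} (hx : conjPair K δx x = x) :
    x = realPair K δx (fstV K δx x) := by
  refine pair_ext (fstV_realPair _).symm ?_
  conv_lhs => rw [← hx]
  rw [conjPair_apply, sndV_mkPair, sndV_realPair]

lemma pairForm_realPair (u v : V K) :
    pairForm K δx (realPair K δx u) (realPair K δx v) = 2 * Complex.I * imForm u v := by
  rw [pairForm_apply]
  simp only [fstV_realPair, sndV_realPair]
  have h : ∀ z : ℂ, z - star z = 2 * Complex.I * (z.im : ℂ) := fun z => by
    apply Complex.ext <;> simp; ring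
  rw [imForm, ← h, star_sum, ← Finset.sum_sub_distrib]
  refine Finset.sum_congr rfl fun j _ => ?_
  rw [star_mul, star_star, Pi.star_apply, Pi.star_apply]
  ring

/-- The restriction of a map to the real points. -/
def realRestr (G : PairSpace K δx → PairSpace K δx) (u : V K) : V K :=
  fstV K δx (G (realPair K δx u))

variable {G : PairSpace K δx → PairSpace K δx}

/-- A map commuting with the conjugation preserves its fixed points, which are the real points. -/
lemma realPair_realRestr (hG : ∀ x, G (conjPair K δx x) = conjPair K δx (G x)) (u : V K) :
    realPair K δx (realRestr G u) = G (realPair K δx u) := by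
  rw [realRestr, ← eq_realPair_of_conjPair_eq]
  rw [← hG, conjPair_realPair]

lemma dnorm_realRestr_le (G : PairSpace K δx → PairSpace K δx) (u : V K) :
    dnorm δx (realRestr G u) ≤ ‖G (realPair K δx u)‖ := dnorm_fstV_le _

lemma hasFDerivAt_comp_realPair (hd : Differentiable ℂ G) (u : V K) :
    HasFDerivAt (fun u => G (realPair K δx u))
      (((fderiv ℂ G (realPair K δx u)).restrictScalars ℝ).comp (realPair K δx)) u :=
  ((hd _).hasFDerivAt.restrictScalars ℝ).comp u (realPair K δx).hasFDerivAt

lemma hasFDerivAt_realRestr (hd : Differentiable ℂ G) (u : V K) :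
    HasFDerivAt (realRestr G) (((fstV K δx).restrictScalars ℝ).comp
      (((fderiv ℂ G (realPair K δx u)).restrictScalars ℝ).comp (realPair K δx))) u :=
  ((fstV K δx).restrictScalars ℝ).hasFDerivAt.comp u (hasFDerivAt_comp_realPair hd u)

lemma realPair_fderiv_realRestr (hd : Differentiable ℂ G)
    (hG : ∀ x, G (conjPair K δx x) = conjPair K δx (G x)) (u a : V K) :
    realPair K δx (fderiv ℝ (realRestr G) u a)
      = fderiv ℂ G (realPair K δx u) (realPair K δx a) := by
  have h1 := (realPair K δx).hasFDerivAt.comp u (hasFDerivAt_realRestr hd u)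
  have h2 : (realPair K δx) ∘ realRestr G = fun u => G (realPair K δx u) := by
    funext u; exact realPair_realRestr hG u
  rw [h2] at h1
  rw [(hasFDerivAt_realRestr hd u).fderiv]
  exact congrArg (fun L => L a) (h1.unique (hasFDerivAt_comp_realPair hd u))

/-- The restriction of a Hamiltonian field to the real points is Hamiltonian. -/
lemma imForm_fderiv_realRestr (hd : Differentiable ℂ G)
    (hG : ∀ x, G (conjPair K δx x) = conjPair K δx (G x))
    (hB : ∀ x a b, pairForm K δx (fderiv ℂ G x a) b + pairForm K δx a (fderiv ℂ G x b) = 0)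
    (u a b : V K) :
    imForm (fderiv ℝ (realRestr G) u a) b + imForm a (fderiv ℝ (realRestr G) u b) = 0 := by
  have h := hB (realPair K δx u) (realPair K δx a) (realPair K δx b)
  rw [← realPair_fderiv_realRestr hd hG, ← realPair_fderiv_realRestr hd hG, pairForm_realPair,
    pairForm_realPair, ← mul_add, ← Complex.ofReal_add] at h
  have h2 : (2 * Complex.I) ≠ 0 := by simp
  exact Complex.ofReal_eq_zero.1 ((mul_eq_zero.1 h).resolve_left h2)

lemma pairNonlin_conjPair (r : ℕ) (lam : ℝ) (x : PairSpace K δx) :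
    pairNonlin r lam K δx (conjPair K δx x) = conjPair K δx (pairNonlin r lam K δx x) := by
  refine pair_ext ?_ ?_
  · rw [pairNonlin, pairNonlin, conjPair_apply, conjPair_apply]
    simp only [fstV_mkPair, sndV_mkPair, star_neg, star_pairField, neg_neg]
  · rw [pairNonlin, pairNonlin, conjPair_apply, conjPair_apply]
    simp only [fstV_mkPair, sndV_mkPair, star_pairField]

lemma pairOp_conjPair {M N : Matrix (Grid K) (Grid K) ℂ}
    (h : ∀ u, star (M *ᵥ u) = N *ᵥ star u) (x : PairSpace K δx) :
    pairOp K δx M N (conjPair K δx x) = conjPair K δx (pairOp K δx M N x) := by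
  have h' : ∀ u, star (N *ᵥ u) = M *ᵥ star u := fun u => by
    have := h (star u)
    rw [star_star] at this
    rw [← this, star_star]
  refine pair_ext ?_ ?_
  · simp only [conjPair_apply, fstV_pairOp, fstV_mkPair, sndV_pairOp, h']
  · simp only [conjPair_apply, fstV_pairOp, sndV_mkPair, sndV_pairOp, h]

/-- The nonlinearity is Lipschitz on balls of the discrete norm. -/
lemma dnorm_nonlin_sub_le {r : ℕ} (hr : 1 ≤ r) {lam : ℝ} (hlam : lam = 1 ∨ lam = -1) {s : ℝ}
    {p q : V K} (hp : dnorm δx p ≤ s) (hq : dnorm δx q ≤ s) :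
    dnorm δx (nonlin r lam p - nonlin r lam q)
      ≤ 4 ^ r * 2 ^ (2 * r + 1) * s ^ (2 * r) * dnorm δx (p - q) := by
  have h1 := norm_sub_le_of_norm_le_pow (d := 2 * r + 1) (by omega)
    (by positivity) (contDiff_pairNonlin r lam) (norm_pairNonlin_le (K := K) (δx := δx) hlam)
    (s := s) (y := realPair K δx p) (z := realPair K δx q) (by rw [norm_realPair]; exact hp)
    (by rw [norm_realPair]; exact hq)
  rw [← map_sub, norm_realPair, Nat.add_sub_cancel] at h1
  refine le_trans ?_ h1
  have h2 : fstV K δx (pairNonlin r lam K δx (realPair K δx p)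
      - pairNonlin r lam K δx (realPair K δx q))
      = Complex.I • (nonlin r lam p - nonlin r lam q) := by
    rw [map_sub, pairNonlin, pairNonlin, fstV_mkPair, fstV_mkPair]
    simp only [fstV_realPair, sndV_realPair]
    rw [pairField_star, pairField_star, smul_sub]
  have h3 := dnorm_fstV_le (pairNonlin r lam K δx (realPair K δx p)
      - pairNonlin r lam K δx (realPair K δx q))
  rwa [h2, dnorm_smul hδ.out, Complex.norm_I, one_mul] at h3

end RealPoints

/-! ### The fixed-point map -/

section FixMap

variable {K : ℕ} {δx : ℝ} {r : ℕ} {lam : ℝ}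

lemma dnorm_stage_le (hδ : 0 < δx) (h : ℝ) (u v : V K) :
    dnorm δx ((1 / 2 : ℂ) • (u + stab K δx h *ᵥ v)) ≤ (dnorm δx u + dnorm δx v) / 2 := by
  rw [dnorm_smul hδ]
  have h1 := dnorm_add_le hδ u (stab K δx h *ᵥ v)
  rw [dnorm_stab hδ] at h1
  have h2 : ‖(1 / 2 : ℂ)‖ = 1 / 2 := by norm_num
  rw [h2]; linarith

/-- The resolvent does not expand, R(hA) is isometric and the average contributes 1/2, so the factor
2^(2r+1) of the nonlinearity becomes 4^r. -/
lemma dnorm_fixMap_sub_le (hδ : 0 < δx) (hr : 1 ≤ r) (hlam : lam = 1 ∨ lam = -1) {ε : ℝ}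
    (hε : 0 ≤ ε) (h : ℝ) {u v w : V K} {s : ℝ} (hv : (dnorm δx u + dnorm δx v) / 2 ≤ s)
    (hw : (dnorm δx u + dnorm δx w) / 2 ≤ s) :
    dnorm δx (fixMap r lam δx ε h u v - fixMap r lam δx ε h u w)
      ≤ ε * (4 ^ r * 4 ^ r * s ^ (2 * r)) * dnorm δx (v - w) := by
  have : Fact (0 < δx) := ⟨hδ⟩
  rw [fixMap, fixMap, add_sub_add_left_eq_sub, ← smul_sub, ← Matrix.mulVec_sub, dnorm_smul hδ]
  have h1 : ‖Complex.I * (ε : ℂ)‖ = ε := by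
    rw [norm_mul, Complex.norm_I, one_mul, Complex.norm_real, Real.norm_of_nonneg hε]
  have h2 := dnorm_nonlin_sub_le hr hlam ((dnorm_stage_le hδ h u v).trans hv)
    ((dnorm_stage_le hδ h u w).trans hw)
  have h3 : (1 / 2 : ℂ) • (u + stab K δx h *ᵥ v) - (1 / 2 : ℂ) • (u + stab K δx h *ᵥ w)
      = (1 / 2 : ℂ) • (stab K δx h *ᵥ (v - w)) := by
    rw [Matrix.mulVec_sub]; module
  have h4 : ‖(1 / 2 : ℂ)‖ = 1 / 2 := by norm_num
  rw [h3, dnorm_smul hδ, h4, dnorm_stab hδ] at h2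
  rw [h1]
  calc _ ≤ ε * (4 ^ r * 2 ^ (2 * r + 1) * s ^ (2 * r) * (1 / 2 * dnorm δx (v - w))) := by
        gcongr
        exact (dnorm_opPlus_inv_le hδ h _).trans h2
    _ = ε * (4 ^ r * (2 ^ 2) ^ r * s ^ (2 * r)) * dnorm δx (v - w) := by
        rw [pow_succ, pow_mul]; ring
    _ = _ := by norm_num

lemma nonlin_zero : nonlin r lam (0 : V K) = 0 := by
  funext j; simp [nonlin]

lemma dnorm_fixMap_sub_self_le (hδ : 0 < δx) (hr : 1 ≤ r) (hlam : lam = 1 ∨ lam = -1) {ε : ℝ}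
    (hε : 0 ≤ ε) (h : ℝ) {u v : V K} {s : ℝ} (hv : (dnorm δx u + dnorm δx v) / 2 ≤ s) :
    dnorm δx (fixMap r lam δx ε h u v - u) ≤ ε * (2 * (4 ^ r * 4 ^ r) * s ^ (2 * r)) * s := by
  have : Fact (0 < δx) := ⟨hδ⟩
  have hs : 0 ≤ s := by
    have h1 := dnorm_nonneg (δx := δx) u
    have h2 := dnorm_nonneg (δx := δx) v
    linarith
  rw [fixMap, add_sub_cancel_left, dnorm_smul hδ]
  have h1 : ‖Complex.I * (ε : ℂ)‖ = ε := by
    rw [norm_mul, Complex.norm_I, one_mul, Complex.norm_real, Real.norm_of_nonneg hε]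
  have h2 := dnorm_nonlin_sub_le (q := 0) hr hlam ((dnorm_stage_le hδ h u v).trans hv)
    (by rw [dnorm_zero hδ]; exact hs)
  rw [nonlin_zero, sub_zero, sub_zero] at h2
  rw [h1]
  calc _ ≤ ε * (4 ^ r * 2 ^ (2 * r + 1) * s ^ (2 * r) * s) := by
        gcongr
        refine (dnorm_opPlus_inv_le hδ h _).trans (h2.trans ?_)
        gcongr
        exact (dnorm_stage_le hδ h u v).trans hv
    _ = ε * (2 * (4 ^ r * (2 ^ 2) ^ r) * s ^ (2 * r)) * s := by rw [pow_succ, pow_mul]; ring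
    _ = _ := by norm_num

/-- Permissibility under a smallness condition. -/
theorem exists_permissible_const (hr : 1 ≤ r) (hlam : lam = 1 ∨ lam = -1) :
    ∃ c : ℝ, 0 < c ∧ ∀ (K : ℕ) (δx h ε : ℝ), 0 < δx → 0 ≤ h → 0 ≤ ε →
      ∀ u : V K, ε * dnorm δx u ^ (2 * r) ≤ c → u ∈ permissible r lam K δx ε h := by
  -- For v of norm at most 2R the stage has norm at most 3R/2 ≤ 2R. With (2R)^(2r) = 4^r R^(2r) this
  -- constant makes the contraction factor 1/4 and the displacement from u at most R.
  refine ⟨1 / (4 * (4 ^ r * 4 ^ r * 4 ^ r)), by positivity, fun K δx h ε hδ _ hε u hu => ?_⟩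
  set R := dnorm δx u with hR
  have hR0 : 0 ≤ R := dnorm_nonneg u
  have hball : ∀ v ∈ dball K δx (2 * R), (R + dnorm δx v) / 2 ≤ 2 * R := fun v hv => by
    have : dnorm δx v ≤ 2 * R := hv
    linarith
  have hk : ε * (4 ^ r * 4 ^ r * (2 * R) ^ (2 * r)) ≤ 1 / 4 := by
    have h1 : ε * (4 ^ r * 4 ^ r * (2 * R) ^ (2 * r))
        = 4 ^ r * 4 ^ r * 4 ^ r * (ε * R ^ (2 * r)) := by
      rw [mul_pow, pow_mul (2 : ℝ) 2 r]; norm_num; ring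
    rw [h1]
    rw [le_div_iff₀ (by positivity)] at hu
    linarith
  refine ⟨fun v hv => ?_, 1 / 4, by norm_num, by norm_num, fun v hv w hw => ?_⟩
  · have h1 := dnorm_fixMap_sub_self_le hδ hr hlam hε h (hball v hv)
    have h2 := dnorm_add_le hδ u (fixMap r lam δx ε h u v - u)
    rw [add_sub_cancel] at h2
    have h3 : ε * (2 * (4 ^ r * 4 ^ r) * (2 * R) ^ (2 * r)) * (2 * R)
        = 4 * (ε * (4 ^ r * 4 ^ r * (2 * R) ^ (2 * r))) * R := by ring
    have h4 : 4 * (ε * (4 ^ r * 4 ^ r * (2 * R) ^ (2 * r))) * R ≤ 1 * R := by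
      gcongr; linarith
    change dnorm δx _ ≤ 2 * R
    linarith
  · exact (dnorm_fixMap_sub_le hδ hr hlam hε h (hball v hv) (hball w hw)).trans
      (mul_le_mul_of_nonneg_right hk (dnorm_nonneg _))

lemma exists_fixedPoint (hδ : 0 < δx) {ε h : ℝ} {u : V K}
    (hu : u ∈ permissible r lam K δx ε h) :
    ∃ v ∈ dball K δx (2 * dnorm δx u), fixMap r lam δx ε h u v = v := by
  have : Fact (0 < δx) := ⟨hδ⟩
  obtain ⟨hmaps, q, hq0, hq1, hlip⟩ := hu
  set F : DSpace K δx → DSpace K δx := fun v =>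
    (toV K δx).symm (fixMap r lam δx ε h u (toV K δx v)) with hF
  set s : Set (DSpace K δx) := Metric.closedBall 0 (2 * dnorm δx u)
  have hmem : ∀ v, v ∈ s ↔ toV K δx v ∈ dball K δx (2 * dnorm δx u) := fun v => by
    simp only [s, mem_closedBall_zero_iff, norm_eq_dnorm]; rfl
  have hsf : Set.MapsTo F s s := fun v hv => by
    rw [hmem] at hv ⊢
    rw [hF, ContinuousLinearEquiv.apply_symm_apply]
    exact hmaps hv
  have hc : ContractingWith (⟨q, hq0⟩ : NNReal) (hsf.restrict F s s) := by
    refine ⟨by exact_mod_cast hq1, LipschitzWith.of_dist_le_mul ?_⟩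
    rintro ⟨v, hv⟩ ⟨w, hw⟩
    rw [Subtype.dist_eq, Subtype.dist_eq, dist_eq_norm, dist_eq_norm]
    change ‖F v - F w‖ ≤ q * ‖v - w‖
    rw [hF]
    simp only
    rw [← map_sub, norm_toV_symm, norm_eq_dnorm, map_sub]
    exact hlip _ ((hmem v).1 hv) _ ((hmem w).1 hw)
  have h0 : (0 : DSpace K δx) ∈ s := by
    simp only [s, mem_closedBall_zero_iff, norm_zero]
    have := dnorm_nonneg (δx := δx) u
    positivity
  obtain ⟨v, hv, hfix, -⟩ := hc.exists_fixedPoint' Metric.isClosed_closedBall.isComplete hsf h0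
    (edist_ne_top _ _)
  refine ⟨toV K δx v, (hmem v).1 hv, ?_⟩
  have h1 := congrArg (toV K δx) hfix
  rwa [hF, ContinuousLinearEquiv.apply_symm_apply] at h1

lemma fixedPoint_unique (hδ : 0 < δx) {ε h : ℝ} {u : V K}
    (hu : u ∈ permissible r lam K δx ε h) {v w : V K} (hv : v ∈ dball K δx (2 * dnorm δx u))
    (hv' : fixMap r lam δx ε h u v = v) (hw : w ∈ dball K δx (2 * dnorm δx u))
    (hw' : fixMap r lam δx ε h u w = w) : v = w := by
  obtain ⟨-, q, hq0, hq1, hlip⟩ := hu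
  have h1 := hlip v hv w hw
  rw [hv', hw'] at h1
  have h2 := dnorm_nonneg (δx := δx) (v - w)
  have h3 : dnorm δx (v - w) = 0 := by nlinarith
  exact sub_eq_zero.1 (eq_zero_of_dnorm_eq_zero hδ h3)

lemma Psi_spec (hδ : 0 < δx) {ε h : ℝ} {u : V K} (hu : u ∈ permissible r lam K δx ε h) :
    Psi r lam δx ε h u ∈ dball K δx (2 * dnorm δx u) ∧
      fixMap r lam δx ε h u (Psi r lam δx ε h u) = Psi r lam δx ε h u := by
  have h1 := exists_fixedPoint hδ hu
  rw [Psi, dif_pos h1]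
  exact h1.choose_spec

/-- `Ψ` is well defined at permissible points. -/
theorem eq_Psi_iff (hδ : 0 < δx) {ε h : ℝ} {u : V K} (hu : u ∈ permissible r lam K δx ε h)
    (v : V K) : v = Psi r lam δx ε h u ↔
      (v ∈ dball K δx (2 * dnorm δx u) ∧ fixMap r lam δx ε h u v = v) := by
  have hs := Psi_spec hδ hu
  constructor
  · rintro rfl; exact hs
  · rintro ⟨h1, h2⟩
    exact fixedPoint_unique hδ hu h1 h2 hs.1 hs.2

end FixMap

end MidpointNLS

end

noncomputable section

namespace MidpointNLS

open Finset Filter Topology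
open scoped ContDiff

/-! ### The modified vector fields on the grid -/

section GridField

variable (r : ℕ) (lam : ℝ) (K : ℕ) (δx h : ℝ) [hδ : Fact (0 < δx)]

variable {r lam K δx}

lemma gridSystem_g_conjPair (hlam : lam = 1 ∨ lam = -1) (x : PairSpace K δx) :
    (gridSystem r lam K δx h hlam).g (conjPair K δx x)
      = conjPair K δx ((gridSystem r lam K δx h hlam).g x) := by
  change pairNonlin r lam K δx (pairOp K δx _ _ (conjPair K δx x))
    = conjPair K δx (pairNonlin r lam K δx (pairOp K δx _ _ x))
  rw [pairOp_conjPair (star_opMinus_inv h), pairNonlin_conjPair]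

lemma gridSystem_T_conjPair (hlam : lam = 1 ∨ lam = -1) (x : PairSpace K δx) :
    (gridSystem r lam K δx h hlam).T (conjPair K δx x)
      = conjPair K δx ((gridSystem r lam K δx h hlam).T x) :=
  pairOp_conjPair (star_opPlus_inv h) x

variable (r lam K δx)

/-- The coefficients of the modified vector field of the midpoint scheme. -/
def gridField (hlam : lam = 1 ∨ lam = -1) (k : ℕ) : V K → V K :=
  realRestr ((gridSystem r lam K δx h hlam).field k)

variable {r lam K δx}

lemma small_gridSystem (hr : 1 ≤ r) (hlam : lam = 1 ∨ lam = -1) (N : ℕ) :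
    ∃ ρ, (gridSystem r lam K δx h hlam).Small N ρ :=
  (gridSystem r lam K δx h hlam).small hr (by positivity) N

lemma gridSystem_homPart_conjPair (hr : 1 ≤ r) (hlam : lam = 1 ∨ lam = -1) (N n : ℕ)
    (x : PairSpace K δx) :
    homPart n ((gridSystem r lam K δx h hlam).defect N) (conjPair K δx x)
      = conjPair K δx (homPart n ((gridSystem r lam K δx h hlam).defect N) x) :=
  (gridSystem r lam K δx h hlam).homPart_defect_equivariant (small_gridSystem h hr hlam) _
    norm_conjPair (gridSystem_g_conjPair h hlam) (gridSystem_T_conjPair h hlam) N n x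

lemma differentiable_field (hlam : lam = 1 ∨ lam = -1) (k : ℕ) :
    Differentiable ℂ ((gridSystem r lam K δx h hlam).field k) :=
  ((gridSystem r lam K δx h hlam).smoothField_field k).contDiff_field.differentiable (by simp)

lemma contDiff_gridField (hlam : lam = 1 ∨ lam = -1) (k : ℕ) :
    ContDiff ℝ ω (gridField r lam K δx h hlam k) :=
  ((fstV K δx).restrictScalars ℝ).contDiff.comp
    ((((gridSystem r lam K δx h hlam).smoothField_field k).contDiff_field.restrict_scalars ℝ).comp
      (realPair K δx).contDiff)

/-- The modified vector fields are Hamiltonian. -/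
lemma imForm_fderiv_gridField (hr : 1 ≤ r) (hlam : lam = 1 ∨ lam = -1) (k : ℕ) (u a b : V K) :
    imForm (fderiv ℝ (gridField r lam K δx h hlam k) u a) b
      + imForm a (fderiv ℝ (gridField r lam K δx h hlam k) u b) = 0 :=
  imForm_fderiv_realRestr (differentiable_field h hlam k)
    (gridSystem_homPart_conjPair h hr hlam k _)
    ((gridSystem r lam K δx h hlam).field_hamiltonian hr (by positivity) k) u a b

lemma gridField_zero (hr : 1 ≤ r) (hlam : lam = 1 ∨ lam = -1) (u : V K) :
    gridField r lam K δx h hlam 0 u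
      = (opPlus K δx h)⁻¹ *ᵥ (Complex.I • nonlin r lam ((opMinus K δx h)⁻¹ *ᵥ u)) := by
  rw [gridField, realRestr, (gridSystem r lam K δx h hlam).field_zero hr (by positivity)]
  change fstV K δx (pairOp K δx _ _ (pairNonlin r lam K δx (pairOp K δx _ _ _))) = _
  rw [fstV_pairOp, pairNonlin, fstV_mkPair, fstV_pairOp, sndV_pairOp, fstV_realPair, sndV_realPair,
    ← star_opMinus_inv, pairField_star]

end GridField

/-! ### Differentiability and symplecticity -/

section Symplectic

variable {r : ℕ} {lam : ℝ} {K : ℕ} {δx : ℝ} (h ε : ℝ) [hδ : Fact (0 < δx)]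

variable (K δx) in
/-- `1 + i h A / 2` as a real operator. -/
def plusCLM : V K →L[ℝ] V K :=
  (LinearMap.toContinuousLinearMap (opPlus K δx h).mulVecLin).restrictScalars ℝ

omit hδ in
lemma plusCLM_apply (u : V K) : plusCLM K δx h u = opPlus K δx h *ᵥ u := rfl

-- The imaginary pairing moves 1 + ihA/2 to its conjugate transpose 1 - ihA/2, and the two sum to 2.
omit hδ in
lemma imForm_plusCLM (x y : V K) :
    imForm (plusCLM K δx h x) y + imForm x (plusCLM K δx h y) = 2 * imForm x y := by
  have h1 : imForm (plusCLM K δx h x) y = imForm x (opMinus K δx h *ᵥ y) := by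
    have h2 : star (opMinus K δx h *ᵥ y) = opPlus K δx h *ᵥ star y := by
      rw [Matrix.star_mulVec, opMinus_conjTranspose, ← Matrix.mulVec_transpose, opPlus_transpose]
    have h3 := sum_mulVec_mul (opPlus_transpose (K := K) (δx := δx) h) x (star y)
    rw [← h2] at h3
    exact congrArg Complex.im h3
  have h4 : opMinus K δx h *ᵥ y + opPlus K δx h *ᵥ y = (2 : ℝ) • y := by
    rw [← Matrix.add_mulVec, add_comm, opPlus_add_opMinus, Matrix.smul_mulVec, Matrix.one_mulVec]
    ext j; simp
  rw [h1, plusCLM_apply, ← imForm_add_right, h4, imForm_smul_right]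

variable (K δx) in
/-- The argument of the nonlinearity in the fixed-point equation, up to `(1 - i h A / 2)⁻¹`. -/
def stageCLM : V K × V K →L[ℝ] V K :=
  .fst ℝ _ _ + (1 / 2 : ℝ) • (plusCLM K δx h).comp (.snd ℝ _ _ - .fst ℝ _ _)

omit hδ in
lemma stageCLM_apply (u v : V K) :
    stageCLM K δx h (u, v) = u + (1 / 2 : ℝ) • plusCLM K δx h (v - u) := rfl

/-- The nonlinear term is the leading coefficient of the modified field, hence Hamiltonian,
evaluated at a stage linear in (u, v). Symplecticity rests on this form. -/
lemma fixMap_eq (hr : 1 ≤ r) (hlam : lam = 1 ∨ lam = -1) (u v : V K) :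
    fixMap r lam δx ε h u v
      = u + ε • gridField r lam K δx h hlam 0 (stageCLM K δx h (u, v)) := by
  have h1 : stageCLM K δx h (u, v) = u + (1 / 2 : ℂ) • (opPlus K δx h *ᵥ (v - u)) := by
    rw [stageCLM_apply, plusCLM_apply]
    congr 1
    ext j; simp
  rw [fixMap, half_add_stab hδ.out, h1, gridField_zero h hr hlam, Matrix.mulVec_smul, mul_comm,
    mul_smul, Complex.coe_smul]

lemma continuous_fixMap (hr : 1 ≤ r) (hlam : lam = 1 ∨ lam = -1) :
    Continuous fun p : V K × V K => fixMap r lam δx ε h p.1 p.2 := by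
  simp only [fixMap_eq (δx := δx) h ε hr hlam]
  exact continuous_fst.add (((contDiff_gridField h hlam 0).continuous.comp
    (stageCLM K δx h).continuous).const_smul ε)

lemma continuous_dnorm : Continuous (dnorm δx : V K → ℝ) := by
  have h1 : (dnorm δx : V K → ℝ) = fun u => ‖(toV K δx).symm u‖ :=
    funext fun u => (norm_toV_symm u).symm
  rw [h1]
  exact (toV K δx).symm.continuous.norm

lemma isCompact_dball (R : ℝ) : IsCompact (dball K δx R) := by
  have : ProperSpace (DSpace K δx) := FiniteDimensional.proper ℂ _
  have h1 : dball K δx R = (toV K δx).symm.toHomeomorph ⁻¹' Metric.closedBall 0 R := by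
    ext u
    rw [Set.mem_preimage, mem_closedBall_zero_iff]
    change dnorm δx u ≤ R ↔ ‖(toV K δx).symm u‖ ≤ R
    rw [norm_toV_symm]
  rw [h1, Homeomorph.isCompact_preimage]
  exact isCompact_closedBall _ _

variable {h ε}

/-- Compactness: nearby values stay in one compact ball, and each cluster point is a fixed point for
u in the right ball, hence equals Ψ(u). No locally uniform contraction constant is needed. -/
lemma continuousAt_Psi (hr : 1 ≤ r) (hlam : lam = 1 ∨ lam = -1) {u : V K}
    (hu : u ∈ interior (permissible r lam K δx ε h)) :
    ContinuousAt (Psi r lam δx ε h) u := by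
  have hnear : ∀ᶠ x in 𝓝 u, x ∈ permissible r lam K δx ε h := mem_interior_iff_mem_nhds.1 hu
  refine (isCompact_dball (K := K) (δx := δx) (2 * (dnorm δx u + 1)))
    |>.tendsto_nhds_of_unique_mapClusterPt ?_ fun x _ hcl => ?_
  · filter_upwards [hnear, (continuous_dnorm (δx := δx)).continuousAt.eventually_lt
      (continuousAt_const (y := dnorm δx u + 1)) (lt_add_one (dnorm δx u))] with x hx hx'
    have h1 : dnorm δx (Psi r lam δx ε h x) ≤ 2 * dnorm δx x := (Psi_spec hδ.out hx).1
    change dnorm δx (Psi r lam δx ε h x) ≤ _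
    linarith
  · obtain ⟨U, hU, hUx⟩ := mapClusterPt_iff_ultrafilter.1 hcl
    have hid : Tendsto (fun y : V K => y) U (𝓝 u) := hU
    refine (eq_Psi_iff hδ.out hnear.self_of_nhds x).2 ⟨?_, ?_⟩
    · refine le_of_tendsto_of_tendsto ((continuous_dnorm.tendsto x).comp hUx)
        (((continuous_dnorm.tendsto u).comp hid).const_mul 2) ?_
      filter_upwards [hU hnear] with y hy using (Psi_spec hδ.out hy).1
    · refine tendsto_nhds_unique
        (((continuous_fixMap h ε hr hlam).tendsto (u, x)).comp (hid.prodMk_nhds hUx)) ?_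
      refine hUx.congr' ?_
      filter_upwards [hU hnear] with y hy using (Psi_spec hδ.out hy).2.symm

/-- The derivative of the fixed-point map at the fixed point is a strict contraction. -/
lemma exists_fderiv_contraction (hr : 1 ≤ r) (hlam : lam = 1 ∨ lam = -1) (hε : 0 ≤ ε) {u v : V K}
    (hu : u ∈ permissible r lam K δx ε h) (hv : dnorm δx v ≤ 2 * dnorm δx u) :
    ∃ q : ℝ, q < 1 ∧ ∀ w, dnorm δx
      (ε • fderiv ℝ (gridField r lam K δx h hlam 0) (stageCLM K δx h (u, v))
        (stageCLM K δx h (0, w))) ≤ q * dnorm δx w := by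
  set T : DSpace K δx ≃L[ℝ] V K :=
    { (toV K δx).toLinearEquiv.restrictScalars ℝ with
      continuous_toFun := (toV K δx).continuous
      continuous_invFun := (toV K δx).symm.continuous } with hT
  set m := gridField r lam K δx h hlam 0 with hm
  have hmd : Differentiable ℝ m := (contDiff_gridField h hlam 0).differentiable (by simp)
  set F : DSpace K δx → DSpace K δx := fun y => T.symm (fixMap r lam δx ε h u (T y)) with hF
  have hlinear : ∀ y : V K, stageCLM K δx h (u, y) = stageCLM K δx h (u, 0)
      + (stageCLM K δx h).comp (.inr ℝ _ _) y := fun y => by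
    change _ = stageCLM K δx h (u, 0) + stageCLM K δx h (0, y)
    rw [← map_add, Prod.mk_add_mk, add_zero, zero_add]
  have hdF : ∀ y, HasFDerivAt F ((T.symm : V K →L[ℝ] DSpace K δx).comp
      ((ε • (fderiv ℝ m (stageCLM K δx h (u, T y))).comp
        ((stageCLM K δx h).comp (.inr ℝ _ _))).comp (T : DSpace K δx →L[ℝ] V K))) y := by
    intro y
    have h1 : HasFDerivAt (fun y => stageCLM K δx h (u, y))
        ((stageCLM K δx h).comp (.inr ℝ _ _)) (T y) := by
      rw [funext hlinear]
      exact (ContinuousLinearMap.hasFDerivAt _).const_add _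
    have h2 : HasFDerivAt (fun y => fixMap r lam δx ε h u y)
        (ε • (fderiv ℝ m (stageCLM K δx h (u, T y))).comp
          ((stageCLM K δx h).comp (.inr ℝ _ _))) (T y) := by
      simp only [fixMap_eq (δx := δx) h ε hr hlam]
      exact (((hmd _).hasFDerivAt.comp (T y) h1).const_smul ε).const_add u
    exact (T.symm : V K →L[ℝ] DSpace K δx).hasFDerivAt.comp y
      (h2.comp y (T : DSpace K δx →L[ℝ] V K).hasFDerivAt)
  have hcF : Continuous (fderiv ℝ F) := by
    have h1 : ContDiff ℝ ω F := by
      refine T.symm.contDiff.comp ?_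
      simp only [fixMap_eq (δx := δx) h ε hr hlam]
      refine contDiff_const.add (((contDiff_gridField h hlam 0).comp
        ((stageCLM K δx h).contDiff.comp (contDiff_const.prodMk T.contDiff))).const_smul ε)
    exact h1.continuous_fderiv (by simp)
  have key : ∃ q : ℝ, q < 1 ∧ ‖fderiv ℝ F (T.symm v)‖ ≤ q := by
    have hsub : ∀ y z, ‖F y - F z‖
        = dnorm δx (fixMap r lam δx ε h u (T y) - fixMap r lam δx ε h u (T z)) := fun y z => by
      rw [hF]
      simp only
      rw [← map_sub]
      exact norm_toV_symm _
    have hTn : ∀ y, ‖y‖ = dnorm δx (T y) := norm_eq_dnorm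
    -- For u = 0 the ball is a single point and permissibility says nothing about derivatives; the
    -- explicit Lipschitz estimate on a small ball replaces it.
    rcases eq_or_ne u 0 with rfl | hu0
    · rw [dnorm_zero hδ.out, mul_zero] at hv
      have hv0 : v = 0 := eq_zero_of_dnorm_eq_zero hδ.out (le_antisymm hv (dnorm_nonneg v))
      obtain ⟨s, hs0, hs1⟩ : ∃ s : ℝ, 0 < s ∧ ε * (4 ^ r * 4 ^ r * s ^ (2 * r)) ≤ 1 / 2 := by
        have h1 : Tendsto (fun s : ℝ => ε * (4 ^ r * 4 ^ r * s ^ (2 * r))) (𝓝[>] 0)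
            (𝓝 (ε * (4 ^ r * 4 ^ r * 0 ^ (2 * r)))) :=
          (Continuous.tendsto (by fun_prop) 0).mono_left nhdsWithin_le_nhds
        rw [zero_pow (by omega), mul_zero, mul_zero] at h1
        obtain ⟨s, hs, hs'⟩ := ((h1.eventually_le_const (show (0 : ℝ) < 1 / 2 by norm_num)).and
          self_mem_nhdsWithin).exists
        exact ⟨s, hs', hs⟩
      refine ⟨1 / 2, by norm_num, ?_⟩
      rw [hv0, map_zero]
      refine norm_fderiv_le_of_lipschitzOn (C := ⟨1 / 2, by norm_num⟩) ℝ
        (Metric.ball_mem_nhds 0 hs0) (LipschitzOnWith.of_dist_le_mul fun y hy z hz => ?_)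
      rw [dist_eq_norm, dist_eq_norm, hsub, hTn (y - z), map_sub]
      rw [mem_ball_zero_iff, hTn] at hy hz
      refine (dnorm_fixMap_sub_le hδ.out hr hlam hε h (s := s) ?_ ?_).trans
        (mul_le_mul_of_nonneg_right hs1 (dnorm_nonneg _))
      · rw [dnorm_zero hδ.out]; linarith
      · rw [dnorm_zero hδ.out]; linarith
    · obtain ⟨-, q, hq0, hq1, hq⟩ := hu
      refine ⟨q, hq1, ?_⟩
      have hupos : 0 < 2 * dnorm δx u := by
        have : dnorm δx u ≠ 0 := fun h0 => hu0 (eq_zero_of_dnorm_eq_zero hδ.out h0)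
        have := lt_of_le_of_ne (dnorm_nonneg (δx := δx) u) this.symm
        linarith
      -- The fixed point may lie on the bounding sphere, so the derivative bound is proved inside
      -- the open ball and carried to the closure by continuity.
      have hmem : ∀ y ∈ Metric.ball (0 : DSpace K δx) (2 * dnorm δx u),
          y ∈ {y | ‖fderiv ℝ F y‖ ≤ q} := fun y hy => by
        refine norm_fderiv_le_of_lipschitzOn (C := ⟨q, hq0⟩) ℝ
          (Metric.isOpen_ball.mem_nhds hy) (LipschitzOnWith.of_dist_le_mul fun y hy z hz => ?_)
        rw [dist_eq_norm, dist_eq_norm, hsub, hTn (y - z), map_sub]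
        rw [mem_ball_zero_iff, hTn] at hy hz
        exact hq _ hy.le _ hz.le
      have h2 := (isClosed_le hcF.norm continuous_const).closure_subset_iff.2 hmem
      rw [closure_ball _ hupos.ne'] at h2
      refine h2 ?_
      rw [mem_closedBall_zero_iff, hTn, ContinuousLinearEquiv.apply_symm_apply]
      exact hv
  obtain ⟨q, hq, hle⟩ := key
  refine ⟨q, hq, fun w => ?_⟩
  have h1 := (fderiv ℝ F (T.symm v)).le_of_opNorm_le hle (T.symm w)
  rw [(hdF _).fderiv] at h1
  have h2 : ‖T.symm w‖ = dnorm δx w := norm_toV_symm w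
  rw [h2] at h1
  refine le_trans (le_of_eq ?_) h1
  refine (norm_toV_symm _).symm.trans ?_
  simp only [ContinuousLinearMap.comp_apply, ContinuousLinearEquiv.coe_coe,
    ContinuousLinearEquiv.apply_symm_apply]
  rfl

/-- Implicit function theorem for v - F_u(v) = 0. Its partial derivative in v is the identity minus
a strict contraction, hence injective, hence invertible in finite dimension. Continuity identifies Ψ
with the implicit function. -/
lemma differentiableAt_Psi (hr : 1 ≤ r) (hlam : lam = 1 ∨ lam = -1) (hε : 0 ≤ ε) {u : V K}
    (hu : u ∈ interior (permissible r lam K δx ε h)) :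
    DifferentiableAt ℝ (Psi r lam δx ε h) u := by
  have hup := interior_subset hu
  have hnear : ∀ᶠ x in 𝓝 u, x ∈ permissible r lam K δx ε h := mem_interior_iff_mem_nhds.1 hu
  set v := Psi r lam δx ε h u with hv
  have hvs := Psi_spec hδ.out hup
  set m := gridField r lam K δx h hlam 0 with hm
  set f : V K × V K → V K := fun p => p.2 - fixMap r lam δx ε h p.1 p.2 with hf
  set f' : V K × V K →L[ℝ] V K := .snd ℝ _ _ - (.fst ℝ _ _ +
    ε • (fderiv ℝ m (stageCLM K δx h (u, v))).comp (stageCLM K δx h)) with hf'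
  have hdf : HasStrictFDerivAt f f' (u, v) := by
    have h1 : HasStrictFDerivAt m (fderiv ℝ m (stageCLM K δx h (u, v))) (stageCLM K δx h (u, v)) :=
      (contDiff_gridField h hlam 0).contDiffAt.hasStrictFDerivAt (by simp)
    simp only [hf, fixMap_eq h ε hr hlam]
    exact hasStrictFDerivAt_snd.sub (hasStrictFDerivAt_fst.add
      ((h1.comp (u, v) (stageCLM K δx h).hasStrictFDerivAt).const_smul ε))
  have hinv : (f' ∘L .inr ℝ (V K) (V K)).IsInvertible := by
    have hinj : Function.Injective (f' ∘L .inr ℝ (V K) (V K)) := by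
      rw [injective_iff_map_eq_zero]
      intro w hw
      obtain ⟨q, hq, hle⟩ := exists_fderiv_contraction hr hlam hε hup hvs.1
      have h1 : w - (0 + ε • fderiv ℝ m (stageCLM K δx h (u, v)) (stageCLM K δx h (0, w))) = 0 := hw
      rw [zero_add, sub_eq_zero] at h1
      have h2 := hle w
      rw [← h1] at h2
      have h3 := dnorm_nonneg (δx := δx) w
      exact eq_zero_of_dnorm_eq_zero hδ.out (by nlinarith)
    exact ⟨(LinearEquiv.ofInjectiveEndo (f' ∘L .inr ℝ (V K) (V K)).toLinearMap
      hinj).toContinuousLinearEquiv, by ext; rfl⟩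
  have h0 : ∀ x ∈ permissible r lam K δx ε h, f (x, Psi r lam δx ε h x) = 0 := fun x hx => by
    rw [hf]; simp only
    rw [(Psi_spec hδ.out hx).2, sub_self]
  have h1 : Tendsto (fun x => (x, Psi r lam δx ε h x)) (𝓝 u) (𝓝 (u, v)) :=
    tendsto_id.prodMk_nhds (continuousAt_Psi hr hlam hu)
  have h2 : Psi r lam δx ε h =ᶠ[𝓝 u] hdf.implicitFunctionOfProdDomain hinv := by
    filter_upwards [h1.eventually (hdf.eventually_apply_eq_iff_implicitFunctionOfProdDomain hinv),
      hnear] with x hx hxp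
    exact (hx.1 (by rw [h0 x hxp, h0 u hup])).symm
  exact ((hdf.hasStrictFDerivAt_implicitFunctionOfProdDomain hinv).hasFDerivAt.congr_of_eventuallyEq
    h2).differentiableAt

/-- Write ω for `imForm`, Q = 1 + ihA/2, x = Da - a and y = Db - b. Differentiating the fixed-point
equation and using that the leading field is Hamiltonian gives ω(x, b + ½Qy) + ω(a + ½Qx, y) = 0. As
ω(Qx,y) + ω(x,Qy) = 2ω(x,y), this is ω(a+x, b+y) = ω(a, b). -/
lemma imForm_fderiv_Psi (hr : 1 ≤ r) (hlam : lam = 1 ∨ lam = -1) (hε : 0 ≤ ε) {u : V K}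
    (hu : u ∈ interior (permissible r lam K δx ε h)) (a b : V K) :
    imForm (fderiv ℝ (Psi r lam δx ε h) u a) (fderiv ℝ (Psi r lam δx ε h) u b) = imForm a b := by
  have hnear : ∀ᶠ x in 𝓝 u, x ∈ permissible r lam K δx ε h := mem_interior_iff_mem_nhds.1 hu
  set D := fderiv ℝ (Psi r lam δx ε h) u with hD
  have hd : HasFDerivAt (Psi r lam δx ε h) D u := (differentiableAt_Psi hr hlam hε hu).hasFDerivAt
  set m := gridField r lam K δx h hlam 0 with hm
  set m' := fderiv ℝ m (stageCLM K δx h (u, Psi r lam δx ε h u)) with hm'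
  have h1 : HasFDerivAt (Psi r lam δx ε h)
      (.id ℝ _ + ε • m'.comp ((stageCLM K δx h).comp ((ContinuousLinearMap.id ℝ _).prod D))) u := by
    have h2 : HasFDerivAt (fun x => x + ε • m (stageCLM K δx h (x, Psi r lam δx ε h x)))
        (.id ℝ _ + ε • m'.comp ((stageCLM K δx h).comp ((ContinuousLinearMap.id ℝ _).prod D))) u :=
      (hasFDerivAt_id u).add ((((((contDiff_gridField h hlam 0).differentiable (by simp)
        _).hasFDerivAt).comp u ((stageCLM K δx h).hasFDerivAt.comp u
          ((hasFDerivAt_id u).prodMk hd)))).const_smul ε)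
    refine h2.congr_of_eventuallyEq ?_
    filter_upwards [hnear] with x hx
    rw [← fixMap_eq (δx := δx) h ε hr hlam, (Psi_spec hδ.out hx).2]
  have hDa : ∀ c, D c = c + ε • m' (stageCLM K δx h (c, D c)) := fun c =>
    congrArg (fun L => L c) (hd.unique h1)
  have hm2 := imForm_fderiv_gridField (δx := δx) h hr hlam 0 (stageCLM K δx h (u, Psi r lam δx ε h u))
    (stageCLM K δx h (a, D a)) (stageCLM K δx h (b, D b))
  rw [← hm, ← hm'] at hm2
  have e1 : ∀ c, ε • m' (stageCLM K δx h (c, D c)) = D c - c := fun c =>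
    eq_sub_of_add_eq' (hDa c).symm
  have hm3 : imForm (D a - a) (stageCLM K δx h (b, D b))
      + imForm (stageCLM K δx h (a, D a)) (D b - b) = 0 := by
    rw [← e1, ← e1, imForm_smul_left, imForm_smul_right, ← mul_add, hm2, mul_zero]
  rw [stageCLM_apply, stageCLM_apply] at hm3
  have hp := imForm_plusCLM (δx := δx) h (D a - a) (D b - b)
  set x := D a - a with hx
  set y := D b - b with hy
  have ea : D a = a + x := by rw [hx]; abel
  have eb : D b = b + y := by rw [hy]; abel
  rw [ea, eb]
  simp only [imForm_add_left, imForm_add_right, imForm_smul_left, imForm_smul_right] at hm3 ⊢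
  linarith

omit hδ in
lemma imForm_eq_sum (x y : V K) :
    imForm x y = ∑ j, ((x j).im * (y j).re - (x j).re * (y j).im) := by
  rw [imForm, Complex.im_sum]
  refine Finset.sum_congr rfl fun j _ => ?_
  rw [Complex.mul_im, Complex.star_def, Complex.conj_re, Complex.conj_im]
  ring

omit hδ in
lemma imForm_single (i j : Grid K) (a b : ℂ) :
    imForm (Pi.single i a) (Pi.single j b : V K) = if i = j then (a * star b).im else 0 := by
  rw [imForm, Finset.sum_eq_single i]
  · split_ifs with hij
    · subst hij; simp
    · rw [Pi.single_eq_same, Pi.single_eq_of_ne hij]; simp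
  · intro k _ hk
    rw [Pi.single_eq_of_ne hk, zero_mul]
  · simp

omit hδ in
/-- A differentiable map whose derivative preserves the symplectic form is symplectic. -/
lemma isSymplecticAt_of_imForm {Φ : V K → V K} {u : V K} (hd : DifferentiableAt ℝ Φ u)
    (hΦ : ∀ a b, imForm (fderiv ℝ Φ u a) (fderiv ℝ Φ u b) = imForm a b) :
    IsSymplecticAt Φ u := by
  refine ⟨hd, ?_⟩
  -- The matrix of `imForm` in the coordinates (Re, Im) is -J, which accounts for the sign.
  have key : ∀ (i j : Grid K) (a b : ℂ),
      -∑ k, (fderiv ℝ Φ u (Pi.single i a) k).im * (fderiv ℝ Φ u (Pi.single j b) k).re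
        + ∑ k, (fderiv ℝ Φ u (Pi.single i a) k).re * (fderiv ℝ Φ u (Pi.single j b) k).im
      = if i = j then -(a * star b).im else 0 := fun i j a b => by
    have h1 := hΦ (Pi.single i a) (Pi.single j b)
    rw [imForm_single, imForm_eq_sum, Finset.sum_sub_distrib] at h1
    have h2 : (if i = j then -(a * star b).im else 0) = -(if i = j then (a * star b).im else 0) := by
      split_ifs <;> simp
    rw [h2, ← h1]
    ring
  rw [realJacobian, sympJ, Matrix.fromBlocks_transpose, Matrix.fromBlocks_multiply,
    Matrix.fromBlocks_multiply]
  congr 1 <;> ext i j <;>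
    simp only [Matrix.mul_zero, Matrix.mul_one, Matrix.mul_neg, zero_add, add_zero,
      Matrix.add_apply, Matrix.mul_apply, Matrix.neg_apply, Matrix.transpose_apply,
      Matrix.of_apply, neg_mul, key] <;>
    simp [Matrix.one_apply] <;> split_ifs <;> simp

/-- `Ψ` is symplectic at interior points of the set of permissible points. -/
theorem isSymplecticAt_Psi (hr : 1 ≤ r) (hlam : lam = 1 ∨ lam = -1) (hε : 0 ≤ ε) {u : V K}
    (hu : u ∈ interior (permissible r lam K δx ε h)) : IsSymplecticAt (Psi r lam δx ε h) u :=
  isSymplecticAt_of_imForm (differentiableAt_Psi hr hlam hε hu)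
    (imForm_fderiv_Psi hr hlam hε hu)

end Symplectic

end MidpointNLS

end

noncomputable section

namespace MidpointNLS

open Finset Filter Topology
open scoped ContDiff

/-! ### Homogeneous polynomials -/

section HomPoly

variable {K : ℕ}

lemma IsHomPoly.sum {d : ℕ} {ι : Type*} (s : Finset ι) {P : ι → V K → ℝ}
    (h : ∀ i ∈ s, IsHomPoly d (P i)) : IsHomPoly d (fun u => ∑ i ∈ s, P i u) := by
  choose! p hp hpe using h
  refine ⟨∑ i ∈ s, p i, MvPolynomial.IsHomogeneous.sum _ _ _ hp, fun u => ?_⟩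
  rw [map_sum]
  exact Finset.sum_congr rfl fun i hi => hpe i hi u

lemma IsHomPoly.mul {d e : ℕ} {P Q : V K → ℝ} (hP : IsHomPoly d P) (hQ : IsHomPoly e Q) :
    IsHomPoly (d + e) (fun u => P u * Q u) := by
  obtain ⟨p, hp, hpe⟩ := hP
  obtain ⟨q, hq, hqe⟩ := hQ
  exact ⟨p * q, hp.mul hq, fun u => by simp only [map_mul, hpe, hqe]⟩

lemma IsHomPoly.const_mul {d : ℕ} {P : V K → ℝ} (c : ℝ) (hP : IsHomPoly d P) :
    IsHomPoly d (fun u => c * P u) := by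
  obtain ⟨p, hp, hpe⟩ := hP
  exact ⟨MvPolynomial.C c * p, hp.C_mul c, fun u => by simp only [map_mul, MvPolynomial.eval_C, hpe]⟩

lemma IsHomPoly.sub {d : ℕ} {P Q : V K → ℝ} (hP : IsHomPoly d P) (hQ : IsHomPoly d Q) :
    IsHomPoly d (fun u => P u - Q u) := by
  obtain ⟨p, hp, hpe⟩ := hP
  obtain ⟨q, hq, hqe⟩ := hQ
  exact ⟨p - q, hp.sub hq, fun u => by simp only [map_sub, hpe, hqe]⟩

lemma isHomPoly_re (j : Grid K) : IsHomPoly 1 (fun u : V K => (u j).re) :=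
  ⟨MvPolynomial.X (Sum.inl j), MvPolynomial.isHomogeneous_X _ _, fun u => by simp⟩

lemma isHomPoly_im (j : Grid K) : IsHomPoly 1 (fun u : V K => (u j).im) :=
  ⟨MvPolynomial.X (Sum.inr j), MvPolynomial.isHomogeneous_X _ _, fun u => by simp⟩

/-- The diagonal of a multilinear form is a homogeneous polynomial. -/
lemma isHomPoly_multilinear {d : ℕ} (m : MultilinearMap ℝ (fun _ : Fin d => V K) ℝ) :
    IsHomPoly d (fun u => m fun _ => u) := by
  classical
  set e : Grid K ⊕ Grid K → V K :=
    Sum.elim (fun j => Pi.single j 1) (fun j => Pi.single j Complex.I) with he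
  have hexp : ∀ u : V K, u = ∑ b, Sum.elim (fun j => (u j).re) (fun j => (u j).im) b • e b := by
    intro u
    rw [Fintype.sum_sum_type]
    simp only [he, Sum.elim_inl, Sum.elim_inr]
    rw [← Finset.sum_add_distrib]
    funext k
    rw [Finset.sum_apply, Finset.sum_eq_single k]
    · simp [Complex.re_add_im]
    · intro j _ hj
      simp [Pi.single_eq_of_ne hj.symm]
    · simp
  refine ⟨∑ f : Fin d → Grid K ⊕ Grid K,
    MvPolynomial.C (m fun i => e (f i)) * ∏ i, MvPolynomial.X (f i), ?_, fun u => ?_⟩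
  · refine MvPolynomial.IsHomogeneous.sum _ _ _ fun f _ => MvPolynomial.IsHomogeneous.C_mul ?_ _
    simpa using MvPolynomial.IsHomogeneous.prod univ
      (fun i : Fin d => (MvPolynomial.X (f i) : MvPolynomial (Grid K ⊕ Grid K) ℝ)) (fun _ => 1)
      fun i _ => MvPolynomial.isHomogeneous_X _ _
  · change m (fun _ => u) = _
    conv_lhs => rw [hexp u]
    rw [MultilinearMap.map_sum, map_sum]
    refine Finset.sum_congr rfl fun f _ => ?_
    rw [MultilinearMap.map_smul_univ, map_mul, map_prod, MvPolynomial.eval_C, smul_eq_mul,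
      mul_comm]
    simp only [MvPolynomial.eval_X]

lemma isHomPoly_imForm {d : ℕ} {X : V K → V K} (hX : IsHomPolyField d X) :
    IsHomPoly (d + 1) (fun u => imForm (X u) u) := by
  simp only [imForm_eq_sum]
  exact IsHomPoly.sum _ fun j _ =>
    ((hX j).2.mul (isHomPoly_re j)).sub ((hX j).1.mul (isHomPoly_im j))

variable {δx : ℝ} [hδ : Fact (0 < δx)]

/-- The restriction of a homogeneous part to the real points is a homogeneous polynomial field. -/
lemma isHomPolyField_realRestr_homPart (n : ℕ) (f : PairSpace K δx → PairSpace K δx) :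
    IsHomPolyField n (realRestr (homPart n f)) := by
  have key : ∀ L : PairSpace K δx →L[ℝ] ℝ,
      IsHomPoly n (fun u => L (homPart n f (realPair K δx u))) := by
    intro L
    have h1 := isHomPoly_multilinear
      ((L.compContinuousMultilinearMap
        (((n.factorial : ℂ)⁻¹ • iteratedFDeriv ℂ n f 0).restrictScalars ℝ)
        |>.compContinuousLinearMap fun _ => realPair K δx).toMultilinearMap)
    exact h1
  intro j
  exact ⟨key (Complex.reCLM.comp ((ContinuousLinearMap.proj j : V K →L[ℝ] ℂ).comp
    ((fstV K δx).restrictScalars ℝ))), key (Complex.imCLM.comp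
      ((ContinuousLinearMap.proj j : V K →L[ℝ] ℂ).comp ((fstV K δx).restrictScalars ℝ)))⟩

end HomPoly

/-! ### The modified Hamiltonian -/

section Hamiltonian

variable {K : ℕ} {δx : ℝ}

variable (K) in
/-- The symplectic form as a continuous bilinear map. -/
def imFormCLM : V K →L[ℝ] V K →L[ℝ] ℝ :=
  LinearMap.toContinuousBilinearMap <| LinearMap.mk₂ ℝ imForm imForm_add_left imForm_smul_left
    imForm_add_right imForm_smul_right

lemma imFormCLM_apply (u v : V K) : imFormCLM K u v = imForm u v := rfl

/-- A function whose differential is represented by `X` has the Hamiltonian field `X`. -/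
lemma hamField_eq (hδ : 0 < δx) {H : V K → ℝ} {u x : V K}
    (h : ∀ w, fderiv ℝ H u w = 2 * δx * imForm x w) : hamField δx H u = x := by
  have hc : (δx : ℂ) ≠ 0 := Complex.ofReal_ne_zero.2 hδ.ne'
  have hs : ∀ (j : Grid K) (a : ℂ), imForm x (Pi.single j a) = (x j * star a).im := fun j a => by
    rw [imForm, Finset.sum_eq_single j]
    · rw [Pi.single_eq_same]
    · intro k _ hk
      rw [Pi.single_eq_of_ne hk, star_zero, mul_zero]
    · simp
  funext j
  rw [hamField, Pi.smul_apply, gradBar, h, h, hs, hs, smul_eq_mul]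
  have h1 : (x j * star (1 : ℂ)).im = (x j).im := by simp
  have h2 : (x j * star Complex.I).im = -(x j).re := by simp
  rw [h1, h2]
  conv_rhs => rw [← Complex.re_add_im (x j)]
  push_cast
  field_simp
  -- The factor 2δx in the hypothesis compensates the δx⁻¹ of the field and the 1/2 in the
  -- derivative with respect to ū.
  linear_combination (-((x j).re : ℂ)) * Complex.I_sq

variable {r : ℕ} {lam : ℝ} (h : ℝ) [hδ : Fact (0 < δx)]

lemma gridField_smul (hlam : lam = 1 ∨ lam = -1) (k : ℕ) (t : ℝ) (u : V K) :
    gridField r lam K δx h hlam k (t • u)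
      = t ^ (2 * r * (k + 1) + 1) • gridField r lam K δx h hlam k u := by
  rw [gridField, realRestr, realRestr, map_smul, MidpointSystem.field_real_smul]
  exact ((fstV K δx).restrictScalars ℝ).map_smul _ _

/-- Euler's identity, obtained by differentiating t ↦ X(tu) at t = 1. -/
lemma fderiv_gridField_self (hlam : lam = 1 ∨ lam = -1) (k : ℕ) (u : V K) :
    fderiv ℝ (gridField r lam K δx h hlam k) u u
      = ((2 * r * (k + 1) + 1 : ℕ) : ℝ) • gridField r lam K δx h hlam k u := by
  have hd := ((contDiff_gridField (r := r) (K := K) (δx := δx) h hlam k).differentiable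
    (by simp) ((1 : ℝ) • u)).hasFDerivAt
  have h1 : HasDerivAt (fun t : ℝ => t • u) u 1 := by
    simpa using (hasDerivAt_id (1 : ℝ)).smul_const u
  have h2 := hd.comp_hasDerivAt (1 : ℝ) h1
  have h3 : HasDerivAt (fun t : ℝ => t ^ (2 * r * (k + 1) + 1) • gridField r lam K δx h hlam k u)
      (((2 * r * (k + 1) + 1 : ℕ) : ℝ) • gridField r lam K δx h hlam k u) 1 := by
    simpa using (hasDerivAt_pow (2 * r * (k + 1) + 1) (1 : ℝ)).smul_const
      (gridField r lam K δx h hlam k u)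
  have h4 : gridField r lam K δx h hlam k ∘ (fun t : ℝ => t • u)
      = fun t : ℝ => t ^ (2 * r * (k + 1) + 1) • gridField r lam K δx h hlam k u :=
    funext fun t => gridField_smul h hlam k t u
  rw [h4, one_smul] at h2
  exact h2.unique h3

/-- The coefficients of the modified Hamiltonian. -/
def gridHam (r : ℕ) (lam : ℝ) (K : ℕ) (δx h : ℝ) [Fact (0 < δx)] (hlam : lam = 1 ∨ lam = -1)
    (k : ℕ) (u : V K) : ℝ :=
  2 * δx / (2 * r * (k + 1) + 2 : ℕ) * imForm (gridField r lam K δx h hlam k u) u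

/-- Homogeneous Poincaré lemma. The derivative of ω(X(u), u) in direction w is ω(X, w) + ω(DX w, u).
As X is Hamiltonian, the second term is -ω(w, DX u), which by Euler's identity is deg X times ω(X,
w). Dividing by deg X + 1 = 2r(k+1)+2 leaves 2δx ω(X, w). -/
lemma hasFDerivAt_gridHam (hr : 1 ≤ r) (hlam : lam = 1 ∨ lam = -1) (k : ℕ) (u : V K) :
    HasFDerivAt (gridHam r lam K δx h hlam k)
      ((2 * δx) • imFormCLM K (gridField r lam K δx h hlam k u)) u := by
  set x := gridField r lam K δx h hlam k with hx
  have hd := ((contDiff_gridField (r := r) (K := K) (δx := δx) h hlam k).differentiable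
    (by simp) u).hasFDerivAt
  rw [← hx] at hd
  have h1 := (imFormCLM K).hasFDerivAt_of_bilinear hd (hasFDerivAt_id u)
  have h2 := h1.const_mul (2 * δx / (2 * r * (k + 1) + 2 : ℕ))
  refine h2.congr_fderiv ?_
  ext w
  have e1 : imForm (fderiv ℝ x u w) u = (2 * r * (k + 1) + 1 : ℕ) * imForm (x u) w := by
    have h3 := imForm_fderiv_gridField (δx := δx) h hr hlam k u w u
    rw [← hx] at h3
    rw [hx, fderiv_gridField_self, ← hx, imForm_smul_right, imForm_swap w] at h3
    linarith
  change 2 * δx / (2 * r * (k + 1) + 2 : ℕ) * (imForm (x u) w + imForm (fderiv ℝ x u w) u)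
    = 2 * δx * imForm (x u) w
  rw [e1]
  push_cast
  have h4 : (2 * (r : ℝ) * (k + 1) + 2) ≠ 0 := by positivity
  field_simp
  ring

/-- The modified Hamiltonian generates the modified vector field. -/
lemma hamField_truncHam_gridHam (hr : 1 ≤ r) (hlam : lam = 1 ∨ lam = -1) (N : ℕ) (t : ℝ) (u : V K) :
    hamField δx (truncHam (gridHam r lam K δx h hlam) N t) u
      = ∑ k ∈ range (N + 1), t ^ k • gridField r lam K δx h hlam k u := by
  refine hamField_eq hδ.out fun w => ?_
  have h1 : HasFDerivAt (truncHam (gridHam r lam K δx h hlam) N t)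
      (∑ k ∈ range (N + 1), t ^ k • ((2 * δx) • imFormCLM K (gridField r lam K δx h hlam k u))) u :=
    HasFDerivAt.fun_sum fun k _ => (hasFDerivAt_gridHam h hr hlam k u).const_mul _
  rw [h1.fderiv, ← imFormCLM_apply, map_sum, _root_.sum_apply, _root_.sum_apply, Finset.mul_sum]
  refine Finset.sum_congr rfl fun k _ => ?_
  simp only [map_smul, _root_.smul_apply, smul_eq_mul]
  ring

lemma isHomPoly_gridHam (hlam : lam = 1 ∨ lam = -1) (k : ℕ) :
    IsHomPoly (2 * r * (k + 1) + 2) (gridHam r lam K δx h hlam k) :=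
  (isHomPoly_imForm (isHomPolyField_realRestr_homPart (2 * r * (k + 1) + 1) _)).const_mul _

lemma dnorm_gridField_le (hlam : lam = 1 ∨ lam = -1) {k : ℕ} {ρ : ℝ}
    (hs : (gridSystem r lam K δx h hlam).Small k ρ) (u : V K) :
    dnorm δx (gridField r lam K δx h hlam k u)
      ≤ 2 / (ρ / 4) ^ (2 * r * (k + 1) + 1) * dnorm δx u ^ (2 * r * (k + 1) + 1) := by
  rw [← norm_realPair u]
  exact (dnorm_realRestr_le _ u).trans (MidpointSystem.norm_field_le hs _)

lemma abs_gridHam_le (hlam : lam = 1 ∨ lam = -1) {k : ℕ} {ρ : ℝ}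
    (hs : (gridSystem r lam K δx h hlam).Small k ρ) (u : V K) :
    |gridHam r lam K δx h hlam k u|
      ≤ 2 / (ρ / 4) ^ (2 * r * (k + 1) + 1) * dnorm δx u ^ (2 * r * (k + 1) + 2) := by
  have h1 := abs_pairing_le hδ.out (gridField r lam K δx h hlam k u) u
  have h2 := dnorm_gridField_le h hlam hs u
  have h3 : gridHam r lam K δx h hlam k u = 2 / (2 * r * (k + 1) + 2 : ℕ)
      * (δx * imForm (gridField r lam K δx h hlam k u) u) := by
    rw [gridHam]; ring
  have h4 : (2 : ℝ) / (2 * r * (k + 1) + 2 : ℕ) ≤ 1 := by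
    rw [div_le_one (by positivity)]
    exact_mod_cast Nat.le_add_left 2 _
  rw [h3, abs_mul, abs_of_nonneg (by positivity : (0 : ℝ) ≤ 2 / (2 * r * (k + 1) + 2 : ℕ))]
  calc _ ≤ 1 * (dnorm δx (gridField r lam K δx h hlam k u) * dnorm δx u) :=
        mul_le_mul h4 h1 (abs_nonneg _) zero_le_one
    _ ≤ 2 / (ρ / 4) ^ (2 * r * (k + 1) + 1) * dnorm δx u ^ (2 * r * (k + 1) + 1) * dnorm δx u := by
        rw [one_mul]
        exact mul_le_mul_of_nonneg_right h2 (dnorm_nonneg u)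
    _ = _ := by ring

/-- The outer resolvent moves to the other argument as (1 - ihA/2)⁻¹, leaving ω(i f(w), w) = λ ∑
|w_j|^(2r+2); the prefactor 2/(2r+2) is 1/(r+1). -/
lemma gridHam_zero (hr : 1 ≤ r) (hlam : lam = 1 ∨ lam = -1) (u : V K) :
    gridHam r lam K δx h hlam 0 u = P0 r lam δx h u := by
  set w := (opMinus K δx h)⁻¹ *ᵥ u with hw
  have h1 : imForm (gridField r lam K δx h hlam 0 u) u
      = imForm (Complex.I • nonlin r lam w) w := by
    rw [gridField_zero h hr hlam]
    have h3 := sum_mulVec_mul (opPlus_inv_transpose (K := K) (δx := δx) h)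
      (Complex.I • nonlin r lam w) (star u)
    rw [← star_opMinus_inv] at h3
    exact congrArg Complex.im h3
  have h2 : imForm (Complex.I • nonlin r lam w) w = lam * ∑ j, ‖w j‖ ^ (2 * r + 2) := by
    rw [imForm, Complex.im_sum, Finset.mul_sum]
    refine Finset.sum_congr rfl fun j _ => ?_
    have e : (Complex.I • nonlin r lam w) j * star (w j)
        = Complex.I * ((lam * ‖w j‖ ^ (2 * r + 2) : ℝ) : ℂ) := by
      have e1 : w j * star (w j) = ((‖w j‖ ^ 2 : ℝ) : ℂ) := by
        rw [Complex.star_def, Complex.mul_conj, Complex.normSq_eq_norm_sq]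
      rw [Pi.smul_apply, smul_eq_mul, nonlin, mul_assoc, mul_assoc, e1, pow_add]
      push_cast
      ring
    rw [e, Complex.I_mul_im, Complex.ofReal_re]
  rw [gridHam, h1, h2, P0, nonlinEnergy, ← hw]
  push_cast
  have h4 : (r : ℝ) + 1 ≠ 0 := by positivity
  have h5 : 2 * (r : ℝ) * 1 + 2 = 2 * (r + 1) := by ring
  rw [h5]
  field_simp

end Hamiltonian

end MidpointNLS

end

noncomputable section

namespace MidpointNLS

open Finset Filter Topology
open scoped ContDiff

/-! ### Backward error analysis on the grid -/

section BackwardError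

variable {r : ℕ} {lam : ℝ} {K : ℕ} {δx : ℝ} (h : ℝ) [hδ : Fact (0 < δx)]

/-- The coefficients of the remainder series. -/
def gridRem (r : ℕ) (lam : ℝ) (K : ℕ) (δx h : ℝ) [Fact (0 < δx)] (hlam : lam = 1 ∨ lam = -1)
    (N l : ℕ) : V K → V K :=
  realRestr (homPart (2 * r * l + 1) ((gridSystem r lam K δx h hlam).defect N))

lemma dnorm_gridRem_le (hlam : lam = 1 ∨ lam = -1) {N : ℕ} {ρ : ℝ}
    (hs : (gridSystem r lam K δx h hlam).Small N ρ) (l : ℕ) (u : V K) :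
    dnorm δx (gridRem r lam K δx h hlam N l u)
      ≤ 2 / (ρ / 4) * (((ρ / 4) ^ (2 * r))⁻¹) ^ l * dnorm δx u ^ (2 * r * l + 1) := by
  have hρ := hs.pos
  have h1 : 2 / (ρ / 4) * (((ρ / 4) ^ (2 * r))⁻¹) ^ l = 2 / (ρ / 4) ^ (2 * r * l + 1) := by
    rw [inv_pow, ← pow_mul, pow_succ]
    field_simp
  rw [h1, ← norm_realPair u]
  exact (dnorm_realRestr_le _ u).trans (hs.norm_homPart_defect_le _ _)

lemma pairOp_realPair (u : V K) :
    pairOp K δx (opPlus K δx h) (opMinus K δx h) (realPair K δx u)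
      = realPair K δx (plusCLM K δx h u) := by
  refine pair_ext ?_ ?_
  · rw [fstV_pairOp, fstV_realPair, fstV_realPair, plusCLM_apply]
  · rw [sndV_pairOp, sndV_realPair, sndV_realPair, plusCLM_apply, Matrix.star_mulVec,
      opPlus_conjTranspose, ← Matrix.mulVec_transpose, opMinus_transpose]

/-- The scheme on real points solves the fixed-point equation. -/
lemma fstV_scheme_eq (hr : 1 ≤ r) (hlam : lam = 1 ∨ lam = -1) {ρ : ℝ}
    (hg : HalfLip (gridSystem r lam K δx h hlam).g ρ) {u : V K} (hu : 2 * dnorm δx u ≤ ρ) :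
    realPair K δx (fstV K δx ((gridSystem r lam K δx h hlam).scheme (realPair K δx u)))
        = (gridSystem r lam K δx h hlam).scheme (realPair K δx u) ∧
    fstV K δx ((gridSystem r lam K δx h hlam).scheme (realPair K δx u))
      = u + gridField r lam K δx h hlam 0 (stageCLM K δx h
        (u, fstV K δx ((gridSystem r lam K δx h hlam).scheme (realPair K δx u)))) := by
  set s := gridSystem r lam K δx h hlam with hs
  set X := realPair K δx u with hX
  have hXn : 2 * ‖X‖ ≤ ρ := by rwa [hX, norm_realPair]
  have hreal : realPair K δx (fstV K δx (s.scheme X)) = s.scheme X := by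
    refine (eq_realPair_of_conjPair_eq ?_).symm
    rw [← s.scheme_equivariant hg (conjPair K δx) norm_conjPair (gridSystem_g_conjPair h hlam)
      (gridSystem_T_conjPair h hlam) hXn, hX, conjPair_realPair]
  refine ⟨hreal, ?_⟩
  set w := fstV K δx (s.scheme X) with hw
  have hstage : s.stage X = realPair K δx (stageCLM K δx h (u, w)) := by
    have h1 : s.S (s.scheme X - X) = s.g (s.stage X) := by
      rw [MidpointSystem.scheme, add_sub_cancel_left, s.S_T]
    have h2 := s.stage_eq hg hXn
    rw [← h1, ← hreal, hX, ← map_sub] at h2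
    have h3 : s.S (realPair K δx (w - u)) = realPair K δx (plusCLM K δx h (w - u)) :=
      pairOp_realPair h _
    rw [h3] at h2
    rw [h2, stageCLM_apply, map_add, map_smul, ← Complex.coe_smul]
    norm_num
  have h4 : s.scheme X = X + s.field 0 (s.stage X) := by
    rw [s.field_zero hr (by positivity), MidpointSystem.scheme]
  have h5 : w = u + fstV K δx (s.field 0 (s.stage X)) := by
    rw [hw, h4, map_add, hX, fstV_realPair]
  rw [hstage] at h5
  exact h5

variable {h}

/-- Scaling by z with z^(2r) = h turns unit nonlinear step into step h, and `norm_scheme_le` puts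
the result in the ball of radius 2‖u‖, where the fixed point is unique. The h inside the resolvents
is untouched. -/
lemma Psi_eq_scheme (hr : 1 ≤ r) (hlam : lam = 1 ∨ lam = -1) {z : ℝ} (hz : 0 < z)
    (hzh : z ^ (2 * r) = h) {ρ : ℝ} (hg : HalfLip (gridSystem r lam K δx h hlam).g ρ) {u : V K}
    (hu : 2 * (z * dnorm δx u) ≤ ρ) (hp : u ∈ permissible r lam K δx h h) :
    Psi r lam δx h h u
      = z⁻¹ • fstV K δx ((gridSystem r lam K δx h hlam).scheme (z • realPair K δx u)) := by
  set s := gridSystem r lam K δx h hlam with hs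
  have hdz : dnorm δx (z • u) = z * dnorm δx u := by
    rw [← Complex.coe_smul, dnorm_smul hδ.out, Complex.norm_real, Real.norm_of_nonneg hz.le]
  obtain ⟨-, h2⟩ := fstV_scheme_eq h hr hlam hg (u := z • u) (by rwa [hdz])
  rw [map_smul, ← hs] at h2
  set w := fstV K δx (s.scheme (z • realPair K δx u)) with hw
  refine ((eq_Psi_iff hδ.out hp _).2 ⟨?_, ?_⟩).symm
  · have h3 : ‖s.scheme (z • realPair K δx u)‖ ≤ 2 * ‖z • realPair K δx u‖ :=
      s.norm_scheme_le hg (by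
        rwa [norm_smul, norm_realPair, Real.norm_of_nonneg hz.le])
    rw [norm_smul, norm_realPair, Real.norm_of_nonneg hz.le] at h3
    have h4 : dnorm δx w ≤ 2 * (z * dnorm δx u) := (dnorm_fstV_le _).trans h3
    change dnorm δx (z⁻¹ • w) ≤ _
    rw [← Complex.coe_smul, dnorm_smul hδ.out, Complex.norm_real,
      Real.norm_of_nonneg (inv_nonneg.2 hz.le), inv_mul_le_iff₀ hz]
    linarith
  · have h5 : stageCLM K δx h (z • u, w) = z • stageCLM K δx h (u, z⁻¹ • w) := by
      rw [← map_smul, Prod.smul_mk, smul_inv_smul₀ hz.ne']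
    rw [h5, gridField_smul, zero_add, mul_one, pow_succ, hzh, mul_comm, mul_smul, ← smul_add] at h2
    rw [fixMap_eq h h hr hlam]
    conv_rhs => rw [h2]
    rw [inv_smul_smul₀ hz.ne']

lemma fieldSum_smul_realPair (hlam : lam = 1 ∨ lam = -1) {z : ℝ} (hzh : z ^ (2 * r) = h) (N : ℕ)
    (u : V K) : fstV K δx ((gridSystem r lam K δx h hlam).fieldSum (N + 1) (z • realPair K δx u))
      = (z * h) • ∑ k ∈ range (N + 1), h ^ k • gridField r lam K δx h hlam k u := by
  rw [MidpointSystem.fieldSum_eq_sum, map_sum, Finset.smul_sum]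
  refine Finset.sum_congr rfl fun k _ => ?_
  have h1 : z ^ (2 * r * (k + 1) + 1) = z * h * h ^ k := by
    rw [pow_succ, pow_mul, hzh]; ring
  rw [MidpointSystem.field_real_smul, h1, smul_smul]
  exact ((fstV K δx).restrictScalars ℝ).map_smul _ _

/-- If Y is the unit-time orbit from zu, then t ↦ z⁻¹Y(t/h) solves the Hamiltonian equation: the
degree 2r(k+1)+1 coefficient scales by z h h^k, leaving exactly the weight h^k. -/
lemma isFlowValue_flowOne (hr : 1 ≤ r) (hlam : lam = 1 ∨ lam = -1) {z : ℝ} (hz : 0 < z)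
    (hzh : z ^ (2 * r) = h) {N : ℕ} {ρ : ℝ}
    (hs : (gridSystem r lam K δx h hlam).Small (N + 1) ρ) {u : V K}
    (hu : 2 * (z * dnorm δx u) ≤ ρ) :
    IsFlowValue (hamField δx (truncHam (gridHam r lam K δx h hlam) N h)) h u
      (z⁻¹ • fstV K δx (flowOne ((gridSystem r lam K δx h hlam).fieldSum (N + 1))
        (z • realPair K δx u))) := by
  set s := gridSystem r lam K δx h hlam with hsd
  have hh : 0 < h := hzh ▸ pow_pos hz _
  set X := s.fieldSum (N + 1) with hX
  set x := z • realPair K δx u with hx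
  have hxn : 2 * ‖x‖ ≤ ρ := by
    rwa [hx, norm_smul, norm_realPair, Real.norm_of_nonneg hz.le]
  have hc : Continuous X := (s.smoothField_fieldSum (N + 1)).cont
  set Y := extendCurve (flowCurve X x) with hY
  have hconj : conjPair K δx x = x := by rw [hx, map_smul, conjPair_realPair]
  -- The orbit of a real point is real, by conjugation equivariance of the field.
  have hYreal : ∀ t ∈ Set.Icc (0 : ℝ) 1, Y t = realPair K δx (fstV K δx (Y t)) := fun t ht => by
    refine eq_realPair_of_conjPair_eq ?_
    rw [hY, extendCurve_apply _ ht, ← flowCurve_equivariant hs.fieldSum hc (conjPair K δx)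
      norm_conjPair (s.fieldSum_equivariant (small_gridSystem h hr hlam) _ norm_conjPair
        (gridSystem_g_conjPair h hlam) (gridSystem_T_conjPair h hlam) (N + 1)) hxn, hconj]
  set L : PairSpace K δx →L[ℝ] V K := (fstV K δx).restrictScalars ℝ with hL
  refine ⟨fun t => z⁻¹ • L (Y (h⁻¹ * t)), ?_, ?_, fun t ht => ?_⟩
  · simp only
    rw [mul_zero, hY, extendCurve_apply _ (by simp)]
    change z⁻¹ • fstV K δx (flowCurve X x 0) = u
    rw [flowCurve_zero hs.fieldSum hc hxn, hx, ← (realPair K δx).map_smul, fstV_realPair,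
      inv_smul_smul₀ hz.ne']
  · simp only
    rw [inv_mul_cancel₀ hh.ne', hY, extendCurve_apply _ (by simp)]
    rfl
  · have hmaps : Set.MapsTo (fun t : ℝ => h⁻¹ * t) (Set.Icc 0 h) (Set.Icc 0 1) := fun τ hτ =>
      ⟨mul_nonneg (inv_nonneg.2 hh.le) hτ.1, by
        rw [inv_mul_le_iff₀ hh, mul_one]; exact hτ.2⟩
    have h1 := hasDerivWithinAt_flowCurve hs.fieldSum hc hxn (hmaps ht)
    rw [← hY] at h1
    have h2 : HasDerivWithinAt (fun t : ℝ => h⁻¹ * t) h⁻¹ (Set.Icc 0 h) t := by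
      simpa using ((hasDerivAt_id t).const_mul h⁻¹).hasDerivWithinAt
    have h3 := (L.hasFDerivAt.comp_hasDerivWithinAt t (h1.scomp t h2 hmaps)).const_smul z⁻¹
    refine h3.congr_deriv ?_
    rw [hamField_truncHam_gridHam h hr hlam]
    set v := fstV K δx (Y (h⁻¹ * t)) with hv
    have hy : Y (h⁻¹ * t) = z • realPair K δx (z⁻¹ • v) := by
      rw [map_smul, smul_inv_smul₀ hz.ne']; exact hYreal _ (hmaps ht)
    have h4 : L (X (Y (h⁻¹ * t)))
        = (z * h) • ∑ k ∈ range (N + 1), h ^ k • gridField r lam K δx h hlam k (z⁻¹ • v) := by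
      rw [hy]; exact fieldSum_smul_realPair hlam hzh N _
    rw [map_smul, h4, smul_smul, smul_smul]
    have h5 : z⁻¹ * h⁻¹ * (z * h) = 1 := by field_simp
    rw [h5, one_smul]
    rfl

/-- The Taylor series of the defect at zu, reindexed: only degrees 2rl+1 with l ≥ N+1 survive, and
z⁻¹z^(2rl+1) = h^l. -/
lemma hasSum_gridRem (hr : 1 ≤ r) (hlam : lam = 1 ∨ lam = -1) {z : ℝ} (hz : 0 < z)
    (hzh : z ^ (2 * r) = h) {N : ℕ} {ρ : ℝ}
    (hs : (gridSystem r lam K δx h hlam).Small N ρ) {u : V K}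
    (hu : 2 * (z * dnorm δx u) < ρ) :
    HasSum (fun m : ℕ => h ^ (N + 1 + m) • gridRem r lam K δx h hlam N (N + 1 + m) u)
      (z⁻¹ • fstV K δx ((gridSystem r lam K δx h hlam).defect N (z • realPair K δx u))) := by
  set s := gridSystem r lam K δx h hlam with hsd
  have hxn : 2 * ‖z • realPair K δx u‖ < ρ := by
    rwa [norm_smul, norm_realPair, Real.norm_of_nonneg hz.le]
  set L : PairSpace K δx →L[ℝ] V K := z⁻¹ • (fstV K δx).restrictScalars ℝ with hL
  have h1 := L.hasSum (hs.hasSum_homPart_defect hxn)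
  set i : ℕ → ℕ := fun m => 2 * r * (N + 1 + m) + 1 with hi
  have hinj : Function.Injective i := fun a b hab => by
    have h2 : 2 * r * (N + 1 + a) = 2 * r * (N + 1 + b) := Nat.succ_injective hab
    have h3 := Nat.eq_of_mul_eq_mul_left (by omega) h2
    omega
  have hzero : ∀ n, n ∉ Set.range i → L (homPart n (s.defect N) (z • realPair K δx u)) = 0 := by
    intro n hn
    rcases le_or_gt n (2 * r * N + 1) with hle | hlt
    · rw [s.homPart_defect_eq_zero_of_le hr (by positivity) N n hle, map_zero]
    · rw [s.homPart_defect_eq_zero hr (small_gridSystem h hr hlam), map_zero]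
      rintro l rfl
      have h2 : N + 1 ≤ l := by
        by_contra hcon
        have : 2 * r * l ≤ 2 * r * N := Nat.mul_le_mul_left _ (by omega)
        omega
      exact hn ⟨l - (N + 1), by rw [hi]; simp only; rw [Nat.add_sub_cancel' h2]⟩
  have h2 := (hinj.hasSum_iff hzero).2 h1
  have h3 : (fun m : ℕ => h ^ (N + 1 + m) • gridRem r lam K δx h hlam N (N + 1 + m) u)
      = (fun n => L (homPart n (s.defect N) (z • realPair K δx u))) ∘ i := by
    funext m
    have h4 : z ^ (2 * r * (N + 1 + m) + 1) = h ^ (N + 1 + m) * z := by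
      rw [pow_succ, pow_mul, hzh]
    have h5 : L (z • homPart (i m) (s.defect N) (realPair K δx u))
        = fstV K δx (homPart (i m) (s.defect N) (realPair K δx u)) := by
      rw [map_smul]
      exact smul_inv_smul₀ hz.ne' _
    rw [Function.comp_apply, homPart_real_smul, h4, mul_smul, map_smul, h5]
    rfl
  rw [h3]
  exact h2

lemma Psi_zero {u : V K} (hp : u ∈ permissible r lam K δx 0 0) : Psi r lam δx 0 0 u = u := by
  refine ((eq_Psi_iff hδ.out hp _).2 ⟨?_, ?_⟩).symm
  · change dnorm δx u ≤ 2 * dnorm δx u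
    linarith [dnorm_nonneg (δx := δx) u]
  · rw [fixMap, Complex.ofReal_zero, mul_zero, zero_smul, add_zero]

end BackwardError

/-- Backward error analysis of the midpoint scheme: the coefficients of the modified Hamiltonian
and the expansion of the difference of the scheme and the flow of the truncated Hamiltonian. -/
theorem exists_modified_hamiltonian (r : ℕ) (hr : 1 ≤ r) (lam : ℝ) (hlam : lam = 1 ∨ lam = -1) :
    ∃ P : (K : ℕ) → (δx h : ℝ) → (k : ℕ) → V K → ℝ,
      (∀ (K : ℕ) (δx h : ℝ), 0 < δx → 0 ≤ h →
        (∀ u, P K δx h 0 u = P0 r lam δx h u) ∧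
        ∀ k : ℕ, IsHomPoly (2 * r * (k + 1) + 2) (P K δx h k)) ∧
      (∃ C : ℕ → ℝ, (∀ k, 0 < C k) ∧
        ∀ (K : ℕ) (δx h : ℝ), 0 < δx → 0 ≤ h → ∀ (k : ℕ) (u : V K),
          |P K δx h k u| ≤ C k * dnorm δx u ^ (2 * r * (k + 1) + 2)) ∧
      ∀ N : ℕ, ∃ Ctilde C : ℝ, 0 < Ctilde ∧ 0 < C ∧
        ∃ Rem : (K : ℕ) → (δx h : ℝ) → (l : ℕ) → V K → V K,
          (∀ (K : ℕ) (δx h : ℝ), 0 < δx → 0 ≤ h → ∀ l : ℕ, N + 2 ≤ l →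
            IsHomPolyField (2 * r * l + 1) (Rem K δx h l) ∧
            ∀ u : V K, dnorm δx (Rem K δx h l u) ≤
              Ctilde * C ^ l * dnorm δx u ^ (2 * r * l + 1)) ∧
          ∀ R : ℝ, 0 < R → ∃ τ : ℝ, 0 < τ ∧
            ∀ (K : ℕ) (δx h : ℝ), 0 < δx → 0 ≤ h → h < τ →
              ∀ u ∈ dball K δx R,
                u ∈ permissible r lam K δx h h ∧
                ∃ v : V K, IsFlowValue (hamField δx (truncHam (P K δx h) N h)) h u v ∧
                  HasSum (fun m : ℕ => h ^ (N + 2 + m) • Rem K δx h (N + 2 + m) u)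
                    (Psi r lam δx h h u - v) := by
  classical
  have hC : (0 : ℝ) ≤ 4 ^ r := by positivity
  choose ρ hρ hsmall using fun N => MidpointSystem.exists_small hr hC N
  set P : (K : ℕ) → (δx h : ℝ) → (k : ℕ) → V K → ℝ := fun K δx h =>
    if hδ : 0 < δx then haveI := Fact.mk hδ; gridHam r lam K δx h hlam else fun _ _ => 0 with hP
  have hPeq : ∀ (K : ℕ) (δx h : ℝ) [hδ : Fact (0 < δx)],
      P K δx h = gridHam r lam K δx h hlam := fun K δx h hδ => by
    rw [hP]; exact dif_pos hδ.out
  refine ⟨P, fun K δx h hδ _ => ?_, ⟨fun k => 2 / (ρ k / 4) ^ (2 * r * (k + 1) + 1),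
    fun k => ?_, fun K δx h hδ _ k u => ?_⟩, fun N => ?_⟩
  · have := Fact.mk hδ
    rw [hPeq]
    exact ⟨gridHam_zero h hr hlam, isHomPoly_gridHam h hlam⟩
  · have := hρ k
    positivity
  · have := Fact.mk hδ
    rw [hPeq]
    exact abs_gridHam_le h hlam (hsmall k _ _) u
  -- The Hamiltonian truncated at h^N has N + 1 coefficients, so it matches `fieldSum (N + 1)` and
  -- the remainder starts at l = N + 2.
  set p := ρ (N + 1) with hp
  have hp0 : 0 < p := hρ (N + 1)
  set Rem : (K : ℕ) → (δx h : ℝ) → (l : ℕ) → V K → V K := fun K δx h =>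
    if hδ : 0 < δx then haveI := Fact.mk hδ; gridRem r lam K δx h hlam (N + 1) else fun _ _ => 0
    with hRem
  have hRemeq : ∀ (K : ℕ) (δx h : ℝ) [hδ : Fact (0 < δx)],
      Rem K δx h = gridRem r lam K δx h hlam (N + 1) := fun K δx h hδ => by
    rw [hRem]; exact dif_pos hδ.out
  refine ⟨2 / (p / 4), ((p / 4) ^ (2 * r))⁻¹, by positivity, by positivity, Rem,
    fun K δx h hδ _ l _ => ?_, fun R hR => ?_⟩
  · have := Fact.mk hδ
    rw [hRemeq]
    exact ⟨isHomPolyField_realRestr_homPart _ _, dnorm_gridRem_le h hlam (hsmall (N + 1) _ _) l⟩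
  obtain ⟨c, hc, hperm⟩ := exists_permissible_const hr hlam
  -- The first bound gives h R^(2r) < c, hence permissibility; the second gives 2zR < p for z^(2r) =
  -- h, so the rescaled point lies in the ball of analyticity.
  refine ⟨min (c / R ^ (2 * r)) (p ^ (2 * r) / (2 * R) ^ (2 * r)), by positivity,
    fun K δx h hδ hh hlt u hu => ?_⟩
  have := Fact.mk hδ
  have huR : dnorm δx u ≤ R := hu
  have hu0 := dnorm_nonneg (δx := δx) u
  have hup : u ∈ permissible r lam K δx h h := by
    refine hperm K δx h h hδ hh hh u ?_
    have h1 := (lt_div_iff₀ (by positivity)).1 (lt_of_lt_of_le hlt (min_le_left _ _))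
    exact le_trans (by gcongr) h1.le
  refine ⟨hup, ?_⟩
  rw [hPeq, hRemeq]
  -- For h = 0 no rescaling is possible: Ψ is the identity, the time interval is a point with no
  -- derivative condition, and every remainder term vanishes.
  rcases hh.eq_or_lt with rfl | hh0
  · refine ⟨u, ⟨fun _ => u, rfl, rfl, fun s hs => ?_⟩, ?_⟩
    · refine HasFDerivWithinAt.of_not_accPt fun hacc => ?_
      rw [Set.Icc_self, accPt_iff_clusterPt, inf_principal] at hacc
      obtain rfl : s = 0 := by simpa using hs
      exact NeBot.ne hacc (by simp)
    · rw [Psi_zero hup, sub_self]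
      convert hasSum_zero with m
      rw [zero_pow (by omega), zero_smul]
  set z : ℝ := h ^ (((2 * r : ℕ) : ℝ)⁻¹) with hz
  have hz0 : 0 < z := Real.rpow_pos_of_pos hh0 _
  have hzh : z ^ (2 * r) = h := Real.rpow_inv_natCast_pow hh (by omega)
  have hzu : 2 * (z * dnorm δx u) < p := by
    have h1 := (lt_div_iff₀ (by positivity)).1 (lt_of_lt_of_le hlt (min_le_right _ _))
    rw [← hzh, ← mul_pow] at h1
    have h2 := lt_of_pow_lt_pow_left₀ _ hp0.le h1
    calc 2 * (z * dnorm δx u) ≤ 2 * (z * R) := by gcongr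
      _ = z * (2 * R) := by ring
      _ < p := h2
  have hs := hsmall (N + 1) _ (gridSystem r lam K δx h hlam)
  refine ⟨_, isFlowValue_flowOne hr hlam hz0 hzh hs hzu.le, ?_⟩
  rw [Psi_eq_scheme hr hlam hz0 hzh hs.g hzu.le hup, ← smul_sub, ← map_sub]
  exact hasSum_gridRem hr hlam hz0 hzh hs hzu

end MidpointNLS

end

theorem proposition3p3 (r : ℕ) (hr : 1 ≤ r) (lam : ℝ) (hlam : lam = 1 ∨ lam = -1) :
    -- the map `Ψ^h_ε` is well defined at every permissible `u`, and symplectic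
    ((∃ c : ℝ, 0 < c ∧ ∀ (K : ℕ) (δx h ε : ℝ), 0 < δx → 0 ≤ h → 0 ≤ ε →
        ∀ u : MidpointNLS.V K, ε * MidpointNLS.dnorm δx u ^ (2 * r) ≤ c →
          u ∈ MidpointNLS.permissible r lam K δx ε h) ∧
      ∀ (K : ℕ) (δx h ε : ℝ), 0 < δx → 0 ≤ h → 0 ≤ ε →
        (∀ u ∈ MidpointNLS.permissible r lam K δx ε h, ∀ v : MidpointNLS.V K,
          v = MidpointNLS.Psi r lam δx ε h u ↔
            (v ∈ MidpointNLS.dball K δx (2 * MidpointNLS.dnorm δx u) ∧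
              MidpointNLS.fixMap r lam δx ε h u v = v)) ∧
        ∀ u ∈ interior (MidpointNLS.permissible r lam K δx ε h),
          MidpointNLS.IsSymplecticAt (MidpointNLS.Psi r lam δx ε h) u) ∧
    -- the coefficients `P_{k,h}` of the formal Hamiltonian, with constants depending on `k` only
    ∃ P : (K : ℕ) → (δx h : ℝ) → (k : ℕ) → MidpointNLS.V K → ℝ,
      (∀ (K : ℕ) (δx h : ℝ), 0 < δx → 0 ≤ h →
        (∀ u, P K δx h 0 u = MidpointNLS.P0 r lam δx h u) ∧
        ∀ k : ℕ, MidpointNLS.IsHomPoly (2 * r * (k + 1) + 2) (P K δx h k)) ∧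
      (∃ C : ℕ → ℝ, (∀ k, 0 < C k) ∧
        ∀ (K : ℕ) (δx h : ℝ), 0 < δx → 0 ≤ h → ∀ (k : ℕ) (u : MidpointNLS.V K),
          |P K δx h k u| ≤ C k * MidpointNLS.dnorm δx u ^ (2 * r * (k + 1) + 2)) ∧
      -- `Ψ^h` and the flow of the truncated Hamiltonian
      ∀ N : ℕ, ∃ Ctilde C : ℝ, 0 < Ctilde ∧ 0 < C ∧
        ∃ Rem : (K : ℕ) → (δx h : ℝ) → (l : ℕ) → MidpointNLS.V K → MidpointNLS.V K,
          (∀ (K : ℕ) (δx h : ℝ), 0 < δx → 0 ≤ h → ∀ l : ℕ, N + 2 ≤ l →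
            MidpointNLS.IsHomPolyField (2 * r * l + 1) (Rem K δx h l) ∧
            ∀ u : MidpointNLS.V K, MidpointNLS.dnorm δx (Rem K δx h l u) ≤
              Ctilde * C ^ l * MidpointNLS.dnorm δx u ^ (2 * r * l + 1)) ∧
          ∀ R : ℝ, 0 < R → ∃ τ : ℝ, 0 < τ ∧
            ∀ (K : ℕ) (δx h : ℝ), 0 < δx → 0 ≤ h → h < τ →
              ∀ u ∈ MidpointNLS.dball K δx R,
                u ∈ MidpointNLS.permissible r lam K δx h h ∧
                ∃ v : MidpointNLS.V K,
                  MidpointNLS.IsFlowValue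
                    (MidpointNLS.hamField δx (MidpointNLS.truncHam (P K δx h) N h)) h u v ∧
                  HasSum (fun m : ℕ => h ^ (N + 2 + m) • Rem K δx h (N + 2 + m) u)
                    (MidpointNLS.Psi r lam δx h h u - v) :=
  ⟨⟨MidpointNLS.exists_permissible_const hr hlam, fun K _ h ε hδ _ hε =>
    ⟨fun _ hu => MidpointNLS.eq_Psi_iff hδ hu, fun _ hu =>
      have : Fact _ := Fact.mk hδ
      MidpointNLS.isSymplecticAt_Psi (K := K) (h := h) (ε := ε) hr hlam hε hu⟩⟩,
    MidpointNLS.exists_modified_hamiltonian r hr lam hlam⟩
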